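/- Let $l>0$, let $V\in L^2[0,l]$ be real-valued, and let $\alpha,\beta,\theta\in\mathbb R$ with $\beta\neq0$. Let $\mathcal H=\bigoplus_{(m,n)\in\mathbb Z^2}\big(L^2[0,l]\oplus L^2[0,l]\big)$ be the Hilbert space of the square lattice graph, with elements $\phi=(\phi_{m,n,r},\phi_{m,n,u})$, where the edge $(m,n,r)$ joins the node $(m,n)$ to $(m+1,n)$ and the edge $(m,n,u)$ joins $(m,n)$ to $(m,n+1)$. Let $\Lambda$ be the self-adjoint operator in $\mathcal H$ acting on each edge as $\phi\mapsto-\phi''+V\phi$, on those $\phi\in\mathcal H$ with all components in $H^2[0,l]$ and with $(-\phi_e''+V\phi_e)_e\in\mathcal H$ that satisfy, for all $m,n\in\mathbb Z$, $$\phi_{m,n}:=\phi_{m,n,r}(0)=\tfrac1\beta\phi_{m,n,u}(0)=e^{-i\pi n\theta}\phi_{m-1,n,r}(l)=\tfrac1\beta e^{i\pi m\theta}\phi_{m,n-1,u}(l),$$ $$\phi'_{m,n,r}(0)+\beta\phi'_{m,n,u}(0)-e^{-i\pi n\theta}\phi'_{m-1,n,r}(l)-\beta e^{i\pi m\theta}\phi'_{m,n-1,u}(l)=\alpha\,\phi_{m,n}.$$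 Let $D$ be the operator $f\mapsto-f''+Vf$ in $L^2[0,l]$ with domain $\{f\in H^2[0,l]: f(0)=f(l)=0\}$; its eigenvalues $\mu_0<\mu_1<\dots$ are called the Dirichlet eigenvalues. Let $M(\theta,\beta)$ be the bounded operator in $\ell^2(\mathbb Z^2)$ given by $$(M(\theta,\beta)g)_{m,n}=e^{i\pi n\theta}g_{m+1,n}+e^{-i\pi n\theta}g_{m-1,n}+\beta^2\big(e^{-i\pi m\theta}g_{m,n+1}+e^{i\pi m\theta}g_{m,n-1}\big).$$ For $z\in\mathbb C$ let $u_1(\cdot;z),u_2(\cdot;z)\in H^2[0,l]$ be the solutions of $-u''+Vu=zu$ with $u_1(0;z)=0$, $u_1'(0;z)=1$ and $u_2(0;z)=1$, $u_2'(0;z)=0$. Put $$\eta(z)=(1+\beta^2)\big(u_1'(l;z)+u_2(l;z)\big)+\alpha u_1(l;z),\qquad \Sigma=\{x\in\mathbb R:\eta(x)\in\operatorname{spec}M(\theta,\beta)\}.$$ A gap of a closed set $S\subseteq\mathbb R$ is a bounded connected component $(a,b)$ of $\mathbb R\setminus S$, with $a<b$ and $a,b\in S$. If $\theta$ is not an integer,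 then: 1. the spectrum of $\Lambda$ has infinitely many gaps; 2. every Dirichlet eigenvalue $\mu_k$ lies inside a gap $(a,b)$ of $\Sigma$, and $\mu_k$ is the only point of the spectrum of $\Lambda$ in $(a,b)$, that is, $(a,b)\cap\operatorname{spec}\Lambda=\{\mu_k\}$; 3. $\|M(\theta,\beta)\|<2(1+\beta^2)$, and $|\eta(\mu_k)|\ge2(1+\beta^2)$ for every $k$. -/

import Mathlib

open MeasureTheory Set

noncomputable section

namespace MagneticLattice

/-! ### Spectrum and eigenvalues of an unbounded operator -/

section Operators

variable {E : Type*} [NormedAddCommGroup E] [NormedSpace ℂ E]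

/-- `z` is in the resolvent set of `T`: the operator `T - z` is a bijection from `dom T` onto the
whole space with bounded inverse `R`. -/
def IsResolventPoint (T : E →ₗ.[ℂ] E) (z : ℂ) : Prop :=
  ∃ R : E →L[ℂ] E,
    (∀ g : E, ∃ h : R g ∈ T.domain, T ⟨R g, h⟩ - z • R g = g) ∧
    (∀ x : T.domain, R (T x - z • (x : E)) = x)

/-- The spectrum of `T` on the real axis (all of the spectrum if `T` is self-adjoint). -/
def realSpec (T : E →ₗ.[ℂ] E) : Set ℝ :=
  {x : ℝ | ¬ IsResolventPoint T (x : ℂ)}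

/-- `z` is an eigenvalue of `T`. -/
def IsEigenvalue (T : E →ₗ.[ℂ] E) (z : ℂ) : Prop :=
  ∃ x : T.domain, (x : E) ≠ 0 ∧ T x = z • (x : E)

end Operators

/-- `(a, b)` is a gap of the closed set `S ⊆ ℝ`: a bounded connected component of `ℝ \ S`. -/
def IsGap (S : Set ℝ) (a b : ℝ) : Prop :=
  a < b ∧ a ∈ S ∧ b ∈ S ∧ Disjoint (Ioo a b) S

/-! ### The Sobolev space `H²[0,l]` -/

/-- Lebesgue measure on `[0,l]`. -/
abbrev edgeMeasure (l : ℝ) : Measure ℝ := volume.restrict (Icc 0 l)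

/-- The space `L²[0,l]`. -/
abbrev EdgeL2 (l : ℝ) : Type := Lp ℂ 2 (edgeMeasure l)

/-- `u ∈ H²[0,l]` with derivatives `u' = v` and `u'' = w`: `w ∈ L²[0,l]`, and on `[0,l]` the
function `v` is a primitive of `w` and `u` is a primitive of `v`. -/
structure IsH2 (l : ℝ) (u v w : ℝ → ℂ) : Prop where
  memLp : MemLp w 2 (edgeMeasure l)
  deriv_eq : ∀ t ∈ Icc (0 : ℝ) l, v t = v 0 + ∫ s in (0 : ℝ)..t, w s
  fun_eq : ∀ t ∈ Icc (0 : ℝ) l, u t = u 0 + ∫ s in (0 : ℝ)..t, v s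

/-- `u ∈ H²[0,l]` (with `u' = v`, `u'' = w`) represents `f ∈ L²[0,l]`, and `-u'' + V u`
represents `g ∈ L²[0,l]`. -/
structure Represents (l : ℝ) (V : ℝ → ℝ) (f g : EdgeL2 l) (u v w : ℝ → ℂ) : Prop where
  isH2 : IsH2 l u v w
  left : f =ᵐ[edgeMeasure l] u
  right : g =ᵐ[edgeMeasure l] fun t => -w t + (V t : ℂ) * u t

/-! ### Closure of these notions under linear combinations, and uniqueness -/

section Helpers

variable {l : ℝ} {V : ℝ → ℝ}

lemma IsH2.intervalIntegrable_snd {u v w : ℝ → ℂ} (h : IsH2 l u v w) {t : ℝ}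
    (ht : t ∈ Icc (0 : ℝ) l) : IntervalIntegrable w volume 0 t := by
  have h1 : IntegrableOn w (Icc 0 l) := h.memLp.integrable (by norm_num)
  rw [intervalIntegrable_iff_integrableOn_Icc_of_le ht.1]
  exact h1.mono_set (Icc_subset_Icc_right ht.2)

lemma IsH2.continuousOn_fst {u v w : ℝ → ℂ} (h : IsH2 l u v w) :
    ContinuousOn v (Icc 0 l) := by
  rcases le_or_gt 0 l with hl | hl
  · have h1 : IntegrableOn w (uIcc 0 l) := by
      rw [uIcc_of_le hl]; exact h.memLp.integrable (by norm_num)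
    have h2 := intervalIntegral.continuousOn_primitive_interval h1
    rw [uIcc_of_le hl] at h2
    exact (continuousOn_const.add h2).congr h.deriv_eq
  · simp [Icc_eq_empty (not_le.mpr hl)]

lemma IsH2.intervalIntegrable_fst {u v w : ℝ → ℂ} (h : IsH2 l u v w) {t : ℝ}
    (ht : t ∈ Icc (0 : ℝ) l) : IntervalIntegrable v volume 0 t := by
  apply ContinuousOn.intervalIntegrable
  rw [uIcc_of_le ht.1]
  exact h.continuousOn_fst.mono (Icc_subset_Icc_right ht.2)

lemma IsH2.continuousOn {u v w : ℝ → ℂ} (h : IsH2 l u v w) :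
    ContinuousOn u (Icc 0 l) := by
  rcases le_or_gt 0 l with hl | hl
  · have h1 : IntegrableOn v (uIcc 0 l) := by
      rw [uIcc_of_le hl]; exact h.continuousOn_fst.integrableOn_compact isCompact_Icc
    have h2 := intervalIntegral.continuousOn_primitive_interval h1
    rw [uIcc_of_le hl] at h2
    exact (continuousOn_const.add h2).congr h.fun_eq
  · simp [Icc_eq_empty (not_le.mpr hl)]

lemma IsH2.add {u v w u' v' w' : ℝ → ℂ} (h : IsH2 l u v w) (h' : IsH2 l u' v' w') :
    IsH2 l (u + u') (v + v') (w + w') where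
  memLp := h.memLp.add h'.memLp
  deriv_eq t ht := by
    have := intervalIntegral.integral_add (h.intervalIntegrable_snd ht)
      (h'.intervalIntegrable_snd ht)
    simp only [Pi.add_apply, this, h.deriv_eq t ht, h'.deriv_eq t ht]
    ring
  fun_eq t ht := by
    have := intervalIntegral.integral_add (h.intervalIntegrable_fst ht)
      (h'.intervalIntegrable_fst ht)
    simp only [Pi.add_apply, this, h.fun_eq t ht, h'.fun_eq t ht]
    ring

lemma IsH2.smul {u v w : ℝ → ℂ} (c : ℂ) (h : IsH2 l u v w) :
    IsH2 l (c • u) (c • v) (c • w) where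
  memLp := h.memLp.const_smul c
  deriv_eq t ht := by
    simp only [Pi.smul_apply, intervalIntegral.integral_smul, h.deriv_eq t ht, smul_add]
  fun_eq t ht := by
    simp only [Pi.smul_apply, intervalIntegral.integral_smul, h.fun_eq t ht, smul_add]

lemma IsH2.zero : IsH2 l 0 0 0 where
  memLp := MemLp.zero
  deriv_eq t _ := by simp
  fun_eq t _ := by simp

lemma Represents.add {f g f' g' : EdgeL2 l} {u v w u' v' w' : ℝ → ℂ}
    (h : Represents l V f g u v w) (h' : Represents l V f' g' u' v' w') :
    Represents l V (f + f') (g + g') (u + u') (v + v') (w + w') where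
  isH2 := h.isH2.add h'.isH2
  left := by
    filter_upwards [Lp.coeFn_add f f', h.left, h'.left] with t h1 h2 h3
    rw [h1, Pi.add_apply, Pi.add_apply, h2, h3]
  right := by
    filter_upwards [Lp.coeFn_add g g', h.right, h'.right] with t h1 h2 h3
    simp only [h1, Pi.add_apply, h2, h3]
    ring

lemma Represents.smul {f g : EdgeL2 l} {u v w : ℝ → ℂ} (c : ℂ)
    (h : Represents l V f g u v w) :
    Represents l V (c • f) (c • g) (c • u) (c • v) (c • w) where
  isH2 := h.isH2.smul c
  left := by
    filter_upwards [Lp.coeFn_smul c f, h.left] with t h1 h2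
    simp [h1, h2]
  right := by
    filter_upwards [Lp.coeFn_smul c g, h.right] with t h1 h2
    simp only [h1, Pi.smul_apply, h2, smul_eq_mul]
    ring

lemma Represents.zero : Represents l V 0 0 0 0 0 where
  isH2 := IsH2.zero
  left := Lp.coeFn_zero _ _ _
  right := by
    filter_upwards [Lp.coeFn_zero ℂ 2 (edgeMeasure l)] with t h1
    rw [h1]
    simp

/-- An integrable function with vanishing primitive vanishes almost everywhere. -/
lemma ae_eq_zero_of_primitive {w : ℝ → ℂ} (hl : 0 < l) (hw : IntegrableOn w (Icc 0 l))
    (h : ∀ t ∈ Icc (0 : ℝ) l, ∫ s in (0 : ℝ)..t, w s = 0) : w =ᵐ[edgeMeasure l] 0 := by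
  have hi : IntervalIntegrable w volume 0 l :=
    (intervalIntegrable_iff_integrableOn_Icc_of_le hl.le).2 hw
  have h1 := hi.ae_hasDerivAt_integral
  have h2 : ∀ᵐ x : ℝ, x ≠ 0 := by simp [ae_iff]
  have h3 : ∀ᵐ x : ℝ, x ≠ l := by simp [ae_iff]
  rw [Filter.EventuallyEq, ae_restrict_iff' measurableSet_Icc]
  filter_upwards [h1, h2, h3] with x hx hx0 hxl hxI
  have hd := hx (by rwa [uIcc_of_le hl.le]) 0 (by simp)
  have hz : (fun y => ∫ s in (0 : ℝ)..y, w s) =ᶠ[nhds x] fun _ => 0 := by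
    filter_upwards [Ioo_mem_nhds (lt_of_le_of_ne hxI.1 (Ne.symm hx0))
      (lt_of_le_of_ne hxI.2 hxl)] with y hy
    exact h y ⟨hy.1.le, hy.2.le⟩
  exact hd.unique ((hasDerivAt_const x (0 : ℂ)).congr_of_eventuallyEq hz)

/-- A continuous function on `[0,l]` which vanishes almost everywhere vanishes. -/
lemma eq_zero_of_ae {u : ℝ → ℂ} (hl : 0 < l) (hc : ContinuousOn u (Icc 0 l))
    (h : u =ᵐ[edgeMeasure l] 0) : ∀ t ∈ Icc (0 : ℝ) l, u t = 0 :=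
  Measure.eqOn_Icc_of_ae_eq volume hl.ne h hc continuousOn_const

/-- The element represented by `-u'' + V u` is determined by the element represented by `u`. -/
lemma Represents.snd_eq_zero {f g : EdgeL2 l} {u v w : ℝ → ℂ} (hl : 0 < l)
    (h : Represents l V f g u v w) (hf : f = 0) : g = 0 := by
  have hu : ∀ t ∈ Icc (0 : ℝ) l, u t = 0 := by
    refine eq_zero_of_ae hl h.isH2.continuousOn ?_
    subst hf
    exact h.left.symm.trans (Lp.coeFn_zero _ _ _)
  have h0 : (0 : ℝ) ∈ Icc (0 : ℝ) l := ⟨le_rfl, hl.le⟩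
  have hv : ∀ t ∈ Icc (0 : ℝ) l, v t = 0 := by
    refine eq_zero_of_ae hl h.isH2.continuousOn_fst (ae_eq_zero_of_primitive hl
      (h.isH2.continuousOn_fst.integrableOn_compact isCompact_Icc) fun t ht => ?_)
    have := h.isH2.fun_eq t ht
    rw [hu t ht, hu 0 h0] at this
    simpa using this.symm
  have hw : w =ᵐ[edgeMeasure l] 0 := by
    refine ae_eq_zero_of_primitive hl (h.isH2.memLp.integrable (by norm_num)) fun t ht => ?_
    have := h.isH2.deriv_eq t ht
    rw [hv t ht, hv 0 h0] at this
    simpa using this.symm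
  rw [Lp.eq_zero_iff_ae_eq_zero]
  filter_upwards [h.right, hw, ae_restrict_mem measurableSet_Icc] with t h1 h2 h3
  simp [h1, h2, hu t h3]

end Helpers

/-! ### The Dirichlet operator on one edge -/

/-- The graph of `D f = -f'' + V f`, `dom D = {f ∈ H²[0,l] : f(0) = f(l) = 0}`. -/
def dirichletGraph (l : ℝ) (V : ℝ → ℝ) : Submodule ℂ (EdgeL2 l × EdgeL2 l) where
  carrier := {p | ∃ u v w : ℝ → ℂ, Represents l V p.1 p.2 u v w ∧ u 0 = 0 ∧ u l = 0}
  add_mem' := by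
    rintro p q ⟨u, v, w, h, h0, h1⟩ ⟨u', v', w', h', h0', h1'⟩
    exact ⟨_, _, _, h.add h', by simp [h0, h0'], by simp [h1, h1']⟩
  zero_mem' := ⟨0, 0, 0, Represents.zero, rfl, rfl⟩
  smul_mem' := by
    rintro c p ⟨u, v, w, h, h0, h1⟩
    exact ⟨_, _, _, h.smul c, by simp [h0], by simp [h1]⟩

/-- The Dirichlet operator `D` on `L²[0,l]`. -/
def dirichletOp (l : ℝ) (V : ℝ → ℝ) : EdgeL2 l →ₗ.[ℂ] EdgeL2 l :=
  (dirichletGraph l V).toLinearPMap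

/-- `dirichletGraph` really is the graph of the operator. -/
theorem dirichletOp_graph {l : ℝ} (hl : 0 < l) (V : ℝ → ℝ) :
    (dirichletOp l V).graph = dirichletGraph l V := by
  refine Submodule.toLinearPMap_graph_eq _ ?_
  rintro ⟨f, g⟩ ⟨u, v, w, h, -, -⟩ hf
  exact h.snd_eq_zero hl hf

/-! ### The operator `Λ` on the square lattice -/

/-- The orientation of an edge: `r` (right) or `u` (up). -/
inductive Dir
  | r
  | u

/-- The edge `(m, n, r)` joins the nodes `(m, n)` and `(m + 1, n)`; the edge `(m, n, u)` joins
`(m, n)` and `(m, n + 1)`. The point `0` of the edge is the node `(m, n)`. -/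
abbrev Edge : Type := ℤ × ℤ × Dir

/-- The Hilbert space of the lattice: the `ℓ²`-direct sum over all edges of `L²[0,l]`. -/
abbrev LatticeL2 (l : ℝ) : Type := lp (fun _ : Edge => EdgeL2 l) 2

/-- The phase `e^{iπx}`. -/
def phase (x : ℝ) : ℂ := Complex.exp (Complex.I * Real.pi * x)

/-- The four boundary values at the node `(m, n)`, brought together by the phases, are given by
the single number `c`. -/
def VertexValue (l θ β : ℝ) (u : Edge → ℝ → ℂ) (m n : ℤ) (c : ℂ) : Prop :=
  u (m, n, Dir.r) 0 = c ∧
  1 / (β : ℂ) * u (m, n, Dir.u) 0 = c ∧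
  phase (-(n * θ)) * u (m - 1, n, Dir.r) l = c ∧
  1 / (β : ℂ) * (phase (m * θ) * u (m, n - 1, Dir.u) l) = c

/-- The weighted sum of the derivatives at the node `(m, n)`. -/
def vertexDeriv (l θ β : ℝ) (v : Edge → ℝ → ℂ) (m n : ℤ) : ℂ :=
  v (m, n, Dir.r) 0 + (β : ℂ) * v (m, n, Dir.u) 0
    - phase (-(n * θ)) * v (m - 1, n, Dir.r) l
    - (β : ℂ) * phase (m * θ) * v (m, n - 1, Dir.u) l

/-- The graph of `Λ`: it acts on each edge as `φ ↦ -φ'' + V φ`, on those `φ` which are `H²` on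
each edge, satisfy the magnetic `δ`-type conditions at all nodes, and have image in the Hilbert
space. -/
def latticeGraph (l : ℝ) (V : ℝ → ℝ) (α β θ : ℝ) :
    Submodule ℂ (LatticeL2 l × LatticeL2 l) where
  carrier := {p | ∃ u v w : Edge → ℝ → ℂ,
    (∀ e, Represents l V (p.1 e) (p.2 e) (u e) (v e) (w e)) ∧
    ∀ m n : ℤ, ∃ c : ℂ, VertexValue l θ β u m n c ∧ vertexDeriv l θ β v m n = α * c}
  add_mem' := by
    rintro p q ⟨u, v, w, h, hb⟩ ⟨u', v', w', h', hb'⟩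
    refine ⟨fun e => u e + u' e, fun e => v e + v' e, fun e => w e + w' e,
      fun e => (h e).add (h' e), fun m n => ?_⟩
    obtain ⟨c, ⟨h1, h2, h3, h4⟩, h5⟩ := hb m n
    obtain ⟨c', ⟨h1', h2', h3', h4'⟩, h5'⟩ := hb' m n
    refine ⟨c + c', ⟨?_, ?_, ?_, ?_⟩, ?_⟩
    · simp only [Pi.add_apply, h1, h1']
    · rw [← h2, ← h2']; simp only [Pi.add_apply]; ring
    · rw [← h3, ← h3']; simp only [Pi.add_apply]; ring
    · rw [← h4, ← h4']; simp only [Pi.add_apply]; ring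
    · rw [mul_add, ← h5, ← h5']; simp only [vertexDeriv, Pi.add_apply]; ring
  zero_mem' := ⟨fun _ => 0, fun _ => 0, fun _ => 0, fun _ => Represents.zero,
    fun m n => ⟨0, by simp [VertexValue], by simp [vertexDeriv]⟩⟩
  smul_mem' := by
    rintro a p ⟨u, v, w, h, hb⟩
    refine ⟨fun e => a • u e, fun e => a • v e, fun e => a • w e,
      fun e => (h e).smul a, fun m n => ?_⟩
    obtain ⟨c, ⟨h1, h2, h3, h4⟩, h5⟩ := hb m n
    refine ⟨a * c, ⟨?_, ?_, ?_, ?_⟩, ?_⟩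
    · simp only [Pi.smul_apply, h1, smul_eq_mul]
    · rw [← h2]; simp only [Pi.smul_apply, smul_eq_mul]; ring
    · rw [← h3]; simp only [Pi.smul_apply, smul_eq_mul]; ring
    · rw [← h4]; simp only [Pi.smul_apply, smul_eq_mul]; ring
    · rw [mul_left_comm, ← h5]; simp only [vertexDeriv, Pi.smul_apply, smul_eq_mul]; ring

/-- The magnetic Schrödinger operator `Λ` on the square lattice. -/
def latticeOp (l : ℝ) (V : ℝ → ℝ) (α β θ : ℝ) : LatticeL2 l →ₗ.[ℂ] LatticeL2 l :=
  (latticeGraph l V α β θ).toLinearPMap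

/-- `latticeGraph` really is the graph of the operator. -/
theorem latticeOp_graph {l : ℝ} (hl : 0 < l) (V : ℝ → ℝ) (α β θ : ℝ) :
    (latticeOp l V α β θ).graph = latticeGraph l V α β θ := by
  refine Submodule.toLinearPMap_graph_eq _ ?_
  rintro ⟨f, g⟩ ⟨u, v, w, h, -⟩ hf
  ext1
  funext e
  refine (h e).snd_eq_zero hl ?_
  have hf' : f = 0 := hf
  simp [hf']

/-! ### The discrete magnetic Laplacian -/

/-- The Hilbert space `ℓ²(ℤ²)`. -/
abbrev NodeL2 : Type := lp (fun _ : ℤ × ℤ => ℂ) 2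

lemma phase_norm (x : ℝ) : ‖phase x‖ = 1 := by
  have : Complex.I * Real.pi * x = ((Real.pi * x : ℝ) : ℂ) * Complex.I := by push_cast; ring
  rw [phase, this, Complex.norm_exp_ofReal_mul_I]

lemma shift_summable (σ : ℤ × ℤ ≃ ℤ × ℤ) (x : ℤ × ℤ → ℝ) (g : NodeL2) :
    Summable fun i => ‖phase (x i) * g (σ i)‖ ^ (2 : ENNReal).toReal := by
  have h := (memℓp_gen_iff (p := 2) (by norm_num)).1 (lp.memℓp g)
  simp only [norm_mul, phase_norm, one_mul]
  exact σ.summable_iff.2 h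

/-- The magnetic shift `(g i)_i ↦ (e^{iπ x i} g (σ i))_i` on `ℓ²(ℤ²)`. -/
def magneticShift (σ : ℤ × ℤ ≃ ℤ × ℤ) (x : ℤ × ℤ → ℝ) : NodeL2 →L[ℂ] NodeL2 :=
  LinearMap.mkContinuous
    { toFun := fun g => ⟨fun i => phase (x i) * g (σ i),
        (memℓp_gen_iff (p := 2) (by norm_num)).2 (shift_summable σ x g)⟩
      map_add' := fun g h => by ext i; exact mul_add _ _ _
      map_smul' := fun c g => by ext i; exact mul_left_comm _ _ _ }
    1 (fun g => by
      rw [one_mul]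
      refine le_of_eq ?_
      rw [lp.norm_eq_tsum_rpow (by norm_num), lp.norm_eq_tsum_rpow (by norm_num)]
      congr 1
      rw [← σ.tsum_eq fun i => ‖g i‖ ^ (2 : ENNReal).toReal]
      simp [phase_norm])

/-- Translation of `ℤ²` by `(j, k)`. -/
def translate (j k : ℤ) : ℤ × ℤ ≃ ℤ × ℤ := Equiv.addRight (j, k)

/-- The discrete magnetic Laplacian `M(θ,β)`. -/
def discreteLaplacian (θ β : ℝ) : NodeL2 →L[ℂ] NodeL2 :=
  magneticShift (translate 1 0) (fun i => i.2 * θ)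
    + magneticShift (translate (-1) 0) (fun i => -(i.2 * θ))
    + ((β : ℂ) ^ 2) • (magneticShift (translate 0 1) (fun i => -(i.1 * θ))
      + magneticShift (translate 0 (-1)) (fun i => i.1 * θ))

theorem discreteLaplacian_apply (θ β : ℝ) (g : NodeL2) (m n : ℤ) :
    discreteLaplacian θ β g (m, n) =
      phase (n * θ) * g (m + 1, n) + phase (-(n * θ)) * g (m - 1, n)
      + (β : ℂ) ^ 2 * (phase (-(m * θ)) * g (m, n + 1) + phase (m * θ) * g (m, n - 1)) := by
  have h : ∀ (j k : ℤ) (x : ℤ × ℤ → ℝ), magneticShift (translate j k) x g (m, n) =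
      phase (x (m, n)) * g (m + j, n + k) := fun _ _ _ => rfl
  have e : discreteLaplacian θ β g (m, n) =
      magneticShift (translate 1 0) (fun i => i.2 * θ) g (m, n)
      + magneticShift (translate (-1) 0) (fun i => -(i.2 * θ)) g (m, n)
      + (β : ℂ) ^ 2 * (magneticShift (translate 0 1) (fun i => -(i.1 * θ)) g (m, n)
        + magneticShift (translate 0 (-1)) (fun i => i.1 * θ) g (m, n)) := rfl
  simp only [e, h, add_zero, sub_eq_add_neg]

/-! ### The discriminant `η` and the set `Σ` -/

/-- `u ∈ H²[0,l]`, with `u' = v`, solves `-u'' + V u = z u`, `u(0) = a`, `u'(0) = b`. -/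
def IsSolution (l : ℝ) (V : ℝ → ℝ) (z a b : ℂ) (u v : ℝ → ℂ) : Prop :=
  ∃ w : ℝ → ℂ, IsH2 l u v w ∧
    (∀ᵐ t ∂(edgeMeasure l), -w t + (V t : ℂ) * u t = z * u t) ∧ u 0 = a ∧ v 0 = b

/-- `y = η(z) = (1 + β²)(u₁'(l;z) + u₂(l;z)) + α u₁(l;z)`, where `u₁, u₂` solve
`-u'' + V u = z u` with `u₁(0) = 0, u₁'(0) = 1` and `u₂(0) = 1, u₂'(0) = 0`. -/
def IsEta (l : ℝ) (V : ℝ → ℝ) (α β : ℝ) (z y : ℂ) : Prop :=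
  ∃ u₁ v₁ u₂ v₂ : ℝ → ℂ, IsSolution l V z 0 1 u₁ v₁ ∧ IsSolution l V z 1 0 u₂ v₂ ∧
    y = (1 + (β : ℂ) ^ 2) * (v₁ l + u₂ l) + α * u₁ l

/-- The part `Σ = η⁻¹(spec M(θ,β))` of the spectrum of `Λ`. -/
def bandSet (l : ℝ) (V : ℝ → ℝ) (α β θ : ℝ) : Set ℝ :=
  {x : ℝ | ∃ y : ℂ, IsEta l V α β x y ∧ y ∈ spectrum ℂ (discreteLaplacian θ β)}

end MagneticLattice

end

noncomputable section

namespace MagneticLattice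

/-! Write c(·;x), s(·;x) for the solutions u₂, u₁ at real energy x and B = 2(1+β²).

Outside the Dirichlet spectrum the problem reduces to the nodes. If s(l;x) ≠ 0, a solution of -u'' +
Vu - xu = k on an edge is fixed by its two end values, and the vertex conditions become (η(x) - M)g
= s(l;x)Γk for the node values g, where Γk collects the sources. So x is in the resolvent set as
soon as η(x) ∉ spec M (`isResolventPoint_latticeOp`).

At a Dirichlet eigenvalue s(l;μ) = 0, and the Wronskian gives c(l;μ)s'(l;μ) = 1, hence |η(μ)| =
(1+β²)|s' + 1/s'| ≥ B. On the other hand the four magnetic translations making up M cannot nearly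
agree on one vector, because going round a plaquette costs the factor e^{2πiθ} ≠ 1; this gives ‖M‖ <
B (`norm_discreteLaplacian_lt`), so μ ∉ Σ. The same flux keeps μ in the spectrum: a resolvent at μ
applied to s(·;μ) on a single edge would yield node values that vanish near that edge, forcing ∫s² =
0 (`mem_realSpec_of_dirichlet`).

It remains to find points of Σ on both sides of μ before the next zero of x ↦ s(l;x). At consecutive
zeros s'(l;·) has opposite signs (`sign_near_zero`), so η passes from one side of [-B, B] to the
other and meets any chosen σ ∈ spec M (`exists_level_between_zeros`). Below the lowest zero the same
follows from η → +∞ as x → -∞ (`hyp_asymptotics`). Hence Σ has a gap around μ in which μ is the only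
zero, so the only spectral point.

Comparison with sin(kl)/k shows that the zeros of s(l;·) are unbounded above. Each is an isolated
point of the closed spectrum, hence the left end of a spectral gap, and there are infinitely many
gaps. -/

/-! ### Primitives of integrable functions on `[0,l]` -/

section Primitive

variable {𝕜 : Type*} [RCLike 𝕜] {l : ℝ}

/-- On `[0,l]` the function `f` is a primitive of the integrable function `f'`. -/
structure IsPrimitive (l : ℝ) (f f' : ℝ → 𝕜) : Prop where
  nonneg : 0 ≤ l
  integrableOn : IntegrableOn f' (Icc 0 l)
  eq : ∀ t ∈ Icc (0 : ℝ) l, f t = f 0 + ∫ s in (0 : ℝ)..t, f' s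

lemma IsPrimitive.intervalIntegrable {f f' : ℝ → 𝕜} (h : IsPrimitive l f f') {t : ℝ}
    (ht : t ∈ Icc (0 : ℝ) l) : IntervalIntegrable f' volume 0 t := by
  rw [intervalIntegrable_iff_integrableOn_Icc_of_le ht.1]
  exact h.integrableOn.mono_set (Icc_subset_Icc_right ht.2)

lemma IsPrimitive.continuousOn {f f' : ℝ → 𝕜} (h : IsPrimitive l f f') :
    ContinuousOn f (Icc 0 l) := by
  have h1 : IntegrableOn f' (uIcc 0 l) := by
    rw [uIcc_of_le h.nonneg]; exact h.integrableOn
  have h2 := intervalIntegral.continuousOn_primitive_interval h1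
  rw [uIcc_of_le h.nonneg] at h2
  exact (continuousOn_const.add h2).congr h.eq

lemma IsPrimitive.add {f f' g g' : ℝ → 𝕜} (hf : IsPrimitive l f f') (hg : IsPrimitive l g g') :
    IsPrimitive l (fun t => f t + g t) (fun t => f' t + g' t) where
  nonneg := hf.nonneg
  integrableOn := hf.integrableOn.add hg.integrableOn
  eq t ht := by
    rw [intervalIntegral.integral_add (hf.intervalIntegrable ht) (hg.intervalIntegrable ht),
      hf.eq t ht, hg.eq t ht]
    ring

lemma IsPrimitive.const_mul {f f' : ℝ → 𝕜} (a : 𝕜) (hf : IsPrimitive l f f') :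
    IsPrimitive l (fun t => a * f t) (fun t => a * f' t) where
  nonneg := hf.nonneg
  integrableOn := hf.integrableOn.const_mul a
  eq t ht := by
    rw [intervalIntegral.integral_const_mul, hf.eq t ht]
    ring

lemma IsPrimitive.sub {f f' g g' : ℝ → 𝕜} (hf : IsPrimitive l f f') (hg : IsPrimitive l g g') :
    IsPrimitive l (fun t => f t - g t) (fun t => f' t - g' t) := by
  simpa [sub_eq_add_neg] using hf.add (hg.const_mul (-1))

lemma IsPrimitive.congr_ae {f f' g' : ℝ → 𝕜} (hf : IsPrimitive l f f')
    (h : f' =ᵐ[edgeMeasure l] g') : IsPrimitive l f g' where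
  nonneg := hf.nonneg
  integrableOn := hf.integrableOn.congr h
  eq t ht := by
    rw [hf.eq t ht]
    congr 1
    apply intervalIntegral.integral_congr_ae
    have h' : f' =ᵐ[volume.restrict (Icc 0 l)] g' := h
    rw [Filter.EventuallyEq, ae_restrict_iff' measurableSet_Icc] at h'
    filter_upwards [h'] with s hs hst
    rw [uIoc_of_le ht.1] at hst
    exact hs ⟨hst.1.le, hst.2.trans ht.2⟩

lemma IsPrimitive.congr {f f' g' : ℝ → 𝕜} (hf : IsPrimitive l f f')
    (h : ∀ t ∈ Icc (0 : ℝ) l, f' t = g' t) : IsPrimitive l f g' :=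
  hf.congr_ae (by
    filter_upwards [ae_restrict_mem measurableSet_Icc] with t ht using h t ht)

lemma isPrimitive_integral {f' : ℝ → 𝕜} (hl : 0 ≤ l) (h : IntegrableOn f' (Icc 0 l)) :
    IsPrimitive l (fun t => ∫ s in (0 : ℝ)..t, f' s) f' where
  nonneg := hl
  integrableOn := h
  eq t _ := by simp

lemma isPrimitive_of_hasDerivAt {f f' : ℝ → 𝕜} (hl : 0 ≤ l) (hd : ∀ t, HasDerivAt f (f' t) t)
    (hc : Continuous f') : IsPrimitive l f f' where
  nonneg := hl
  integrableOn := hc.continuousOn.integrableOn_compact isCompact_Icc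
  eq t _ := by
    rw [intervalIntegral.integral_eq_sub_of_hasDerivAt (fun s _ => hd s)
      (hc.intervalIntegrable _ _)]
    ring

lemma IsPrimitive.ofReal {f f' : ℝ → ℝ} (h : IsPrimitive l f f') :
    IsPrimitive l (fun t => (f t : ℂ)) (fun t => (f' t : ℂ)) where
  nonneg := h.nonneg
  integrableOn := h.integrableOn.ofReal
  eq t ht := by
    rw [intervalIntegral.integral_ofReal, h.eq t ht]
    push_cast
    rfl

/-- Increments of the primitive are dominated by those of the real-valued primitive of ‖f'‖, so
absolute continuity passes from the latter to the former. -/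
lemma absolutelyContinuousOnInterval_integral {f' : ℝ → 𝕜} (hl : 0 ≤ l)
    (h : IntegrableOn f' (Icc 0 l)) :
    AbsolutelyContinuousOnInterval (fun t => ∫ s in (0 : ℝ)..t, f' s) 0 l := by
  have hi : IntervalIntegrable f' volume 0 l :=
    (intervalIntegrable_iff_integrableOn_Icc_of_le hl).2 h
  have h1 := hi.norm.absolutelyContinuousOnInterval_intervalIntegral (c := 0) (by simp)
  have hsub : ∀ {x}, x ∈ uIcc 0 l → IntervalIntegrable f' volume 0 x := fun hx =>
    hi.mono_set (uIcc_subset_uIcc_left hx)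
  refine squeeze_zero' (Filter.Eventually.of_forall fun E => Finset.sum_nonneg
    fun _ _ => dist_nonneg) ?_ h1
  have hmem : ∀ᶠ E in AbsolutelyContinuousOnInterval.totalLengthFilter ⊓
      Filter.principal (AbsolutelyContinuousOnInterval.disjWithin 0 l),
      E ∈ AbsolutelyContinuousOnInterval.disjWithin 0 l :=
    Filter.eventually_inf_principal.2 (Filter.Eventually.of_forall fun _ h => h)
  filter_upwards [hmem] with E hE
  refine Finset.sum_le_sum fun i hi' => ?_
  have hm := hE.1 i hi'
  rw [dist_eq_norm, dist_eq_norm, intervalIntegral.integral_interval_sub_left (hsub hm.1)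
    (hsub hm.2), intervalIntegral.integral_interval_sub_left (hsub hm.1).norm (hsub hm.2).norm,
    Real.norm_eq_abs]
  exact intervalIntegral.norm_integral_le_abs_integral_norm

/-- The product rule for absolutely continuous functions. -/
lemma IsPrimitive.mul {f f' g g' : ℝ → 𝕜} (hf : IsPrimitive l f f') (hg : IsPrimitive l g g') :
    IsPrimitive l (fun t => f t * g t) (fun t => f' t * g t + f t * g' t) := by
  have hl := hf.nonneg
  have hI : IntegrableOn (fun t => f' t * g t + f t * g' t) (Icc 0 l) :=
    (hf.integrableOn.mul_continuousOn hg.continuousOn isCompact_Icc).add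
      (hg.integrableOn.continuousOn_mul hf.continuousOn isCompact_Icc)
  refine ⟨hl, hI, ?_⟩
  -- Since `f` and `g` are controlled only on [0,l], they are replaced by primitives given by the
  -- integral formula everywhere. Then FG - P is absolutely continuous with derivative zero almost
  -- everywhere, hence constant.
  set F : ℝ → 𝕜 := fun t => f 0 + ∫ s in (0 : ℝ)..t, f' s with hF
  set G : ℝ → 𝕜 := fun t => g 0 + ∫ s in (0 : ℝ)..t, g' s with hG
  set P : ℝ → 𝕜 := fun t => ∫ s in (0 : ℝ)..t, (f' s * g s + f s * g' s) with hP
  have hc : ∀ a : 𝕜, AbsolutelyContinuousOnInterval (fun _ : ℝ => a) 0 l := fun a =>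
    (LipschitzWith.const (α := ℝ) a).lipschitzOnWith.absolutelyContinuousOnInterval
  have hFa : AbsolutelyContinuousOnInterval F 0 l :=
    (hc (f 0)).add (absolutelyContinuousOnInterval_integral hl hf.integrableOn)
  have hGa : AbsolutelyContinuousOnInterval G 0 l :=
    (hc (g 0)).add (absolutelyContinuousOnInterval_integral hl hg.integrableOn)
  have hPa : AbsolutelyContinuousOnInterval P 0 l :=
    absolutelyContinuousOnInterval_integral hl hI
  have hQ := (hFa.smul hGa).sub hPa
  have hii : ∀ {h : ℝ → 𝕜}, IntegrableOn h (Icc 0 l) → IntervalIntegrable h volume 0 l :=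
    fun h => (intervalIntegrable_iff_integrableOn_Icc_of_le hl).2 h
  obtain ⟨C, hC⟩ := hQ.const_of_ae_hasDerivAt_zero (by
    filter_upwards [(hii hf.integrableOn).ae_hasDerivAt_integral,
      (hii hg.integrableOn).ae_hasDerivAt_integral,
      (hii hI).ae_hasDerivAt_integral] with x h1 h2 h3 hx
    have d1 : HasDerivAt F (f' x) x := (h1 hx 0 (by simp)).const_add _
    have d2 : HasDerivAt G (g' x) x := (h2 hx 0 (by simp)).const_add _
    have d3 := h3 hx 0 (by simp)
    have d4 := (d1.mul d2).sub d3
    rw [uIcc_of_le hl] at hx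
    have e1 : F x = f x := (hf.eq x hx).symm
    have e2 : G x = g x := (hg.eq x hx).symm
    rw [e1, e2, sub_self] at d4
    exact d4)
  rw [uIcc_of_le hl] at hC
  intro t ht
  have h0 := hC 0 ⟨le_rfl, hl⟩
  have ht' := hC t ht
  have e1 : F t = f t := (hf.eq t ht).symm
  have e2 : G t = g t := (hg.eq t ht).symm
  have e3 : F 0 = f 0 := by simp [hF]
  have e4 : G 0 = g 0 := by simp [hG]
  have e5 : P 0 = 0 := by simp [hP]
  simp only [Pi.sub_apply, smul_eq_mul, Pi.mul_apply, e1, e2, e3, e4, e5] at h0 ht'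
  change f t * g t = f 0 * g 0 + P t
  linear_combination ht' - h0

end Primitive

/-! ### The equation `-u'' + q u = f` on `[0,l]` -/

section Equation

variable {𝕜 : Type*} [RCLike 𝕜] {l : ℝ}

/-- On `[0,l]`, the pair `(u, v)` satisfies `u' = v` and `-v' + q u = f`. -/
structure IsSol (l : ℝ) (q f u v : ℝ → 𝕜) : Prop where
  fst : IsPrimitive l u v
  snd : IsPrimitive l v (fun t => q t * u t - f t)

/-- The pairs `(c, c')` and `(s, s')` are the solutions of `-u'' + q u = 0` with
`c(0) = 1, c'(0) = 0` and `s(0) = 0, s'(0) = 1`. -/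
structure IsFundamental (l : ℝ) (q c c' s s' : ℝ → 𝕜) : Prop where
  cos : IsSol l q (fun _ => 0) c c'
  sin : IsSol l q (fun _ => 0) s s'
  cos_zero : c 0 = 1
  cos_deriv_zero : c' 0 = 0
  sin_zero : s 0 = 0
  sin_deriv_zero : s' 0 = 1

variable {q f g u v p r c c' s s' : ℝ → 𝕜}

lemma IsSol.nonneg (h : IsSol l q f u v) : 0 ≤ l := h.fst.nonneg

lemma IsSol.congr_ae (h : IsSol l q f u v) {q₁ f₁ : ℝ → 𝕜}
    (hq : ∀ᵐ t ∂(edgeMeasure l), q t * u t - f t = q₁ t * u t - f₁ t) : IsSol l q₁ f₁ u v :=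
  ⟨h.fst, h.snd.congr_ae hq⟩

lemma IsSol.add (h : IsSol l q f u v) (h' : IsSol l q g p r) :
    IsSol l q (fun t => f t + g t) (fun t => u t + p t) (fun t => v t + r t) :=
  ⟨h.fst.add h'.fst, (h.snd.add h'.snd).congr fun t _ => by ring⟩

lemma IsSol.const_mul (a : 𝕜) (h : IsSol l q f u v) :
    IsSol l q (fun t => a * f t) (fun t => a * u t) (fun t => a * v t) :=
  ⟨h.fst.const_mul a, (h.snd.const_mul a).congr fun t _ => by ring⟩

lemma IsSol.ofReal {q f u v : ℝ → ℝ} (h : IsSol l q f u v) :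
    IsSol l (fun t => (q t : ℂ)) (fun t => (f t : ℂ)) (fun t => (u t : ℂ)) (fun t => (v t : ℂ)) :=
  ⟨h.fst.ofReal, h.snd.ofReal.congr fun t _ => by push_cast; ring⟩

lemma IsFundamental.ofReal {q c c' s s' : ℝ → ℝ} (h : IsFundamental l q c c' s s') :
    IsFundamental l (fun t => (q t : ℂ)) (fun t => (c t : ℂ)) (fun t => (c' t : ℂ))
      (fun t => (s t : ℂ)) (fun t => (s' t : ℂ)) where
  cos := by simpa using h.cos.ofReal
  sin := by simpa using h.sin.ofReal
  cos_zero := by simp [h.cos_zero]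
  cos_deriv_zero := by simp [h.cos_deriv_zero]
  sin_zero := by simp [h.sin_zero]
  sin_deriv_zero := by simp [h.sin_deriv_zero]

/-- Lagrange's identity. -/
lemma IsSol.lagrange (h : IsSol l q f u v) (h' : IsSol l q g p r) {t : ℝ}
    (ht : t ∈ Icc (0 : ℝ) l) :
    u t * r t - v t * p t = u 0 * r 0 - v 0 * p 0 + ∫ x in (0 : ℝ)..t, (f x * p x - u x * g x) :=
  (((h.fst.mul h'.snd).sub (h.snd.mul h'.fst)).congr (g' := fun x => f x * p x - u x * g x)
    fun x _ => by ring).eq t ht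

lemma IsFundamental.wronskian (h : IsFundamental l q c c' s s') {t : ℝ}
    (ht : t ∈ Icc (0 : ℝ) l) : c t * s' t - c' t * s t = 1 := by
  have := h.cos.lagrange h.sin ht
  simpa [h.cos_zero, h.cos_deriv_zero, h.sin_zero, h.sin_deriv_zero] using this

/-- Variation of constants: Lagrange's identity against `s` and against `c` gives two linear
equations for (u(t), v(t)), whose determinant is the Wronskian 1. The next lemma solves the same
system for v. -/
lemma IsFundamental.eq_fst (h : IsFundamental l q c c' s s') (hu : IsSol l q f u v) {t : ℝ}
    (ht : t ∈ Icc (0 : ℝ) l) :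
    u t = u 0 * c t + v 0 * s t + (c t * ∫ x in (0 : ℝ)..t, f x * s x)
      - s t * ∫ x in (0 : ℝ)..t, f x * c x := by
  have h1 := hu.lagrange h.sin ht
  have h2 := hu.lagrange h.cos ht
  have h3 := h.wronskian ht
  simp only [h.cos_zero, h.cos_deriv_zero, h.sin_zero, h.sin_deriv_zero, mul_zero, sub_zero,
    mul_one, zero_sub] at h1 h2
  linear_combination c t * h1 - s t * h2 - u t * h3

lemma IsFundamental.eq_snd (h : IsFundamental l q c c' s s') (hu : IsSol l q f u v) {t : ℝ}
    (ht : t ∈ Icc (0 : ℝ) l) :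
    v t = u 0 * c' t + v 0 * s' t + (c' t * ∫ x in (0 : ℝ)..t, f x * s x)
      - s' t * ∫ x in (0 : ℝ)..t, f x * c x := by
  have h1 := hu.lagrange h.sin ht
  have h2 := hu.lagrange h.cos ht
  have h3 := h.wronskian ht
  simp only [h.cos_zero, h.cos_deriv_zero, h.sin_zero, h.sin_deriv_zero, mul_zero, sub_zero,
    mul_one, zero_sub] at h1 h2
  linear_combination c' t * h1 - s' t * h2 - v t * h3

lemma IsFundamental.eq_of_homogeneous (h : IsFundamental l q c c' s s')
    (hu : IsSol l q (fun _ => 0) u v) {t : ℝ} (ht : t ∈ Icc (0 : ℝ) l) :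
    u t = u 0 * c t + v 0 * s t ∧ v t = u 0 * c' t + v 0 * s' t :=
  ⟨by simpa using h.eq_fst hu ht, by simpa using h.eq_snd hu ht⟩

/-- The solution of `-u'' + q u = f` with vanishing initial values. -/
lemma IsFundamental.isSol_particular (h : IsFundamental l q c c' s s')
    (hf : IntegrableOn f (Icc 0 l)) :
    IsSol l q f
      (fun t => (c t * ∫ x in (0 : ℝ)..t, f x * s x) - s t * ∫ x in (0 : ℝ)..t, f x * c x)
      (fun t => (c' t * ∫ x in (0 : ℝ)..t, f x * s x) - s' t * ∫ x in (0 : ℝ)..t, f x * c x) := by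
  have hl := h.cos.nonneg
  have hs := isPrimitive_integral hl
    (hf.mul_continuousOn h.sin.fst.continuousOn isCompact_Icc)
  have hc := isPrimitive_integral hl
    (hf.mul_continuousOn h.cos.fst.continuousOn isCompact_Icc)
  refine ⟨((h.cos.fst.mul hs).sub (h.sin.fst.mul hc)).congr fun t _ => by ring,
    ((h.cos.snd.mul hs).sub (h.sin.snd.mul hc)).congr fun t ht => ?_⟩
  linear_combination (-f t) * h.wronskian ht

/-! ### Existence -/

/-- Weighted Volterra estimate for the iterated primitive. -/
lemma abs_iterated_integral_le {q y : ℝ → ℝ} {κ N : ℝ} (hκ : 0 < κ) (hN : 0 ≤ N)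
    (hq : IntegrableOn q (Icc 0 l))
    (hyN : ∀ t ∈ Icc (0 : ℝ) l, |y t| ≤ N * Real.exp (κ * t)) {t : ℝ} (ht : t ∈ Icc (0 : ℝ) l) :
    |∫ a in (0 : ℝ)..t, ∫ b in (0 : ℝ)..a, q b * y b|
      ≤ (∫ b in (0 : ℝ)..l, |q b|) / κ * N * Real.exp (κ * t) := by
  have hl : 0 ≤ l := ht.1.trans ht.2
  set Q := ∫ b in (0 : ℝ)..l, |q b| with hQ
  have hQ0 : 0 ≤ Q := intervalIntegral.integral_nonneg hl fun _ _ => abs_nonneg _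
  have hqi : ∀ a ∈ Icc (0 : ℝ) l, IntervalIntegrable (fun b => |q b|) volume 0 a := fun a ha => by
    rw [intervalIntegrable_iff_integrableOn_Icc_of_le ha.1]
    exact (hq.mono_set (Icc_subset_Icc_right ha.2)).abs
  have inner : ∀ a ∈ Icc (0 : ℝ) l, ‖∫ b in (0 : ℝ)..a, q b * y b‖ ≤ Q * N * Real.exp (κ * a) := by
    intro a ha
    calc ‖∫ b in (0 : ℝ)..a, q b * y b‖
        ≤ ∫ b in (0 : ℝ)..a, |q b| * (N * Real.exp (κ * a)) := by
          refine intervalIntegral.norm_integral_le_of_norm_le ha.1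
            (Filter.Eventually.of_forall fun b hb => ?_) ((hqi a ha).mul_const _)
          have hb' : b ∈ Icc (0 : ℝ) l := ⟨hb.1.le, hb.2.trans ha.2⟩
          rw [Real.norm_eq_abs, abs_mul]
          refine mul_le_mul_of_nonneg_left ((hyN b hb').trans ?_) (abs_nonneg _)
          gcongr
          exact hb.2
      _ = (∫ b in (0 : ℝ)..a, |q b|) * (N * Real.exp (κ * a)) := by
          rw [intervalIntegral.integral_mul_const]
      _ ≤ Q * (N * Real.exp (κ * a)) := by
          gcongr
          exact intervalIntegral.integral_mono_interval le_rfl ha.1 ha.2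
            (Filter.Eventually.of_forall fun _ => abs_nonneg _) (hqi l ⟨hl, le_rfl⟩)
      _ = _ := by ring
  calc |∫ a in (0 : ℝ)..t, ∫ b in (0 : ℝ)..a, q b * y b|
      ≤ ∫ a in (0 : ℝ)..t, Q * N * Real.exp (κ * a) := by
        refine intervalIntegral.norm_integral_le_of_norm_le ht.1
          (Filter.Eventually.of_forall fun a ha => inner a ⟨ha.1.le, ha.2.trans ht.2⟩)
          (Continuous.intervalIntegrable (by fun_prop) _ _)
    _ = Q * N * ((Real.exp (κ * t) - 1) / κ) := by
        rw [intervalIntegral.integral_const_mul,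
          intervalIntegral.integral_comp_mul_left (fun x => Real.exp x) hκ.ne', integral_exp]
        simp [div_eq_inv_mul]
    _ ≤ Q * N * (Real.exp (κ * t) / κ) := by
        gcongr
        linarith
    _ = _ := by ring

/-- Banach's fixed point theorem for the Volterra form of the equation, with `q` merely integrable.
The unknown is y = e^{-κt}u, so that the plain sup norm on C[0,l] plays the role of a weighted norm.
-/
lemma exists_isSol {q : ℝ → ℝ} (hl : 0 ≤ l) (hq : IntegrableOn q (Icc 0 l)) (a b : ℝ) :
    ∃ u v : ℝ → ℝ, IsSol l q (fun _ => 0) u v ∧ u 0 = a ∧ v 0 = b := by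
  set Q := ∫ b in (0 : ℝ)..l, |q b| with hQ
  have hQ0 : 0 ≤ Q := intervalIntegral.integral_nonneg hl fun _ _ => abs_nonneg _
  -- This weight makes Q/κ ≤ 1/2, which is the contraction constant.
  set κ := 2 * (Q + 1) with hκ
  have hκ0 : 0 < κ := by positivity
  have hκQ : Q / κ ≤ 1 / 2 := by
    rw [div_le_div_iff₀ hκ0 two_pos]; linarith
  -- Recovers u from y on the whole line: y is continued by constants and the weight is put back.
  let extd : C(Icc (0 : ℝ) l, ℝ) → ℝ → ℝ := fun y t => Real.exp (κ * t) * IccExtend hl y t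
  have hextd : ∀ y, Continuous (extd y) := fun y => by
    have := (ContinuousMap.continuous y).Icc_extend' (h := hl)
    fun_prop
  have hI : ∀ y, IntegrableOn (fun t => q t * extd y t) (Icc 0 l) := fun y =>
    hq.mul_continuousOn (hextd y).continuousOn isCompact_Icc
  have hP : ∀ y, IsPrimitive l (fun t => ∫ r in (0 : ℝ)..t, q r * extd y r)
      (fun t => q t * extd y t) := fun y => isPrimitive_integral hl (hI y)
  have hPP : ∀ y, IsPrimitive l (fun t => ∫ x in (0 : ℝ)..t, (b + ∫ r in (0 : ℝ)..x, q r * extd y r))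
      (fun t => b + ∫ r in (0 : ℝ)..t, q r * extd y r) := fun y => isPrimitive_integral hl
    ((continuousOn_const.add (hP y).continuousOn).integrableOn_compact isCompact_Icc)
  let F : C(Icc (0 : ℝ) l, ℝ) → C(Icc (0 : ℝ) l, ℝ) := fun y =>
    ⟨fun t => Real.exp (-(κ * t)) * (a + ∫ x in (0 : ℝ)..t, (b + ∫ r in (0 : ℝ)..x, q r * extd y r)),
      by
        have := continuousOn_iff_continuous_domRestrict.1 (hPP y).continuousOn
        have h2 : Continuous fun t : Icc (0 : ℝ) l =>
          ∫ x in (0 : ℝ)..t, (b + ∫ r in (0 : ℝ)..x, q r * extd y r) := this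
        fun_prop⟩
  have hF : ContractingWith (1 / 2) F := by
    refine ⟨by norm_num, LipschitzWith.of_dist_le_mul fun y z => ?_⟩
    rw [ContinuousMap.dist_le (by positivity)]
    intro t
    have hi : ∀ y, IntervalIntegrable (fun x => b + ∫ r in (0 : ℝ)..x, q r * extd y r) volume 0 t :=
      fun y => (hPP y).intervalIntegrable t.2
    have e : (∫ x in (0 : ℝ)..t, (b + ∫ r in (0 : ℝ)..x, q r * extd y r))
        - ∫ x in (0 : ℝ)..t, (b + ∫ r in (0 : ℝ)..x, q r * extd z r)
        = ∫ x in (0 : ℝ)..t, ∫ r in (0 : ℝ)..x, q r * (extd y r - extd z r) := by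
      rw [← intervalIntegral.integral_sub (hi y) (hi z)]
      refine intervalIntegral.integral_congr fun x hx => ?_
      rw [uIcc_of_le t.2.1] at hx
      have hx' : x ∈ Icc (0 : ℝ) l := ⟨hx.1, hx.2.trans t.2.2⟩
      have := intervalIntegral.integral_sub ((hP y).intervalIntegrable hx')
        ((hP z).intervalIntegrable hx')
      simp only [mul_sub]
      rw [this]
      ring
    have hb := abs_iterated_integral_le (y := fun r => extd y r - extd z r) (N := dist y z) hκ0
      dist_nonneg hq (fun r hr => by
        simp only [extd]
        rw [IccExtend_of_mem hl y hr, IccExtend_of_mem hl z hr, ← mul_sub, abs_mul, Real.abs_exp,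
          mul_comm, ← Real.dist_eq]
        gcongr
        exact ContinuousMap.dist_apply_le_dist _) t.2
    change dist (Real.exp (-(κ * t)) * (a + _)) (Real.exp (-(κ * t)) * (a + _)) ≤ _
    rw [Real.dist_eq, ← mul_sub, add_sub_add_left_eq_sub, e, abs_mul, Real.abs_exp]
    calc Real.exp (-(κ * t)) * |∫ x in (0 : ℝ)..t, ∫ r in (0 : ℝ)..x, q r * (extd y r - extd z r)|
        ≤ Real.exp (-(κ * t)) * (Q / κ * dist y z * Real.exp (κ * t)) := by gcongr
      _ = Q / κ * dist y z * (Real.exp (-(κ * t)) * Real.exp (κ * t)) := by ring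
      _ = Q / κ * dist y z := by rw [← Real.exp_add]; simp
      _ ≤ 1 / 2 * dist y z := by gcongr
      _ = _ := by norm_num
  set y := hF.fixedPoint F with hy
  have hfix : F y = y := hF.fixedPoint_isFixedPt
  set v : ℝ → ℝ := fun t => b + ∫ r in (0 : ℝ)..t, q r * extd y r with hv
  have hu : ∀ t ∈ Icc (0 : ℝ) l, extd y t = a + ∫ x in (0 : ℝ)..t, v x := by
    intro t ht
    have h1 := congrArg (fun z : C(Icc (0 : ℝ) l, ℝ) => z ⟨t, ht⟩) hfix
    have h2 : y ⟨t, ht⟩ = Real.exp (-(κ * t)) * (a + ∫ x in (0 : ℝ)..t, v x) := h1.symm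
    simp only [extd]
    rw [IccExtend_of_mem hl y ht, h2, ← mul_assoc, ← Real.exp_add]
    simp
  have h00 : (0 : ℝ) ∈ Icc (0 : ℝ) l := ⟨le_rfl, hl⟩
  have hu0 : extd y 0 = a := by rw [hu 0 h00]; simp
  refine ⟨extd y, v, ⟨⟨hl, (hPP y).integrableOn, fun t ht => ?_⟩,
    ⟨hl, by simpa using hI y, fun t ht => ?_⟩⟩, hu0, by simp [hv]⟩
  · rw [hu0, hu t ht]
  · simp [hv]

lemma exists_isFundamental {q : ℝ → ℝ} (hl : 0 ≤ l) (hq : IntegrableOn q (Icc 0 l)) :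
    ∃ c c' s s' : ℝ → ℝ, IsFundamental l q c c' s s' := by
  obtain ⟨c, c', h1, h2, h3⟩ := exists_isSol hl hq 1 0
  obtain ⟨s, s', h4, h5, h6⟩ := exists_isSol hl hq 0 1
  exact ⟨c, c', s, s', h1, h4, h2, h3, h5, h6⟩

end Equation

/-! ### Perturbation of solutions -/

section Perturbation

variable {l : ℝ} {q p u v c c' s s' V : ℝ → ℝ}

/-- Keeping `c` and `s` together in one kernel lets the addition theorems for trigonometric and
hyperbolic functions act before absolute values are taken. -/
lemma IsFundamental.eq_kernel {f : ℝ → ℝ} (h : IsFundamental l q c c' s s')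
    (hu : IsSol l q f u v) (hf : IntegrableOn f (Icc 0 l)) {t : ℝ} (ht : t ∈ Icc (0 : ℝ) l) :
    u t - (u 0 * c t + v 0 * s t) = (∫ r in (0 : ℝ)..t, (c t * s r - s t * c r) * f r) ∧
    v t - (u 0 * c' t + v 0 * s' t) = ∫ r in (0 : ℝ)..t, (c' t * s r - s' t * c r) * f r := by
  have hl := h.cos.nonneg
  have hs := (isPrimitive_integral hl
    (hf.mul_continuousOn h.sin.fst.continuousOn isCompact_Icc)).intervalIntegrable ht
  have hc := (isPrimitive_integral hl
    (hf.mul_continuousOn h.cos.fst.continuousOn isCompact_Icc)).intervalIntegrable ht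
  have e : ∀ a b : ℝ, ∫ r in (0 : ℝ)..t, (a * s r - b * c r) * f r =
      (a * ∫ r in (0 : ℝ)..t, f r * s r) - b * ∫ r in (0 : ℝ)..t, f r * c r := fun a b => by
    rw [← intervalIntegral.integral_const_mul, ← intervalIntegral.integral_const_mul,
      ← intervalIntegral.integral_sub (hs.const_mul a) (hc.const_mul b)]
    congr 1
    ext r
    ring
  rw [e, e]
  exact ⟨by linear_combination h.eq_fst hu ht, by linear_combination h.eq_snd hu ht⟩

/-- The growth e^{κ(t-r)} of the kernel and e^{κr} of `u` multiply to e^{κt}, independent of r. The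
value κ = 0 serves oscillating and κ = k hyperbolic solutions. -/
lemma abs_volterra_le {k : ℝ → ℝ} {A N κ : ℝ} (hA : 0 ≤ A) (hN : 0 ≤ N)
    (hp : IntegrableOn p (Icc 0 l)) (hu : ∀ r ∈ Icc (0 : ℝ) l, |u r| ≤ N * Real.exp (κ * r))
    {t : ℝ} (ht : t ∈ Icc (0 : ℝ) l)
    (hk : ∀ r ∈ Icc (0 : ℝ) t, |k r| ≤ A * Real.exp (κ * (t - r))) :
    |∫ r in (0 : ℝ)..t, k r * (p r * u r)|
      ≤ A * N * (∫ r in (0 : ℝ)..l, |p r|) * Real.exp (κ * t) := by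
  have hl : 0 ≤ l := ht.1.trans ht.2
  have hpi : ∀ a ∈ Icc (0 : ℝ) l, IntervalIntegrable (fun b => |p b|) volume 0 a := fun a ha => by
    rw [intervalIntegrable_iff_integrableOn_Icc_of_le ha.1]
    exact (hp.mono_set (Icc_subset_Icc_right ha.2)).abs
  calc |∫ r in (0 : ℝ)..t, k r * (p r * u r)|
      ≤ ∫ r in (0 : ℝ)..t, |p r| * (A * N * Real.exp (κ * t)) := by
        rw [← Real.norm_eq_abs]
        refine intervalIntegral.norm_integral_le_of_norm_le ht.1
          (Filter.Eventually.of_forall fun r hr => ?_) ((hpi t ht).mul_const _)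
        have e : Real.exp (κ * t) = Real.exp (κ * (t - r)) * Real.exp (κ * r) := by
          rw [← Real.exp_add]; ring_nf
        rw [Real.norm_eq_abs, abs_mul, abs_mul, e]
        calc |k r| * (|p r| * |u r|)
            ≤ (A * Real.exp (κ * (t - r))) * (|p r| * (N * Real.exp (κ * r))) := by
              gcongr
              · exact hk r ⟨hr.1.le, hr.2⟩
              · exact hu r ⟨hr.1.le, hr.2.trans ht.2⟩
          _ = _ := by ring
    _ = (∫ r in (0 : ℝ)..t, |p r|) * (A * N * Real.exp (κ * t)) := by
        rw [intervalIntegral.integral_mul_const]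
    _ ≤ (∫ r in (0 : ℝ)..l, |p r|) * (A * N * Real.exp (κ * t)) := by
        gcongr
        exact intervalIntegral.integral_mono_interval le_rfl ht.1 ht.2
          (Filter.Eventually.of_forall fun _ => abs_nonneg _) (hpi l ⟨hl, le_rfl⟩)
    _ = _ := by ring

/-- Comparison of a solution of `-u'' + (q - p) u = 0` with the solution of `-u'' + q u = 0` with
the same initial values, when the perturbation `p` is small relative to the Green kernel. -/
lemma IsFundamental.perturbation (h : IsFundamental l q c c' s s')
    (hp : IntegrableOn p (Icc 0 l)) (hu : IsSol l q (fun t => p t * u t) u v)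
    {A A' B κ : ℝ} (hA : 0 ≤ A) (hA' : 0 ≤ A')
    (hAp : A * (∫ r in (0 : ℝ)..l, |p r|) ≤ 1 / 2)
    (hk : ∀ t ∈ Icc (0 : ℝ) l, ∀ r ∈ Icc (0 : ℝ) t,
      |c t * s r - s t * c r| ≤ A * Real.exp (κ * (t - r)))
    (hk' : ∀ t ∈ Icc (0 : ℝ) l, ∀ r ∈ Icc (0 : ℝ) t,
      |c' t * s r - s' t * c r| ≤ A' * Real.exp (κ * (t - r)))
    (hB : ∀ t ∈ Icc (0 : ℝ) l, |u 0 * c t + v 0 * s t| ≤ B * Real.exp (κ * t))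
    {t : ℝ} (ht : t ∈ Icc (0 : ℝ) l) :
    |u t - (u 0 * c t + v 0 * s t)|
      ≤ A * (2 * B) * (∫ r in (0 : ℝ)..l, |p r|) * Real.exp (κ * t) ∧
    |v t - (u 0 * c' t + v 0 * s' t)|
      ≤ A' * (2 * B) * (∫ r in (0 : ℝ)..l, |p r|) * Real.exp (κ * t) := by
  have hl : 0 ≤ l := ht.1.trans ht.2
  have h0 : (0 : ℝ) ∈ Icc (0 : ℝ) l := ⟨le_rfl, hl⟩
  have huc := hu.fst.continuousOn
  have hpu : IntegrableOn (fun t => p t * u t) (Icc 0 l) :=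
    hp.mul_continuousOn huc isCompact_Icc
  have hB0 : 0 ≤ B := by
    have := (abs_nonneg _).trans (hB 0 h0)
    simpa using this
  set P := ∫ r in (0 : ℝ)..l, |p r| with hP
  -- A priori bound: the maximum N of e^{-κr}|u(r)| satisfies N ≤ B + N/2 by the smallness of `p`,
  -- whence N ≤ 2B.
  have hu2 : ∀ r ∈ Icc (0 : ℝ) l, |u r| ≤ (2 * B) * Real.exp (κ * r) := by
    have hcont : ContinuousOn (fun r => |u r| * Real.exp (-(κ * r))) (Icc 0 l) :=
      huc.abs.mul (Continuous.continuousOn (by fun_prop))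
    obtain ⟨τ, hτ, hmax⟩ := isCompact_Icc.exists_isMaxOn ⟨0, h0⟩ hcont
    set N := |u τ| * Real.exp (-(κ * τ)) with hN
    have hN0 : 0 ≤ N := by positivity
    have hexp : ∀ r, Real.exp (-(κ * r)) * Real.exp (κ * r) = 1 := fun r => by
      rw [← Real.exp_add]; simp
    have huN : ∀ r ∈ Icc (0 : ℝ) l, |u r| ≤ N * Real.exp (κ * r) := fun r hr => by
      have h1 : |u r| * Real.exp (-(κ * r)) ≤ N := hmax hr
      calc |u r| = |u r| * Real.exp (-(κ * r)) * Real.exp (κ * r) := by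
            rw [mul_assoc, hexp, mul_one]
        _ ≤ _ := by gcongr
    have h1 := abs_volterra_le hA hN0 hp huN hτ (hk τ hτ)
    rw [← (h.eq_kernel hu hpu hτ).1] at h1
    have h2 : |u τ| ≤ (B + N / 2) * Real.exp (κ * τ) := by
      have h3 : |u τ| ≤ |u τ - (u 0 * c τ + v 0 * s τ)| + |u 0 * c τ + v 0 * s τ| := by
        simpa using abs_add_le (u τ - (u 0 * c τ + v 0 * s τ)) (u 0 * c τ + v 0 * s τ)
      have h4 : A * N * P * Real.exp (κ * τ) ≤ N / 2 * Real.exp (κ * τ) := by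
        gcongr
        calc A * N * P = A * P * N := by ring
          _ ≤ 1 / 2 * N := by gcongr
          _ = N / 2 := by ring
      have h5 := hB τ hτ
      linarith
    have h3 : N ≤ B + N / 2 := by
      calc N ≤ (B + N / 2) * Real.exp (κ * τ) * Real.exp (-(κ * τ)) := by
            rw [hN] at h2 ⊢
            gcongr
        _ = B + N / 2 := by rw [mul_assoc, mul_comm (Real.exp _), hexp, mul_one]
    intro r hr
    refine (huN r hr).trans ?_
    gcongr
    linarith
  have hB2 : 0 ≤ 2 * B := by positivity
  rw [(h.eq_kernel hu hpu ht).1, (h.eq_kernel hu hpu ht).2]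
  exact ⟨abs_volterra_le hA hB2 hp hu2 ht (hk t ht), abs_volterra_le hA' hB2 hp hu2 ht (hk' t ht)⟩

/-! ### Dependence on the spectral parameter -/

lemma IsSol.change_parameter {x y : ℝ} (h : IsSol l (fun t => V t - y) (fun _ => 0) u v) :
    IsSol l (fun t => V t - x) (fun t => (y - x) * u t) u v :=
  h.congr_ae (Filter.Eventually.of_forall fun t => by ring)

/-- Solutions depend on the spectral parameter in a locally Lipschitz way. -/
lemma IsFundamental.lipschitz_parameter {x : ℝ}
    (h : IsFundamental l (fun t => V t - x) c c' s s') (a b : ℝ) :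
    ∃ D δ : ℝ, 0 ≤ D ∧ 0 < δ ∧ ∀ (y : ℝ) (u v : ℝ → ℝ), |y - x| < δ →
      IsSol l (fun t => V t - y) (fun _ => 0) u v → u 0 = a → v 0 = b →
      ∀ t ∈ Icc (0 : ℝ) l, |u t - (a * c t + b * s t)| ≤ D * |y - x| ∧
        |v t - (a * c' t + b * s' t)| ≤ D * |y - x| := by
  have hl := h.cos.nonneg
  have hbd : ∀ {f : ℝ → ℝ}, ContinuousOn f (Icc 0 l) → ∃ K, 0 ≤ K ∧ ∀ t ∈ Icc (0 : ℝ) l,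
      |f t| ≤ K := fun hf => by
    obtain ⟨K, hK⟩ := isCompact_Icc.exists_bound_of_continuousOn hf
    exact ⟨K, (norm_nonneg _).trans (hK 0 ⟨le_rfl, hl⟩), hK⟩
  obtain ⟨K₁, hK₁, h₁⟩ := hbd h.cos.fst.continuousOn
  obtain ⟨K₂, hK₂, h₂⟩ := hbd h.sin.fst.continuousOn
  obtain ⟨K₃, hK₃, h₃⟩ := hbd h.cos.snd.continuousOn
  obtain ⟨K₄, hK₄, h₄⟩ := hbd h.sin.snd.continuousOn
  have key : ∀ {f g : ℝ → ℝ} {K L : ℝ}, 0 ≤ K → 0 ≤ L → (∀ t ∈ Icc (0 : ℝ) l, |f t| ≤ K) →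
      (∀ t ∈ Icc (0 : ℝ) l, |g t| ≤ L) → ∀ t ∈ Icc (0 : ℝ) l, ∀ r ∈ Icc (0 : ℝ) t,
      |f t * s r - g t * c r| ≤ (K * K₂ + L * K₁) * Real.exp (0 * (t - r)) := by
    intro f g K L hK hL hf hg t ht r hr
    have hr' : r ∈ Icc (0 : ℝ) l := ⟨hr.1, hr.2.trans ht.2⟩
    rw [zero_mul, Real.exp_zero, mul_one]
    refine (abs_sub _ _).trans ?_
    rw [abs_mul, abs_mul]
    have := hf t ht
    have := hg t ht
    have := h₁ r hr'
    have := h₂ r hr'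
    gcongr
  set A := K₁ * K₂ + K₂ * K₁
  set A' := K₃ * K₂ + K₄ * K₁
  set B := |a| * K₁ + |b| * K₂
  have hA : 0 ≤ A := by positivity
  have hA' : 0 ≤ A' := by positivity
  have hB : 0 ≤ B := by positivity
  -- The perturbation is the constant y - x, with integral of modulus l|y - x|; this δ makes A·l·|y
  -- - x| ≤ 1/2.
  refine ⟨(A + A') * (2 * B) * l, 1 / (2 * (A * l + 1)), by positivity, by positivity,
    fun y u v hy hu hu0 hv0 t ht => ?_⟩
  have hP : ∫ _ in (0 : ℝ)..l, |y - x| = l * |y - x| := by simp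
  have hp := h.perturbation (p := fun _ => y - x) (A := A) (A' := A') (B := B) (κ := 0)
    (integrableOn_const (by simp)) hu.change_parameter hA hA' (by
      rw [hP]
      rw [lt_div_iff₀ (by positivity)] at hy
      nlinarith [abs_nonneg (y - x)])
    (key hK₁ hK₂ h₁ h₂) (key hK₃ hK₄ h₃ h₄) (fun t ht => by
      rw [zero_mul, Real.exp_zero, mul_one, hu0, hv0]
      refine (abs_add_le _ _).trans ?_
      rw [abs_mul, abs_mul]
      have := h₁ t ht
      have := h₂ t ht
      simp only [B]
      gcongr) ht
  rw [hP, zero_mul, Real.exp_zero, mul_one, hu0, hv0] at hp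
  have h5 : 0 ≤ A * (2 * B) * (l * |y - x|) := by positivity
  have h6 : 0 ≤ A' * (2 * B) * (l * |y - x|) := by positivity
  exact ⟨by linarith [hp.1], by linarith [hp.2]⟩

lemma continuousAt_of_lipschitz {F : ℝ → ℝ} {x D δ : ℝ} (hδ : 0 < δ)
    (h : ∀ y, |y - x| < δ → |F y - F x| ≤ D * |y - x|) : ContinuousAt F x := by
  rw [ContinuousAt, tendsto_iff_norm_sub_tendsto_zero]
  refine squeeze_zero' (Filter.Eventually.of_forall fun _ => norm_nonneg _)
    (g := fun y => D * |y - x|) ?_ ?_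
  · filter_upwards [Metric.ball_mem_nhds x hδ] with y hy
    exact h y hy
  · have : ContinuousAt (fun y => D * |y - x|) x := by fun_prop
    simpa [ContinuousAt] using this

variable {C C' S S' : ℝ → ℝ → ℝ}

lemma continuous_fundamental
    (H : ∀ x, IsFundamental l (fun t => V t - x) (C x) (C' x) (S x) (S' x)) :
    Continuous (fun x => C x l) ∧ Continuous (fun x => S x l) ∧ Continuous (fun x => S' x l) := by
  have hl : l ∈ Icc (0 : ℝ) l := ⟨(H 0).cos.nonneg, le_rfl⟩
  refine ⟨continuous_iff_continuousAt.2 fun x => ?_, continuous_iff_continuousAt.2 fun x => ?_,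
    continuous_iff_continuousAt.2 fun x => ?_⟩
  · obtain ⟨D, δ, -, hδ, h⟩ := (H x).lipschitz_parameter 1 0
    refine continuousAt_of_lipschitz (D := D) hδ fun y hy => ?_
    simpa using (h y _ _ hy (H y).cos (H y).cos_zero (H y).cos_deriv_zero l hl).1
  all_goals
    obtain ⟨D, δ, -, hδ, h⟩ := (H x).lipschitz_parameter 0 1
    refine continuousAt_of_lipschitz (D := D) hδ fun y hy => ?_
    have := h y _ _ hy (H y).sin (H y).sin_zero (H y).sin_deriv_zero l hl
  · simpa using this.1
  · simpa using this.2

lemma IsFundamental.exists_sin_ne_zero (hl : 0 < l) (h : IsFundamental l q c c' s s') :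
    ∃ t ∈ Icc (0 : ℝ) l, s t ≠ 0 := by
  by_contra! hs
  have h1 : (fun t => (s' t : ℂ)) =ᵐ[edgeMeasure l] 0 := by
    refine ae_eq_zero_of_primitive hl h.ofReal.sin.fst.integrableOn fun t ht => ?_
    have := h.ofReal.sin.fst.eq t ht
    simpa [hs t ht, h.sin_zero] using this.symm
  have h2 := eq_zero_of_ae hl h.ofReal.sin.snd.continuousOn h1 0 ⟨le_rfl, hl.le⟩
  simp [h.sin_deriv_zero] at h2

lemma IsFundamental.integral_sin_sq_pos (hl : 0 < l) (h : IsFundamental l q c c' s s') :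
    0 < ∫ t in (0 : ℝ)..l, s t * s t := by
  obtain ⟨t, ht, hst⟩ := h.exists_sin_ne_zero hl
  have hc := h.sin.fst.continuousOn
  exact intervalIntegral.integral_pos hl (hc.mul hc) (fun x _ => mul_self_nonneg _)
    ⟨t, ht, mul_self_pos.2 hst⟩

/-- Near a zero of `x ↦ s(l;x)` the sign of this function is determined by `s'(l;x)`. -/
lemma sign_near_zero (hl : 0 < l)
    (H : ∀ x, IsFundamental l (fun t => V t - x) (C x) (C' x) (S x) (S' x)) {x : ℝ}
    (hx : S x l = 0) :
    ∃ δ > 0, ∀ y, y ≠ x → |y - x| < δ → 0 < (y - x) * (S' x l * S y l) := by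
  obtain ⟨D, δ, hD, hδ, h⟩ := (H x).lipschitz_parameter 0 1
  have hll : l ∈ Icc (0 : ℝ) l := ⟨hl.le, le_rfl⟩
  have hc := fun y => (H y).sin.fst.continuousOn
  have hpos := (H x).integral_sin_sq_pos hl
  set I := ∫ t in (0 : ℝ)..l, S x t * S x t with hI
  obtain ⟨K, hK⟩ := isCompact_Icc.exists_bound_of_continuousOn (hc x)
  have hK0 : 0 ≤ K := (norm_nonneg _).trans (hK l hll)
  -- The second bound keeps K·D·l·|y - x| below I, so ∫ s(·;x)s(·;y) stays positive.
  refine ⟨min δ (I / (K * D * l + 1)), lt_min hδ (by positivity), fun y hyx hy => ?_⟩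
  have hy1 := hy.trans_le (min_le_left _ _)
  have hy2 := hy.trans_le (min_le_right _ _)
  -- Since s(l;x) = 0, this reads s'(l;x)s(l;y) = (y - x)∫ s(·;x)s(·;y), and the integral is close
  -- to ∫ s(·;x)² > 0.
  have hlag := (H x).sin.lagrange ((H y).sin.change_parameter (x := x)) hll
  have e1 : ∫ t in (0 : ℝ)..l, (0 * S y t - S x t * ((y - x) * S y t)) =
      -(y - x) * ∫ t in (0 : ℝ)..l, S x t * S y t := by
    rw [← intervalIntegral.integral_const_mul]
    congr 1
    ext t
    ring
  rw [e1, hx, (H x).sin_zero, (H y).sin_zero] at hlag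
  have hii : ∀ y, IntervalIntegrable (fun t => S x t * S y t) volume 0 l := fun y =>
    ContinuousOn.intervalIntegrable (by rw [uIcc_of_le hl.le]; exact (hc x).mul (hc y))
  have e2 : |(∫ t in (0 : ℝ)..l, S x t * S y t) - I| ≤ K * (D * |y - x|) * |l - 0| := by
    rw [hI, ← intervalIntegral.integral_sub (hii y) (hii x), ← Real.norm_eq_abs]
    refine intervalIntegral.norm_integral_le_of_norm_le_const fun t ht => ?_
    rw [uIoc_of_le hl.le] at ht
    have ht' : t ∈ Icc (0 : ℝ) l := ⟨ht.1.le, ht.2⟩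
    rw [← mul_sub, norm_mul]
    have h1 := (h y _ _ hy1 (H y).sin (H y).sin_zero (H y).sin_deriv_zero t ht').1
    have h2 := hK t ht'
    simp only [zero_mul, one_mul, zero_add] at h1
    rw [Real.norm_eq_abs (S y t - S x t)]
    gcongr
  have e3 : 0 < ∫ t in (0 : ℝ)..l, S x t * S y t := by
    have h1 := (abs_le.1 e2).1
    rw [sub_zero, abs_of_pos hl] at h1
    rw [lt_div_iff₀ (by positivity)] at hy2
    have h2 := abs_nonneg (y - x)
    nlinarith
  have e4 : (y - x) * (S' x l * S y l) = (y - x) ^ 2 * ∫ t in (0 : ℝ)..l, S x t * S y t := by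
    linear_combination (x - y) * hlag
  rw [e4]
  have : y - x ≠ 0 := sub_ne_zero.2 hyx
  positivity

end Perturbation

/-! ### Asymptotics for large spectral parameters -/

section Asymptotics

variable {l : ℝ} {V : ℝ → ℝ} {C C' S S' : ℝ → ℝ → ℝ}

lemma isFundamental_trig (hl : 0 ≤ l) {k : ℝ} (hk : k ≠ 0) :
    IsFundamental l (fun _ => -k ^ 2) (fun t => Real.cos (k * t)) (fun t => -k * Real.sin (k * t))
      (fun t => Real.sin (k * t) / k) (fun t => Real.cos (k * t)) := by
  have hlin : ∀ t, HasDerivAt (fun t => k * t) k t := fun t => by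
    simpa using (hasDerivAt_id t).const_mul k
  have hc : ∀ t, HasDerivAt (fun t => Real.cos (k * t)) (-k * Real.sin (k * t)) t := fun t => by
    convert (hlin t).cos using 1; ring
  have hs : ∀ t, HasDerivAt (fun t => Real.sin (k * t)) (k * Real.cos (k * t)) t := fun t => by
    convert (hlin t).sin using 1; ring
  refine ⟨⟨?_, ?_⟩, ⟨?_, ?_⟩, by simp, by simp, by simp, by simp⟩
  · exact isPrimitive_of_hasDerivAt hl hc (by fun_prop)
  · refine isPrimitive_of_hasDerivAt hl (fun t => ?_) (by fun_prop)
    convert (hs t).const_mul (-k) using 1; ring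
  · refine isPrimitive_of_hasDerivAt hl (fun t => ?_) (by fun_prop)
    convert (hs t).div_const k using 1; field_simp
  · refine isPrimitive_of_hasDerivAt hl (fun t => ?_) (by fun_prop)
    exact (hc t).congr_deriv (by field_simp; simp)

lemma isFundamental_hyp (hl : 0 ≤ l) {k : ℝ} (hk : k ≠ 0) :
    IsFundamental l (fun _ => k ^ 2) (fun t => Real.cosh (k * t)) (fun t => k * Real.sinh (k * t))
      (fun t => Real.sinh (k * t) / k) (fun t => Real.cosh (k * t)) := by
  have hlin : ∀ t, HasDerivAt (fun t => k * t) k t := fun t => by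
    simpa using (hasDerivAt_id t).const_mul k
  have hc : ∀ t, HasDerivAt (fun t => Real.cosh (k * t)) (k * Real.sinh (k * t)) t := fun t => by
    convert (hlin t).cosh using 1; ring
  have hs : ∀ t, HasDerivAt (fun t => Real.sinh (k * t)) (k * Real.cosh (k * t)) t := fun t => by
    convert (hlin t).sinh using 1; ring
  refine ⟨⟨?_, ?_⟩, ⟨?_, ?_⟩, by simp, by simp, by simp, by simp⟩
  · exact isPrimitive_of_hasDerivAt hl hc (by fun_prop)
  · refine isPrimitive_of_hasDerivAt hl (fun t => ?_) (by fun_prop)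
    convert (hs t).const_mul k using 1; ring
  · refine isPrimitive_of_hasDerivAt hl (fun t => ?_) (by fun_prop)
    convert (hs t).div_const k using 1; field_simp
  · refine isPrimitive_of_hasDerivAt hl (fun t => ?_) (by fun_prop)
    exact (hc t).congr_deriv (by field_simp; simp)

/-- The free equation at energy k² is the reference and `V` the perturbation. The kernel is
-sin(k(t-r))/k, so A = 1/k, and the smallness condition is the assumed lower bound for k. -/
lemma abs_sin_sub_le (hl : 0 ≤ l) (hV : IntegrableOn V (Icc 0 l))
    (H : ∀ x, IsFundamental l (fun t => V t - x) (C x) (C' x) (S x) (S' x)) {k : ℝ} (hk : 0 < k)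
    (hkV : 2 * (∫ t in (0 : ℝ)..l, |V t|) ≤ k) :
    |S (k ^ 2) l - Real.sin (k * l) / k| ≤ 2 * (∫ t in (0 : ℝ)..l, |V t|) / k ^ 2 := by
  have hll : l ∈ Icc (0 : ℝ) l := ⟨hl, le_rfl⟩
  have hsol : IsSol l (fun _ => -k ^ 2) (fun t => -V t * S (k ^ 2) t) (S (k ^ 2)) (S' (k ^ 2)) :=
    (H (k ^ 2)).sin.congr_ae (Filter.Eventually.of_forall fun t => by ring)
  have h := (isFundamental_trig hl hk.ne').perturbation (A := 1 / k) (A' := 1) (B := 1 / k)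
    (κ := 0) hV.neg hsol (by positivity) zero_le_one (by
      simp only [Pi.neg_apply, abs_neg]
      rw [one_div, inv_mul_le_iff₀ hk]; linarith)
    (fun t _ r _ => by
      have e : Real.cos (k * t) * (Real.sin (k * r) / k) - Real.sin (k * t) / k * Real.cos (k * r)
          = -Real.sin (k * t - k * r) / k := by rw [Real.sin_sub]; ring
      rw [e, zero_mul, Real.exp_zero, mul_one, abs_div, abs_neg, abs_of_pos hk]
      gcongr
      exact Real.abs_sin_le_one _)
    (fun t _ r _ => by
      have e : -k * Real.sin (k * t) * (Real.sin (k * r) / k) - Real.cos (k * t) * Real.cos (k * r)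
          = -Real.cos (k * t - k * r) := by rw [Real.cos_sub]; field_simp; ring
      rw [e, zero_mul, Real.exp_zero, mul_one, abs_neg]
      exact Real.abs_cos_le_one _)
    (fun t _ => by
      simp only [(H (k ^ 2)).sin_zero, (H (k ^ 2)).sin_deriv_zero, zero_mul, zero_add, one_mul,
        Real.exp_zero, mul_one]
      rw [abs_div, abs_of_pos hk]
      gcongr
      exact Real.abs_sin_le_one _) hll
  simp only [(H (k ^ 2)).sin_zero, (H (k ^ 2)).sin_deriv_zero, zero_mul, zero_add, one_mul,
    Real.exp_zero, mul_one, Pi.neg_apply, abs_neg] at h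
  refine h.1.trans (le_of_eq ?_)
  field_simp

/-- With kl ≡ π/2 or 3π/2 modulo 2π, k·s(l;k²) lies within 1 of +1 or -1. Taking k large gives a
sign change of s(l;·) beyond `X`. -/
lemma exists_sin_eq_zero_gt (hl : 0 < l) (hV : IntegrableOn V (Icc 0 l))
    (H : ∀ x, IsFundamental l (fun t => V t - x) (C x) (C' x) (S x) (S' x)) (X : ℝ) :
    ∃ x > X, S x l = 0 := by
  set P := ∫ t in (0 : ℝ)..l, |V t| with hP
  have hP0 : 0 ≤ P := intervalIntegral.integral_nonneg hl.le fun _ _ => abs_nonneg _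
  obtain ⟨n, hn⟩ := exists_nat_gt ((2 * P + |X| + 1) * l)
  have hpi := Real.pi_gt_three
  have key : ∀ a : ℝ, 0 < a → 2 * P < (a + n * (2 * Real.pi)) / l ∧
      |X| + 1 < (a + n * (2 * Real.pi)) / l := by
    intro a ha
    have hn0 : (0 : ℝ) ≤ n := n.cast_nonneg
    have h1 : 2 * P + |X| + 1 < (a + n * (2 * Real.pi)) / l := by
      rw [lt_div_iff₀ hl]
      nlinarith
    constructor <;> linarith [abs_nonneg X]
  have est : ∀ a : ℝ, 0 < a → ∃ k, 0 < k ∧ |X| + 1 < k ∧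
      k = (a + n * (2 * Real.pi)) / l ∧ |k * S (k ^ 2) l - Real.sin a| < 1 := by
    intro a ha
    obtain ⟨h1, h2⟩ := key a ha
    set k := (a + n * (2 * Real.pi)) / l with hk
    have hk0 : 0 < k := by linarith [abs_nonneg X]
    refine ⟨k, hk0, h2, rfl, ?_⟩
    have h3 := abs_sin_sub_le hl.le hV H hk0 h1.le
    have h4 : Real.sin (k * l) = Real.sin a := by
      rw [hk, div_mul_cancel₀ _ hl.ne', Real.sin_add_nat_mul_two_pi]
    rw [h4] at h3
    have h5 : k * S (k ^ 2) l - Real.sin a = k * (S (k ^ 2) l - Real.sin a / k) := by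
      field_simp
    rw [h5, abs_mul, abs_of_pos hk0]
    calc k * |S (k ^ 2) l - Real.sin a / k| ≤ k * (2 * P / k ^ 2) := by gcongr
      _ = 2 * P / k := by field_simp
      _ < 1 := by rw [div_lt_one hk0]; exact h1
  have hcont := (continuous_fundamental H).2.1
  obtain ⟨k₁, hk₁, hX₁, -, h₁⟩ := est (Real.pi / 2) (by positivity)
  obtain ⟨k₂, hk₂, hX₂, -, h₂⟩ := est (Real.pi / 2 + Real.pi) (by positivity)
  rw [Real.sin_add_pi, Real.sin_pi_div_two] at h₂
  rw [Real.sin_pi_div_two] at h₁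
  have hS₁ : 0 < S (k₁ ^ 2) l := by
    have := (abs_lt.1 h₁).1
    exact pos_of_mul_pos_right (by linarith) hk₁.le
  have hS₂ : S (k₂ ^ 2) l < 0 := by
    have := (abs_lt.1 h₂).2
    by_contra! hc
    have := mul_nonneg hk₂.le hc
    linarith
  obtain ⟨x, hx, hx0⟩ := intermediate_value_uIcc (hcont.continuousOn
    (s := uIcc (k₁ ^ 2) (k₂ ^ 2))) (show (0 : ℝ) ∈ uIcc (S (k₁ ^ 2) l) (S (k₂ ^ 2) l) from
      mem_uIcc.2 (Or.inr ⟨hS₂.le, hS₁.le⟩))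
  refine ⟨x, ?_, hx0⟩
  have hsq : ∀ k : ℝ, |X| + 1 < k → X < k ^ 2 := fun k hk => by
    nlinarith [abs_nonneg X, le_abs_self X]
  exact (lt_min (hsq _ hX₁) (hsq _ hX₂)).trans_le hx.1

/-- The counterpart of `abs_sin_sub_le` at energy -k², with weight e^{kt} because the free solutions
are now hyperbolic. -/
lemma hyp_estimates (hl : 0 ≤ l) (hV : IntegrableOn V (Icc 0 l))
    (H : ∀ x, IsFundamental l (fun t => V t - x) (C x) (C' x) (S x) (S' x)) {k : ℝ} (hk : 0 < k)
    (hkV : 2 * (∫ t in (0 : ℝ)..l, |V t|) ≤ k) :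
    |S (-k ^ 2) l - Real.sinh (k * l) / k|
      ≤ 2 * (∫ t in (0 : ℝ)..l, |V t|) / k ^ 2 * Real.exp (k * l) ∧
    |S' (-k ^ 2) l - Real.cosh (k * l)|
      ≤ 2 * (∫ t in (0 : ℝ)..l, |V t|) / k * Real.exp (k * l) ∧
    |C (-k ^ 2) l - Real.cosh (k * l)|
      ≤ 2 * (∫ t in (0 : ℝ)..l, |V t|) / k * Real.exp (k * l) := by
  have hll : l ∈ Icc (0 : ℝ) l := ⟨hl, le_rfl⟩
  have hsol : ∀ {u v : ℝ → ℝ}, IsSol l (fun t => V t - -k ^ 2) (fun _ => 0) u v →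
      IsSol l (fun _ => k ^ 2) (fun t => -V t * u t) u v := fun h =>
    h.congr_ae (Filter.Eventually.of_forall fun t => by ring)
  have hch : ∀ {x : ℝ}, 0 ≤ x → |Real.cosh x| ≤ Real.exp x := fun {x} hx => by
    rw [abs_of_pos (Real.cosh_pos x), ← Real.cosh_add_sinh]
    linarith [Real.sinh_nonneg_iff.2 hx]
  have hsh : ∀ {x : ℝ}, 0 ≤ x → |Real.sinh x| ≤ Real.exp x := fun {x} hx => by
    rw [abs_of_nonneg (Real.sinh_nonneg_iff.2 hx), ← Real.cosh_add_sinh]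
    linarith [Real.cosh_pos x]
  have hP : 1 / k * (∫ t in (0 : ℝ)..l, |(-V) t|) ≤ 1 / 2 := by
    simp only [Pi.neg_apply, abs_neg]
    rw [one_div, inv_mul_le_iff₀ hk]; linarith
  have hk1 : ∀ t ∈ Icc (0 : ℝ) l, ∀ r ∈ Icc (0 : ℝ) t,
      |Real.cosh (k * t) * (Real.sinh (k * r) / k) - Real.sinh (k * t) / k * Real.cosh (k * r)|
        ≤ 1 / k * Real.exp (k * (t - r)) := fun t _ r hr => by
    have e : Real.cosh (k * t) * (Real.sinh (k * r) / k)
        - Real.sinh (k * t) / k * Real.cosh (k * r) = -Real.sinh (k * (t - r)) / k := by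
      rw [mul_sub, Real.sinh_sub]; ring
    rw [e, abs_div, abs_neg, abs_of_pos hk, div_eq_inv_mul, one_div]
    gcongr
    exact hsh (mul_nonneg hk.le (sub_nonneg.2 hr.2))
  have hk2 : ∀ t ∈ Icc (0 : ℝ) l, ∀ r ∈ Icc (0 : ℝ) t,
      |k * Real.sinh (k * t) * (Real.sinh (k * r) / k) - Real.cosh (k * t) * Real.cosh (k * r)|
        ≤ 1 * Real.exp (k * (t - r)) := fun t _ r hr => by
    have e : k * Real.sinh (k * t) * (Real.sinh (k * r) / k)
        - Real.cosh (k * t) * Real.cosh (k * r) = -Real.cosh (k * (t - r)) := by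
      rw [mul_sub, Real.cosh_sub]; field_simp; ring
    rw [e, abs_neg, one_mul]
    exact hch (mul_nonneg hk.le (sub_nonneg.2 hr.2))
  have hS := (isFundamental_hyp hl hk.ne').perturbation (B := 1 / k) (κ := k) hV.neg
    (hsol (H (-k ^ 2)).sin) (by positivity) zero_le_one hP hk1 hk2 (fun t ht => by
      simp only [(H (-k ^ 2)).sin_zero, (H (-k ^ 2)).sin_deriv_zero, zero_mul, zero_add, one_mul]
      rw [abs_div, abs_of_pos hk, div_eq_inv_mul, one_div]
      gcongr
      exact hsh (mul_nonneg hk.le ht.1)) hll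
  have hC := (isFundamental_hyp hl hk.ne').perturbation (B := 1) (κ := k) hV.neg
    (hsol (H (-k ^ 2)).cos) (by positivity) zero_le_one hP hk1 hk2 (fun t ht => by
      simp only [(H (-k ^ 2)).cos_zero, (H (-k ^ 2)).cos_deriv_zero, zero_mul, add_zero, one_mul]
      exact hch (mul_nonneg hk.le ht.1)) hll
  simp only [(H (-k ^ 2)).sin_zero, (H (-k ^ 2)).sin_deriv_zero, (H (-k ^ 2)).cos_zero,
    (H (-k ^ 2)).cos_deriv_zero, zero_mul, zero_add, add_zero, one_mul, Pi.neg_apply,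
    abs_neg] at hS hC
  refine ⟨hS.1.trans (le_of_eq ?_), hS.2.trans (le_of_eq ?_), hC.1.trans (le_of_eq ?_)⟩ <;>
    field_simp

/-- The leading term (1+β²)·2cosh(kl) is at least (1+β²)e^{kl}, while the errors and the α-term take
away only fixed fractions of it. -/
lemma hyp_asymptotics (hl : 0 < l) (hV : IntegrableOn V (Icc 0 l))
    (H : ∀ x, IsFundamental l (fun t => V t - x) (C x) (C' x) (S x) (S' x)) (α β : ℝ) :
    ∃ k₀ > 0, ∀ k ≥ k₀, 0 < S (-k ^ 2) l ∧
      k * l / 2 ≤ (1 + β ^ 2) * (S' (-k ^ 2) l + C (-k ^ 2) l) + α * S (-k ^ 2) l := by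
  set P := ∫ t in (0 : ℝ)..l, |V t| with hP
  have hP0 : 0 ≤ P := intervalIntegral.integral_nonneg hl.le fun _ _ => abs_nonneg _
  -- The summands give in turn 2P/k ≤ 1/8, |α|/k ≤ 1/4 and kl ≥ 1. With E = e^{kl} the sum s' + c is
  -- then at least 3E/4 and the α-term at least -E/4, leaving E/2 ≥ kl/2.
  refine ⟨16 * P + 4 * |α| + 1 / l + 1, by positivity, fun k hk => ?_⟩
  have hα := abs_nonneg α
  have hl1 : 0 < 1 / l := by positivity
  have hk0 : 0 < k := by linarith
  obtain ⟨h1, h2, h3⟩ := hyp_estimates hl.le hV H hk0 (by linarith)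
  rw [← hP] at h1 h2 h3
  set E := Real.exp (k * l) with hE
  have hkl : 1 ≤ k * l := by
    have : 1 / l ≤ k := by linarith
    rwa [div_le_iff₀ hl] at this
  have hE1 : k * l + 1 ≤ E := Real.add_one_le_exp _
  have hEinv : Real.exp (-(k * l)) ≤ E / 4 := by
    rw [Real.exp_neg, ← hE, inv_le_iff_one_le_mul₀ (by linarith)]
    nlinarith
  have hsinh : Real.sinh (k * l) = (E - Real.exp (-(k * l))) / 2 := Real.sinh_eq _
  have hcosh : Real.cosh (k * l) = (E + Real.exp (-(k * l))) / 2 := Real.cosh_eq _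
  have hexp := Real.exp_pos (-(k * l))
  have hE0 : 0 < E := by linarith
  have hPk : 2 * P / k ≤ 1 / 8 := by
    rw [div_le_iff₀ hk0]; linarith
  have hαk : |α| / k ≤ 1 / 4 := by
    rw [div_le_iff₀ hk0]; linarith
  have h1' : |k * S (-k ^ 2) l - Real.sinh (k * l)| ≤ 1 / 8 * E := by
    have e : k * S (-k ^ 2) l - Real.sinh (k * l) =
        k * (S (-k ^ 2) l - Real.sinh (k * l) / k) := by field_simp
    rw [e, abs_mul, abs_of_pos hk0]
    calc k * |S (-k ^ 2) l - Real.sinh (k * l) / k| ≤ k * (2 * P / k ^ 2 * E) := by gcongr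
      _ = 2 * P / k * E := by field_simp
      _ ≤ _ := by gcongr
  have h2' : |S' (-k ^ 2) l - Real.cosh (k * l)| ≤ 1 / 8 * E := h2.trans (by gcongr)
  have h3' : |C (-k ^ 2) l - Real.cosh (k * l)| ≤ 1 / 8 * E := h3.trans (by gcongr)
  rw [abs_le] at h1' h2' h3'
  have hkS : 0 < k * S (-k ^ 2) l := by linarith
  have hS0 : 0 < S (-k ^ 2) l := pos_of_mul_pos_right hkS hk0.le
  refine ⟨hS0, ?_⟩
  have h4 : -(1 / 4 * E) ≤ α * S (-k ^ 2) l := by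
    have h5 : |α * S (-k ^ 2) l| ≤ 1 / 4 * E := by
      rw [abs_mul, abs_of_pos hS0]
      calc |α| * S (-k ^ 2) l = |α| / k * (k * S (-k ^ 2) l) := by field_simp
        _ ≤ 1 / 4 * E := by gcongr; linarith
    exact (abs_le.1 h5).1
  have h6 : 3 / 4 * E ≤ S' (-k ^ 2) l + C (-k ^ 2) l := by linarith
  have h7 : 3 / 4 * E ≤ (1 + β ^ 2) * (S' (-k ^ 2) l + C (-k ^ 2) l) := by
    nlinarith [sq_nonneg β]
  linarith

end Asymptotics

/-! ### Level sets between consecutive zeros -/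

section Zeros

variable {f η d : ℝ → ℝ} {B σ : ℝ}

/-- In the application f = s(l;·), d = s'(l;·), B = 2(1+β²). Between the zeros `f` keeps its sign;
it has the sign of d(μ) just after μ and the opposite of that of d(ν) just before ν. Hence d(μ)d(ν)
< 0 and η lies beyond B at one end, beyond -B at the other. -/
lemma exists_level_between_zeros (hf : Continuous f) (hη : Continuous η)
    (hpos : ∀ x, f x = 0 → 0 < d x → B ≤ η x) (hneg : ∀ x, f x = 0 → d x < 0 → η x ≤ -B)
    (hsign : ∀ x, f x = 0 → ∃ δ > 0, ∀ y, y ≠ x → |y - x| < δ → 0 < (y - x) * (d x * f y))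
    (hσ : |σ| < B) {μ ν : ℝ} (hμν : μ < ν) (hμ : f μ = 0) (hν : f ν = 0)
    (hno : ∀ y ∈ Ioo μ ν, f y ≠ 0) : ∃ a ∈ Ioo μ ν, η a = σ := by
  obtain ⟨hσ1, hσ2⟩ := abs_lt.1 hσ
  obtain ⟨δ₁, hδ₁, h₁⟩ := hsign μ hμ
  obtain ⟨δ₂, hδ₂, h₂⟩ := hsign ν hν
  set y₁ := μ + min (δ₁ / 2) ((ν - μ) / 2) with hy₁
  set y₂ := ν - min (δ₂ / 2) ((ν - μ) / 2) with hy₂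
  have hm₁ : 0 < min (δ₁ / 2) ((ν - μ) / 2) := lt_min (by linarith) (by linarith)
  have hm₂ : 0 < min (δ₂ / 2) ((ν - μ) / 2) := lt_min (by linarith) (by linarith)
  have hm₁' := min_le_right (δ₁ / 2) ((ν - μ) / 2)
  have hm₂' := min_le_right (δ₂ / 2) ((ν - μ) / 2)
  have g₁ := h₁ y₁ (by linarith) (by
    rw [abs_of_pos (by linarith)]
    have := min_le_left (δ₁ / 2) ((ν - μ) / 2)
    linarith)
  have g₂ := h₂ y₂ (by linarith) (by
    rw [abs_of_neg (by linarith)]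
    have := min_le_left (δ₂ / 2) ((ν - μ) / 2)
    linarith)
  have g₁' : 0 < d μ * f y₁ := pos_of_mul_pos_right g₁ (by linarith)
  have g₂' : d ν * f y₂ < 0 := by
    by_contra! hc
    have : (y₂ - ν) * (d ν * f y₂) ≤ 0 := mul_nonpos_of_nonpos_of_nonneg (by linarith) hc
    linarith
  have hsame : 0 < f y₁ * f y₂ := by
    by_contra! hc
    have h0 : (0 : ℝ) ∈ uIcc (f y₁) (f y₂) := by
      rw [mem_uIcc]
      rcases mul_nonpos_iff.1 hc with h | h
      · exact Or.inr ⟨h.2, h.1⟩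
      · exact Or.inl h
    obtain ⟨y, hy, hy0⟩ := intermediate_value_uIcc (hf.continuousOn (s := uIcc y₁ y₂)) h0
    refine hno y ⟨?_, ?_⟩ hy0
    · exact (lt_min (by linarith) (by linarith)).trans_le hy.1
    · exact hy.2.trans_lt (max_lt (by linarith) (by linarith))
  have hopp : d μ * d ν < 0 := by
    by_contra! hc
    have h3 : (d μ * f y₁) * (d ν * f y₂) < 0 := mul_neg_of_pos_of_neg g₁' g₂'
    have h4 : 0 ≤ (d μ * d ν) * (f y₁ * f y₂) := mul_nonneg hc hsame.le
    nlinarith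
  rcases mul_neg_iff.1 hopp with ⟨hd₁, hd₂⟩ | ⟨hd₁, hd₂⟩
  · have e₁ := hpos μ hμ hd₁
    have e₂ := hneg ν hν hd₂
    exact intermediate_value_Ioo' hμν.le hη.continuousOn ⟨by linarith, by linarith⟩
  · have e₁ := hneg μ hμ hd₁
    have e₂ := hpos ν hν hd₂
    exact intermediate_value_Ioo hμν.le hη.continuousOn ⟨by linarith, by linarith⟩

/-- If there are zeros below μ, `hsign` separates them from μ and compactness yields the nearest
one. If there are none, f > 0 on the left of μ forces d(μ) < 0, so η(μ) ≤ -B, while η is unbounded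
above towards -∞. -/
lemma exists_level_below (hf : Continuous f) (hη : Continuous η)
    (hpos : ∀ x, f x = 0 → 0 < d x → B ≤ η x) (hneg : ∀ x, f x = 0 → d x < 0 → η x ≤ -B)
    (hsign : ∀ x, f x = 0 → ∃ δ > 0, ∀ y, y ≠ x → |y - x| < δ → 0 < (y - x) * (d x * f y))
    (hfbot : ∃ X, ∀ x ≤ X, 0 < f x) (hηbot : ∀ X N : ℝ, ∃ x < X, N < η x)
    (hσ : |σ| < B) {μ : ℝ} (hμ : f μ = 0) : ∃ a < μ, η a = σ ∧ ∀ y ∈ Ico a μ, f y ≠ 0 := by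
  obtain ⟨δ, hδ, h⟩ := hsign μ hμ
  by_cases hz : ∃ z < μ, f z = 0
  · obtain ⟨z, hzμ, hz0⟩ := hz
    -- Isolation of μ: it allows the nearest zero to be sought in a compact interval that excludes μ
    -- itself.
    have hnear : ∀ y, y < μ → f y = 0 → y ≤ μ - δ := fun y hy hy0 => by
      by_contra! hc
      have := h y hy.ne (by rw [abs_of_neg (by linarith)]; linarith)
      simp [hy0] at this
    have hcomp : IsCompact (Icc z (μ - δ) ∩ f ⁻¹' {0}) :=
      isCompact_Icc.inter_right (isClosed_singleton.preimage hf)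
    obtain ⟨ν, ⟨⟨hν1, hν2⟩, hν0⟩, hmax⟩ := hcomp.exists_isGreatest
      ⟨z, ⟨le_rfl, hnear z hzμ hz0⟩, hz0⟩
    have hno : ∀ y ∈ Ioo ν μ, f y ≠ 0 := fun y hy hy0 => by
      have := hmax ⟨⟨hν1.trans hy.1.le, hnear y hy.2 hy0⟩, hy0⟩
      exact absurd hy.1 (not_lt.2 this)
    obtain ⟨a, ha, haσ⟩ := exists_level_between_zeros hf hη hpos hneg hsign hσ
      (show ν < μ by linarith) hν0 hμ hno
    exact ⟨a, ha.2, haσ, fun y hy => hno y ⟨ha.1.trans_le hy.1, hy.2⟩⟩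
  · push Not at hz
    obtain ⟨X, hX⟩ := hfbot
    have hfpos : ∀ y < μ, 0 < f y := fun y hy => by
      by_contra! hc
      have h0 : (0 : ℝ) ∈ uIcc (f (min X y)) (f y) :=
        mem_uIcc.2 (Or.inr ⟨hc, (hX _ (min_le_left _ _)).le⟩)
      obtain ⟨t, ht, ht0⟩ := intermediate_value_uIcc (hf.continuousOn (s := uIcc (min X y) y)) h0
      rw [uIcc_of_le (min_le_right _ _)] at ht
      exact hz t (ht.2.trans_lt hy) ht0
    have h1 := h (μ - δ / 2) (by linarith) (by rw [abs_of_neg (by linarith)]; linarith)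
    have h2 := hfpos (μ - δ / 2) (by linarith)
    have hd : d μ < 0 := by
      by_contra! hc
      have : (μ - δ / 2 - μ) * (d μ * f (μ - δ / 2)) ≤ 0 :=
        mul_nonpos_of_nonpos_of_nonneg (by linarith) (mul_nonneg hc h2.le)
      linarith
    have h3 := hneg μ hμ hd
    obtain ⟨x, hx, hxσ⟩ := hηbot μ σ
    obtain ⟨a, ha, haσ⟩ := intermediate_value_Ioo' hx.le hη.continuousOn
      (show σ ∈ Ioo (η μ) (η x) from ⟨by linarith [(abs_lt.1 hσ).1], hxσ⟩)
    exact ⟨a, ha.2, haσ, fun y hy => hz y hy.2⟩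

/-- No extremal case arises on this side, since zeros are unbounded above. -/
lemma exists_level_above (hf : Continuous f) (hη : Continuous η)
    (hpos : ∀ x, f x = 0 → 0 < d x → B ≤ η x) (hneg : ∀ x, f x = 0 → d x < 0 → η x ≤ -B)
    (hsign : ∀ x, f x = 0 → ∃ δ > 0, ∀ y, y ≠ x → |y - x| < δ → 0 < (y - x) * (d x * f y))
    (hftop : ∀ X : ℝ, ∃ x > X, f x = 0)
    (hσ : |σ| < B) {μ : ℝ} (hμ : f μ = 0) : ∃ b > μ, η b = σ ∧ ∀ y ∈ Ioc μ b, f y ≠ 0 := by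
  obtain ⟨δ, hδ, h⟩ := hsign μ hμ
  obtain ⟨z, hzμ, hz0⟩ := hftop μ
  have hnear : ∀ y, μ < y → f y = 0 → μ + δ ≤ y := fun y hy hy0 => by
    by_contra! hc
    have := h y hy.ne' (by rw [abs_of_pos (by linarith)]; linarith)
    simp [hy0] at this
  have hcomp : IsCompact (Icc (μ + δ) z ∩ f ⁻¹' {0}) :=
    isCompact_Icc.inter_right (isClosed_singleton.preimage hf)
  obtain ⟨ν, ⟨⟨hν1, hν2⟩, hν0⟩, hmin⟩ := hcomp.exists_isLeast
    ⟨z, ⟨hnear z hzμ hz0, le_rfl⟩, hz0⟩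
  have hno : ∀ y ∈ Ioo μ ν, f y ≠ 0 := fun y hy hy0 => by
    have := hmin ⟨⟨hnear y hy.1 hy0, hy.2.le.trans hν2⟩, hy0⟩
    exact absurd hy.2 (not_lt.2 this)
  obtain ⟨b, hb, hbσ⟩ := exists_level_between_zeros hf hη hpos hneg hsign hσ
    (show μ < ν by linarith) hμ hν0 hno
  exact ⟨b, hb.1, hbσ, fun y hy => hno y ⟨hy.1, hy.2.trans_lt hb.2⟩⟩

/-- A closed set with points below and above `μ ∉ T` has a gap around `μ`. -/
lemma exists_isGap_of_isClosed {T : Set ℝ} (hT : IsClosed T) {a₀ b₀ μ : ℝ} (ha : a₀ < μ)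
    (hb : μ < b₀) (haT : a₀ ∈ T) (hbT : b₀ ∈ T) (hμ : μ ∉ T) :
    ∃ a b, IsGap T a b ∧ μ ∈ Ioo a b ∧ a₀ ≤ a ∧ b ≤ b₀ := by
  obtain ⟨a, ⟨⟨ha1, ha2⟩, haT'⟩, hmax⟩ := (isCompact_Icc.inter_right hT).exists_isGreatest
    (⟨a₀, ⟨le_rfl, ha.le⟩, haT⟩ : (Icc a₀ μ ∩ T).Nonempty)
  obtain ⟨b, ⟨⟨hb1, hb2⟩, hbT'⟩, hmin⟩ := (isCompact_Icc.inter_right hT).exists_isLeast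
    (⟨b₀, ⟨hb.le, le_rfl⟩, hbT⟩ : (Icc μ b₀ ∩ T).Nonempty)
  have haμ : a < μ := lt_of_le_of_ne ha2 fun h => hμ (h ▸ haT')
  have hbμ : μ < b := lt_of_le_of_ne hb1 fun h => hμ (h ▸ hbT')
  refine ⟨a, b, ⟨haμ.trans hbμ, haT', hbT', ?_⟩, ⟨haμ, hbμ⟩, ha1, hb2⟩
  rw [Set.disjoint_left]
  intro y hy hyT
  rcases le_total y μ with h | h
  · exact absurd hy.1 (not_lt.2 (hmax ⟨⟨ha1.trans hy.1.le, h⟩, hyT⟩))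
  · exact absurd hy.2 (not_lt.2 (hmin ⟨⟨h, hy.2.le.trans hb2⟩, hyT⟩))

end Zeros

/-! ### The norm and the spectrum of the discrete magnetic Laplacian -/

section Discrete

lemma phase_add (x y : ℝ) : phase (x + y) = phase x * phase y := by
  simp only [phase, ← Complex.exp_add]
  push_cast
  ring_nf

lemma phase_zero : phase 0 = 1 := by simp [phase]

lemma phase_mul_phase_neg (x : ℝ) : phase x * phase (-x) = 1 := by
  rw [← phase_add, add_neg_cancel, phase_zero]

lemma phase_ne_zero (x : ℝ) : phase x ≠ 0 := Complex.exp_ne_zero _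

/-- The factor is e^{2πiθ}, the holonomy of one plaquette. Both the norm bound and the Dirichlet
spectral points use non-integrality of θ through this fact. -/
lemma phase_two_mul_ne_one {θ : ℝ} (hθ : ∀ k : ℤ, θ ≠ k) : phase (2 * θ) ≠ 1 := by
  intro h
  rw [phase, Complex.exp_eq_one_iff] at h
  obtain ⟨n, hn⟩ := h
  refine hθ n ?_
  have h2 : (2 * Real.pi * Complex.I : ℂ) ≠ 0 := Complex.two_pi_I_ne_zero
  have h3 : (2 * Real.pi * Complex.I : ℂ) * (θ : ℂ) = (2 * Real.pi * Complex.I : ℂ) * (n : ℂ) := by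
    push_cast at hn
    linear_combination hn
  exact_mod_cast mul_left_cancel₀ h2 h3

lemma magneticShift_apply (σ : ℤ × ℤ ≃ ℤ × ℤ) (x : ℤ × ℤ → ℝ) (g : NodeL2) (i : ℤ × ℤ) :
    magneticShift σ x g i = phase (x i) * g (σ i) := rfl

lemma norm_magneticShift (σ : ℤ × ℤ ≃ ℤ × ℤ) (x : ℤ × ℤ → ℝ) (g : NodeL2) :
    ‖magneticShift σ x g‖ = ‖g‖ := by
  rw [lp.norm_eq_tsum_rpow (by norm_num), lp.norm_eq_tsum_rpow (by norm_num)]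
  congr 1
  rw [← σ.tsum_eq fun i => ‖g i‖ ^ (2 : ENNReal).toReal]
  simp [magneticShift_apply, phase_norm]

/-- Translation by `e₁` in the magnetic field. -/
def shiftRight (θ : ℝ) : NodeL2 →L[ℂ] NodeL2 :=
  magneticShift (translate 1 0) (fun i => i.2 * θ)

/-- The inverse of `shiftRight`. -/
def shiftLeft (θ : ℝ) : NodeL2 →L[ℂ] NodeL2 :=
  magneticShift (translate (-1) 0) (fun i => -(i.2 * θ))

/-- Translation by `e₂` in the magnetic field. -/
def shiftUp (θ : ℝ) : NodeL2 →L[ℂ] NodeL2 :=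
  magneticShift (translate 0 1) (fun i => -(i.1 * θ))

/-- The inverse of `shiftUp`. -/
def shiftDown (θ : ℝ) : NodeL2 →L[ℂ] NodeL2 :=
  magneticShift (translate 0 (-1)) (fun i => i.1 * θ)

variable (θ : ℝ) (g h : NodeL2) (m n : ℤ)

lemma shiftRight_apply : shiftRight θ g (m, n) = phase (n * θ) * g (m + 1, n) := by
  change phase (n * θ) * g (m + 1, n + 0) = _
  rw [add_zero]

lemma shiftLeft_apply : shiftLeft θ g (m, n) = phase (-(n * θ)) * g (m - 1, n) := by
  change phase (-(n * θ)) * g (m + -1, n + 0) = _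
  rw [add_zero, sub_eq_add_neg]

lemma shiftUp_apply : shiftUp θ g (m, n) = phase (-(m * θ)) * g (m, n + 1) := by
  change phase (-(m * θ)) * g (m + 0, n + 1) = _
  rw [add_zero]

lemma shiftDown_apply : shiftDown θ g (m, n) = phase (m * θ) * g (m, n - 1) := by
  change phase (m * θ) * g (m + 0, n + -1) = _
  rw [add_zero, sub_eq_add_neg]

lemma norm_shiftRight : ‖shiftRight θ g‖ = ‖g‖ := norm_magneticShift _ _ _
lemma norm_shiftLeft : ‖shiftLeft θ g‖ = ‖g‖ := norm_magneticShift _ _ _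
lemma norm_shiftUp : ‖shiftUp θ g‖ = ‖g‖ := norm_magneticShift _ _ _
lemma norm_shiftDown : ‖shiftDown θ g‖ = ‖g‖ := norm_magneticShift _ _ _

lemma shiftRight_shiftLeft : shiftRight θ (shiftLeft θ g) = g := by
  ext ⟨m, n⟩
  rw [shiftRight_apply, shiftLeft_apply, ← mul_assoc, phase_mul_phase_neg, one_mul,
    add_sub_cancel_right]

lemma shiftUp_shiftDown : shiftUp θ (shiftDown θ g) = g := by
  ext ⟨m, n⟩
  rw [shiftUp_apply, shiftDown_apply, ← mul_assoc, mul_comm (phase _), phase_mul_phase_neg,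
    one_mul, add_sub_cancel_right]

/-- The Weyl commutation relation: magnetic translations commute up to the flux through a plaquette.
-/
lemma shiftUp_shiftRight : shiftUp θ (shiftRight θ g) =
    phase (2 * θ) • shiftRight θ (shiftUp θ g) := by
  ext ⟨m, n⟩
  rw [lp.coeFn_smul, Pi.smul_apply, smul_eq_mul, shiftUp_apply, shiftRight_apply,
    shiftRight_apply, shiftUp_apply]
  have h : phase (-(m * θ)) * phase ((n + 1 : ℤ) * θ) =
      phase (2 * θ) * (phase (n * θ) * phase (-((m + 1 : ℤ) * θ))) := by
    simp only [← phase_add]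
    congr 1
    push_cast
    ring
  linear_combination (g (m + 1, n + 1)) * h

lemma discreteLaplacian_eq (β : ℝ) : discreteLaplacian θ β =
    shiftRight θ + shiftLeft θ + ((β : ℂ) ^ 2) • (shiftUp θ + shiftDown θ) := rfl

/-- ⟨Tx, y⟩ = ⟨Tx, TT'y⟩ = ⟨x, T'y⟩, as an isometry preserves inner products. So `shiftLeft` and
`shiftDown` act as adjoints. -/
lemma inner_eq_of_isometry_of_rightInverse {E : Type*} [NormedAddCommGroup E]
    [InnerProductSpace ℂ E] (T T' : E →L[ℂ] E) (hT : ∀ x, ‖T x‖ = ‖x‖) (hTT' : ∀ x, T (T' x) = x)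
    (x y : E) : inner ℂ (T x) y = inner ℂ x (T' y) := by
  have h := (LinearIsometry.mk T.toLinearMap hT).inner_map_map x (T' y)
  change inner ℂ (T x) (T (T' y)) = _ at h
  rwa [hTT'] at h

lemma inner_shiftRight : inner ℂ (shiftRight θ g) h = inner ℂ g (shiftLeft θ h) :=
  inner_eq_of_isometry_of_rightInverse _ _ (norm_shiftRight θ) (shiftRight_shiftLeft θ) g h

lemma inner_shiftUp : inner ℂ (shiftUp θ g) h = inner ℂ g (shiftDown θ h) :=
  inner_eq_of_isometry_of_rightInverse _ _ (norm_shiftUp θ) (shiftUp_shiftDown θ) g h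

lemma isSelfAdjoint_discreteLaplacian (β : ℝ) : IsSelfAdjoint (discreteLaplacian θ β) := by
  rw [ContinuousLinearMap.isSelfAdjoint_iff_isSymmetric]
  intro g h
  have h1 : inner ℂ (shiftLeft θ g) h = inner ℂ g (shiftRight θ h) := by
    rw [← inner_conj_symm, ← inner_shiftRight, inner_conj_symm]
  have h2 : inner ℂ (shiftDown θ g) h = inner ℂ g (shiftUp θ h) := by
    rw [← inner_conj_symm, ← inner_shiftUp, inner_conj_symm]
  simp only [discreteLaplacian_eq, ContinuousLinearMap.coe_coe, add_apply,
    smul_apply, inner_add_left, inner_add_right, inner_smul_left,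
    inner_smul_right, inner_shiftRight, inner_shiftUp, h1, h2, map_pow, Complex.conj_ofReal]
  ring

/-- Provides the real level that η has to attain near each Dirichlet eigenvalue. -/
lemma exists_real_mem_spectrum_discreteLaplacian (β : ℝ) :
    ∃ σ : ℝ, (σ : ℂ) ∈ spectrum ℂ (discreteLaplacian θ β) := by
  have : Nontrivial NodeL2 :=
    ⟨lp.single 2 (0, 0) 1, 0, fun h => by
      have := congrArg (fun g : NodeL2 => g (0, 0)) h
      simp at this⟩
  obtain ⟨z, hz⟩ := spectrum.nonempty (discreteLaplacian θ β)
  exact ⟨z.re, by rwa [← (isSelfAdjoint_discreteLaplacian θ β).mem_spectrum_eq_re hz]⟩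

/-- The magnetic flux separates `shiftRight, shiftLeft` from `shiftDown, shiftUp`. -/
lemma flux_le : ‖1 - phase (2 * θ)‖ * ‖g‖ ≤
    ‖shiftRight θ g - shiftDown θ g‖ + ‖shiftUp θ g - shiftLeft θ g‖ := by
  -- Applying the isometry U turns Rg - Dg into URg - g; applying R turns Ug - Lg into RUg - g. The
  -- two results differ by the commutator of R and U.
  have h1 : ‖shiftRight θ g - shiftDown θ g‖ = ‖shiftUp θ (shiftRight θ g) - g‖ := by
    rw [← norm_shiftUp θ (shiftRight θ g - shiftDown θ g), map_sub, shiftUp_shiftDown]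
  have h2 : ‖shiftUp θ g - shiftLeft θ g‖ = ‖shiftRight θ (shiftUp θ g) - g‖ := by
    rw [← norm_shiftRight θ (shiftUp θ g - shiftLeft θ g), map_sub, shiftRight_shiftLeft]
  have h3 : ‖shiftRight θ (shiftUp θ g) - shiftUp θ (shiftRight θ g)‖ =
      ‖1 - phase (2 * θ)‖ * ‖g‖ := by
    rw [shiftUp_shiftRight]
    rw [← one_smul ℂ (shiftRight θ (shiftUp θ g)), smul_smul, mul_one, ← sub_smul, norm_smul,
      norm_shiftRight, norm_shiftUp]
  rw [h1, h2, ← h3, ← norm_neg (shiftUp θ (shiftRight θ g) - g), add_comm]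
  refine le_trans (le_of_eq ?_) (norm_add_le _ _)
  congr 1
  abel

/-- The parallelogram law: ‖x+y‖² = 4N² - ‖x-y‖². -/
lemma norm_add_le_of_norm_sub_ge {x y : NodeL2} {N δ : ℝ} (hx : ‖x‖ = N) (hy : ‖y‖ = N)
    (hδ : 0 ≤ δ) (h : δ * N ≤ ‖x - y‖) : ‖x + y‖ ≤ Real.sqrt (4 - δ ^ 2) * N := by
  have hN : 0 ≤ N := hx ▸ norm_nonneg x
  have hp := parallelogram_law_with_norm ℂ x y
  rw [hx, hy] at hp
  rcases hN.eq_or_lt with h0 | h0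
  · rw [← h0] at hp ⊢
    nlinarith [norm_nonneg (x + y), norm_nonneg (x - y), mul_self_nonneg ‖x - y‖]
  have h1 : ‖x + y‖ ^ 2 ≤ (4 - δ ^ 2) * N ^ 2 := by
    have := mul_self_le_mul_self (by positivity) h
    nlinarith
  -- For N > 0 the estimate itself forces δ ≤ 2, so the square root is not cut off at zero.
  have h2 : 0 ≤ 4 - δ ^ 2 := by
    by_contra! hc
    nlinarith [sq_nonneg ‖x + y‖, mul_pos h0 h0]
  refine abs_le_of_sq_le_sq' ?_ (by positivity) |>.2
  rw [mul_pow, Real.sq_sqrt h2]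
  exact h1

/-- By `flux_le` one of the pairs (R, D), (U, L) is at distance at least δ‖g‖ on a given g, so its
sum is at most ρ‖g‖ with ρ < 2. A multiple of R + L + U + D is split off from M and regrouped into
these pairs, and the rest is bounded trivially. -/
theorem norm_discreteLaplacian_lt {θ β : ℝ} (hβ : β ≠ 0) (hθ : ∀ k : ℤ, θ ≠ k) :
    ‖discreteLaplacian θ β‖ < 2 * (1 + β ^ 2) := by
  -- Two differences together exceed the flux term, so one of them exceeds half of it.
  set δ := ‖1 - phase (2 * θ)‖ / 2 with hδ
  have hδ0 : 0 < δ := by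
    have : 0 < ‖1 - phase (2 * θ)‖ :=
      norm_pos_iff.2 (sub_ne_zero.2 (phase_two_mul_ne_one hθ).symm)
    positivity
  -- The largest multiple of R + L + U + D whose removal leaves the nonnegative coefficients 1 - κ
  -- and β² - κ.
  set κ := min 1 (β ^ 2) with hκ
  have hκ0 : 0 < κ := lt_min one_pos (by positivity)
  have hκ1 : κ ≤ 1 := min_le_left _ _
  have hκ2 : κ ≤ β ^ 2 := min_le_right _ _
  set ρ := Real.sqrt (4 - δ ^ 2) with hρ
  have hρ0 : 0 ≤ ρ := Real.sqrt_nonneg _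
  have hρ2 : ρ < 2 := by
    rw [hρ, Real.sqrt_lt' two_pos]
    nlinarith
  have hbound : ‖discreteLaplacian θ β‖ ≤ 2 * (1 + β ^ 2) - κ * (2 - ρ) := by
    refine ContinuousLinearMap.opNorm_le_bound _ (by nlinarith) fun g => ?_
    set N := ‖g‖ with hN
    have hN0 : 0 ≤ N := norm_nonneg _
    have hR : ‖shiftRight θ g‖ = N := norm_shiftRight θ g
    have hL : ‖shiftLeft θ g‖ = N := norm_shiftLeft θ g
    have hU : ‖shiftUp θ g‖ = N := norm_shiftUp θ g
    have hD : ‖shiftDown θ g‖ = N := norm_shiftDown θ g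
    have hpair : ‖shiftRight θ g + shiftDown θ g‖ + ‖shiftUp θ g + shiftLeft θ g‖
        ≤ (2 + ρ) * N := by
      have h1 := flux_le θ g
      have e : ‖1 - phase (2 * θ)‖ = 2 * δ := by rw [hδ]; ring
      rw [e, ← hN] at h1
      have hRD := norm_add_le (shiftRight θ g) (shiftDown θ g)
      have hUL := norm_add_le (shiftUp θ g) (shiftLeft θ g)
      rw [hR, hD] at hRD
      rw [hU, hL] at hUL
      rcases le_or_gt (δ * N) ‖shiftRight θ g - shiftDown θ g‖ with h2 | h2
      · have h3 := norm_add_le_of_norm_sub_ge hR hD hδ0.le h2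
        linarith
      · have h3 := norm_add_le_of_norm_sub_ge hU hL hδ0.le (by linarith)
        linarith
    have e : discreteLaplacian θ β g =
        ((κ : ℝ) : ℂ) • ((shiftRight θ g + shiftDown θ g) + (shiftUp θ g + shiftLeft θ g))
        + (((1 - κ : ℝ) : ℂ) • (shiftRight θ g + shiftLeft θ g)
          + ((β ^ 2 - κ : ℝ) : ℂ) • (shiftUp θ g + shiftDown θ g)) := by
      simp only [discreteLaplacian_eq, add_apply,
        smul_apply]
      push_cast
      module
    have n1 : ‖((κ : ℝ) : ℂ) • ((shiftRight θ g + shiftDown θ g)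
        + (shiftUp θ g + shiftLeft θ g))‖ ≤ κ * ((2 + ρ) * N) := by
      rw [norm_smul, Complex.norm_real, Real.norm_of_nonneg hκ0.le]
      gcongr
      exact (norm_add_le _ _).trans hpair
    have n2 : ‖((1 - κ : ℝ) : ℂ) • (shiftRight θ g + shiftLeft θ g)‖ ≤ (1 - κ) * (N + N) := by
      rw [norm_smul, Complex.norm_real, Real.norm_of_nonneg (by linarith)]
      have := norm_add_le (shiftRight θ g) (shiftLeft θ g)
      rw [hR, hL] at this
      exact mul_le_mul_of_nonneg_left this (by linarith)
    have n3 : ‖((β ^ 2 - κ : ℝ) : ℂ) • (shiftUp θ g + shiftDown θ g)‖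
        ≤ (β ^ 2 - κ) * (N + N) := by
      rw [norm_smul, Complex.norm_real, Real.norm_of_nonneg (by linarith)]
      have := norm_add_le (shiftUp θ g) (shiftDown θ g)
      rw [hU, hD] at this
      exact mul_le_mul_of_nonneg_left this (by linarith)
    rw [e]
    have n4 := add_le_add n1 ((norm_add_le _ _).trans (add_le_add n2 n3))
    refine (norm_add_le _ _).trans (n4.trans (le_of_eq ?_))
    ring
  nlinarith

end Discrete

/-! ### The equation on one edge in `L²[0,l]` -/

section EdgeEquation

variable {l : ℝ} {V : ℝ → ℝ}

lemma memLp_of_continuousOn {u : ℝ → ℂ} (hu : ContinuousOn u (Icc 0 l)) (p : ENNReal) :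
    MemLp u p (edgeMeasure l) := by
  obtain ⟨K, hK⟩ := isCompact_Icc.exists_bound_of_continuousOn hu
  refine MemLp.of_bound (hu.aestronglyMeasurable measurableSet_Icc) K ?_
  filter_upwards [ae_restrict_mem measurableSet_Icc] with t ht using hK t ht

lemma edgeL2_integrableOn (k : EdgeL2 l) : IntegrableOn k (Icc 0 l) :=
  (Lp.memLp k).integrable (by norm_num)

lemma Represents.isSol {f g : EdgeL2 l} {u v w : ℝ → ℂ} (hl : 0 ≤ l)
    (h : Represents l V f g u v w) (x : ℝ) :
    IsSol l (fun t => ((V t - x : ℝ) : ℂ)) (g - (x : ℂ) • f : EdgeL2 l) u v := by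
  refine ⟨⟨hl, h.isH2.continuousOn_fst.integrableOn_compact isCompact_Icc, h.isH2.fun_eq⟩,
    IsPrimitive.congr_ae (f' := w) ⟨hl, h.isH2.memLp.integrable (by norm_num), h.isH2.deriv_eq⟩ ?_⟩
  filter_upwards [h.left, h.right, Lp.coeFn_sub g ((x : ℂ) • f), Lp.coeFn_smul (x : ℂ) f]
    with t h1 h2 h3 h4
  rw [h3, Pi.sub_apply, h4, Pi.smul_apply, h1, h2, smul_eq_mul]
  push_cast
  ring

lemma IsSol.represents (hV : MemLp V 2 (edgeMeasure l)) {x : ℝ} {k f : EdgeL2 l}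
    {u v : ℝ → ℂ} (h : IsSol l (fun t => ((V t - x : ℝ) : ℂ)) k u v)
    (hf : f =ᵐ[edgeMeasure l] u) :
    ∃ w, Represents l V f (k + (x : ℂ) • f) u v w := by
  refine ⟨fun t => ((V t - x : ℝ) : ℂ) * u t - k t, ⟨?_, h.snd.eq, h.fst.eq⟩, hf, ?_⟩
  -- Here V ∈ L², not only L¹, is needed: u'' = (V - x)u - k has to be square integrable.
  · have h1 : MemLp (fun t => ((V t - x : ℝ) : ℂ)) 2 (edgeMeasure l) :=
      MemLp.ofReal (hV.sub (memLp_const x))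
    have h2 := memLp_of_continuousOn h.fst.continuousOn ⊤
    exact (h2.mul (r := 2) h1).sub (Lp.memLp k)
  · filter_upwards [hf, Lp.coeFn_add k ((x : ℂ) • f), Lp.coeFn_smul (x : ℂ) f] with t h1 h2 h3
    rw [h2, Pi.add_apply, h3, Pi.smul_apply, h1, smul_eq_mul]
    push_cast
    ring

/-- On `[0,l]` the `L¹`-norm is bounded by the `L²`-norm. -/
lemma exists_integral_norm_le (l : ℝ) :
    ∃ K, 0 ≤ K ∧ ∀ k : EdgeL2 l, ∫ t in Icc 0 l, ‖k t‖ ≤ K * ‖k‖ := by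
  set c := (edgeMeasure l) univ ^ (1 / (1 : ENNReal).toReal - 1 / (2 : ENNReal).toReal) with hc
  have hc_top : c ≠ ⊤ := by
    refine ENNReal.rpow_ne_top_of_nonneg (by norm_num) ?_
    exact measure_ne_top _ _
  refine ⟨c.toReal, ENNReal.toReal_nonneg, fun k => ?_⟩
  have h1 := eLpNorm_le_eLpNorm_mul_rpow_measure_univ (p := 1) (q := 2) (by norm_num)
    (Lp.aestronglyMeasurable k)
  rw [integral_norm_eq_lintegral_enorm (Lp.aestronglyMeasurable k), ← eLpNorm_one_eq_lintegral_enorm,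
    Lp.norm_def, mul_comm, ← ENNReal.toReal_mul]
  exact ENNReal.toReal_mono (ENNReal.mul_ne_top (Lp.eLpNorm_ne_top k) hc_top) h1

lemma intervalIntegrable_mul (k : EdgeL2 l) {ψ : ℝ → ℂ} (hψ : ContinuousOn ψ (Icc 0 l)) {t : ℝ}
    (ht : t ∈ Icc (0 : ℝ) l) : IntervalIntegrable (fun r => k r * ψ r) volume 0 t := by
  rw [intervalIntegrable_iff_integrableOn_Icc_of_le ht.1]
  exact ((edgeL2_integrableOn k).mul_continuousOn hψ isCompact_Icc).mono_set
    (Icc_subset_Icc_right ht.2)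

lemma integral_congr_edge {f g : ℝ → ℂ} (h : f =ᵐ[edgeMeasure l] g) {t : ℝ}
    (ht : t ∈ Icc (0 : ℝ) l) : ∫ r in (0 : ℝ)..t, f r = ∫ r in (0 : ℝ)..t, g r := by
  apply intervalIntegral.integral_congr_ae
  have h' : f =ᵐ[volume.restrict (Icc 0 l)] g := h
  rw [Filter.EventuallyEq, ae_restrict_iff' measurableSet_Icc] at h'
  filter_upwards [h'] with s hs hst
  rw [uIoc_of_le ht.1] at hst
  exact hs ⟨hst.1.le, hst.2.trans ht.2⟩

lemma integral_mul_add (k k' : EdgeL2 l) {ψ : ℝ → ℂ} (hψ : ContinuousOn ψ (Icc 0 l)) {t : ℝ}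
    (ht : t ∈ Icc (0 : ℝ) l) :
    ∫ r in (0 : ℝ)..t, (k + k' : EdgeL2 l) r * ψ r =
      (∫ r in (0 : ℝ)..t, k r * ψ r) + ∫ r in (0 : ℝ)..t, k' r * ψ r := by
  rw [← intervalIntegral.integral_add (intervalIntegrable_mul k hψ ht)
    (intervalIntegrable_mul k' hψ ht)]
  refine integral_congr_edge ?_ ht
  filter_upwards [Lp.coeFn_add k k'] with r hr
  rw [hr, Pi.add_apply, add_mul]

lemma integral_mul_smul (a : ℂ) (k : EdgeL2 l) (ψ : ℝ → ℂ) {t : ℝ} (ht : t ∈ Icc (0 : ℝ) l) :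
    ∫ r in (0 : ℝ)..t, (a • k : EdgeL2 l) r * ψ r = a * ∫ r in (0 : ℝ)..t, k r * ψ r := by
  rw [← intervalIntegral.integral_const_mul]
  refine integral_congr_edge ?_ ht
  filter_upwards [Lp.coeFn_smul a k] with r hr
  rw [hr, Pi.smul_apply, smul_eq_mul, mul_assoc]

lemma exists_norm_integral_mul_le {ψ : ℝ → ℂ} (hψ : ContinuousOn ψ (Icc 0 l)) :
    ∃ K, 0 ≤ K ∧ ∀ k : EdgeL2 l, ∀ t ∈ Icc (0 : ℝ) l,
      ‖∫ r in (0 : ℝ)..t, k r * ψ r‖ ≤ K * ‖k‖ := by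
  obtain ⟨K₁, hK₁, h₁⟩ := exists_integral_norm_le l
  obtain ⟨K₂, hK₂⟩ := isCompact_Icc.exists_bound_of_continuousOn hψ
  refine ⟨|K₂| * K₁, by positivity, fun k t ht => ?_⟩
  calc ‖∫ r in (0 : ℝ)..t, k r * ψ r‖ ≤ ∫ r in (0 : ℝ)..t, ‖k r‖ * |K₂| := by
        refine intervalIntegral.norm_integral_le_of_norm_le ht.1
          (Filter.Eventually.of_forall fun r hr => ?_) ?_
        · rw [norm_mul]
          gcongr
          exact (hK₂ r ⟨hr.1.le, hr.2.trans ht.2⟩).trans (le_abs_self _)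
        · rw [intervalIntegrable_iff_integrableOn_Icc_of_le ht.1]
          exact IntegrableOn.mono_set ((edgeL2_integrableOn k).norm.mul_const _)
            (Icc_subset_Icc_right ht.2)
    _ = (∫ r in Icc 0 t, ‖k r‖) * |K₂| := by
        rw [intervalIntegral.integral_mul_const, intervalIntegral.integral_of_le ht.1,
          integral_Icc_eq_integral_Ioc]
    _ ≤ (∫ r in Icc 0 l, ‖k r‖) * |K₂| := by
        exact mul_le_mul_of_nonneg_right (setIntegral_mono_set (edgeL2_integrableOn k).norm
          (Filter.Eventually.of_forall fun _ => norm_nonneg _)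
          (Icc_subset_Icc_right ht.2).eventuallyLE) (abs_nonneg _)
    _ ≤ (K₁ * ‖k‖) * |K₂| := by
        gcongr
        exact h₁ k
    _ = _ := by ring

lemma exists_integral_clm (hl : 0 ≤ l) {ψ : ℝ → ℂ} (hψ : ContinuousOn ψ (Icc 0 l)) :
    ∃ I : EdgeL2 l →L[ℂ] ℂ, ∀ k, I k = ∫ r in (0 : ℝ)..l, k r * ψ r := by
  obtain ⟨K, -, hK⟩ := exists_norm_integral_mul_le hψ
  have hll : l ∈ Icc (0 : ℝ) l := ⟨hl, le_rfl⟩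
  exact ⟨LinearMap.mkContinuous
    { toFun := fun k => ∫ r in (0 : ℝ)..l, k r * ψ r
      map_add' := fun k k' => integral_mul_add k k' hψ hll
      map_smul' := fun a k => integral_mul_smul a k ψ hll } K fun k => hK k l hll, fun _ => rfl⟩

variable {q c c' s s' : ℝ → ℂ}

lemma IsFundamental.exists_particular_clm (h : IsFundamental l q c c' s s') :
    ∃ P : EdgeL2 l →L[ℂ] EdgeL2 l, ∀ k, P k =ᵐ[edgeMeasure l]
      fun t => (c t * ∫ x in (0 : ℝ)..t, k x * s x) - s t * ∫ x in (0 : ℝ)..t, k x * c x := by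
  have hcc := h.cos.fst.continuousOn
  have hsc := h.sin.fst.continuousOn
  set p : EdgeL2 l → ℝ → ℂ := fun k t =>
    (c t * ∫ x in (0 : ℝ)..t, k x * s x) - s t * ∫ x in (0 : ℝ)..t, k x * c x with hp
  have hpc : ∀ k, ContinuousOn (p k) (Icc 0 l) := fun k =>
    (h.isSol_particular (edgeL2_integrableOn k)).fst.continuousOn
  have hm : ∀ k, MemLp (p k) 2 (edgeMeasure l) := fun k => memLp_of_continuousOn (hpc k) 2
  obtain ⟨K₁, hK₁, h₁⟩ := exists_norm_integral_mul_le hsc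
  obtain ⟨K₂, hK₂, h₂⟩ := exists_norm_integral_mul_le hcc
  obtain ⟨K₃, hK₃⟩ := isCompact_Icc.exists_bound_of_continuousOn hsc
  obtain ⟨K₄, hK₄⟩ := isCompact_Icc.exists_bound_of_continuousOn hcc
  have hbound : ∀ k, ∀ t ∈ Icc (0 : ℝ) l, ‖p k t‖ ≤ (|K₄| * K₁ + |K₃| * K₂) * ‖k‖ := by
    intro k t ht
    calc ‖p k t‖ ≤ ‖c t‖ * ‖∫ x in (0 : ℝ)..t, k x * s x‖
          + ‖s t‖ * ‖∫ x in (0 : ℝ)..t, k x * c x‖ := by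
          refine (norm_sub_le _ _).trans ?_
          rw [norm_mul, norm_mul]
      _ ≤ |K₄| * (K₁ * ‖k‖) + |K₃| * (K₂ * ‖k‖) := by
          gcongr
          · exact (hK₄ t ht).trans (le_abs_self _)
          · exact h₁ k t ht
          · exact (hK₃ t ht).trans (le_abs_self _)
          · exact h₂ k t ht
      _ = _ := by ring
  refine ⟨LinearMap.mkContinuous
    { toFun := fun k => (hm k).toLp
      map_add' := fun k k' => ?_
      map_smul' := fun a k => ?_ }
    ((edgeMeasure l).real univ ^ ((2 : ENNReal).toReal⁻¹) * (|K₄| * K₁ + |K₃| * K₂))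
    fun k => ?_, fun k => (hm k).coeFn_toLp⟩
  · rw [← MemLp.toLp_add, MemLp.toLp_eq_toLp_iff]
    filter_upwards [ae_restrict_mem measurableSet_Icc] with t ht
    simp only [hp, Pi.add_apply, integral_mul_add k k' hsc ht, integral_mul_add k k' hcc ht]
    ring
  · rw [RingHom.id_apply, ← MemLp.toLp_const_smul, MemLp.toLp_eq_toLp_iff]
    filter_upwards [ae_restrict_mem measurableSet_Icc] with t ht
    simp only [hp, Pi.smul_apply, smul_eq_mul, integral_mul_smul a k _ ht]
    ring
  · rw [mul_assoc]
    refine Lp.norm_le_of_ae_bound (by positivity) ?_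
    filter_upwards [(hm k).coeFn_toLp, ae_restrict_mem measurableSet_Icc] with t h1 ht
    change ‖((hm k).toLp : EdgeL2 l) t‖ ≤ _
    rw [h1]
    exact hbound k t ht

/-- Solution operators for `-u'' + V u - x u = k` on one edge: `Ec` and `Es` are the fundamental
solutions as elements of `L²[0,l]`, `P k` is the solution with vanishing initial values. -/
structure EdgeSolver (l : ℝ) (V : ℝ → ℝ) (x : ℝ) (cl sl sl' : ℂ) where
  Ec : EdgeL2 l
  Es : EdgeL2 l
  P : EdgeL2 l →L[ℂ] EdgeL2 l
  Is : EdgeL2 l →L[ℂ] ℂ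
  Ic : EdgeL2 l →L[ℂ] ℂ
  exists_represents : ∀ (k : EdgeL2 l) (a b : ℂ), ∃ u v w : ℝ → ℂ,
    Represents l V (a • Ec + b • Es + P k) (k + (x : ℂ) • (a • Ec + b • Es + P k)) u v w ∧
      u 0 = a ∧ v 0 = b
  eq_of_represents : ∀ {f g : EdgeL2 l} {u v w : ℝ → ℂ}, Represents l V f g u v w →
    f = u 0 • Ec + v 0 • Es + P (g - (x : ℂ) • f)
  fst_end : ∀ {f g : EdgeL2 l} {u v w : ℝ → ℂ}, Represents l V f g u v w →
    u l = u 0 * cl + v 0 * sl + cl * Is (g - (x : ℂ) • f) - sl * Ic (g - (x : ℂ) • f)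
  -- Lagrange's identity against s, kept free of division so that it remains meaningful at Dirichlet
  -- eigenvalues.
  snd_end : ∀ {f g : EdgeL2 l} {u v w : ℝ → ℂ}, Represents l V f g u v w →
    v l * sl = u l * sl' - u 0 - Is (g - (x : ℂ) • f)
  -- Controls the initial value by the L²-norm, uniformly over all edges; this makes the node values
  -- of an element of dom Λ square summable.
  norm_le : ∃ K, ∀ a b : ℂ, ‖a‖ ≤ K * ‖a • Ec + b • Es‖
  Is_ne_zero : Is Es ≠ 0

lemma exists_edgeSolver (hl : 0 < l) (hV : MemLp V 2 (edgeMeasure l)) {x : ℝ}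
    {c c' s s' : ℝ → ℝ} (h : IsFundamental l (fun t => V t - x) c c' s s') :
    Nonempty (EdgeSolver l V x (c l) (s l) (s' l)) := by
  have H := h.ofReal
  have hll : l ∈ Icc (0 : ℝ) l := ⟨hl.le, le_rfl⟩
  have h00 : (0 : ℝ) ∈ Icc (0 : ℝ) l := ⟨le_rfl, hl.le⟩
  have hcc := H.cos.fst.continuousOn
  have hsc := H.sin.fst.continuousOn
  obtain ⟨P, hP⟩ := H.exists_particular_clm
  obtain ⟨Is, hIs⟩ := exists_integral_clm hl.le hsc
  obtain ⟨Ic, hIc⟩ := exists_integral_clm hl.le hcc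
  set Ec := (memLp_of_continuousOn hcc 2).toLp with hEc
  set Es := (memLp_of_continuousOn hsc 2).toLp with hEs
  have hEc' : Ec =ᵐ[edgeMeasure l] fun t => (c t : ℂ) := MemLp.coeFn_toLp _
  have hEs' : Es =ᵐ[edgeMeasure l] fun t => (s t : ℂ) := MemLp.coeFn_toLp _
  have hcomb : ∀ (a b : ℂ) (k : EdgeL2 l), (a • Ec + b • Es + P k : EdgeL2 l) =ᵐ[edgeMeasure l]
      fun t => a * c t + b * s t + ((c t * ∫ x in (0 : ℝ)..t, k x * s x)
        - s t * ∫ x in (0 : ℝ)..t, k x * c x) := by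
    intro a b k
    filter_upwards [Lp.coeFn_add (a • Ec + b • Es) (P k), Lp.coeFn_add (a • Ec) (b • Es),
      Lp.coeFn_smul a Ec, Lp.coeFn_smul b Es, hEc', hEs', hP k] with t h1 h2 h3 h4 h5 h6 h7
    rw [h1, Pi.add_apply, h2, Pi.add_apply, h3, h4, Pi.smul_apply, Pi.smul_apply, h5, h6, h7,
      smul_eq_mul, smul_eq_mul]
  refine ⟨⟨Ec, Es, P, Is, Ic, fun k a b => ?_, fun {f g u v w} hr => ?_, fun {f g u v w} hr => ?_,
    fun {f g u v w} hr => ?_, ?_, ?_⟩⟩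
  · have hsol := ((H.cos.const_mul a).add (H.sin.const_mul b)).add
      (H.isSol_particular (edgeL2_integrableOn k))
    simp only [mul_zero, zero_add] at hsol
    obtain ⟨w, hw⟩ := hsol.represents hV (hcomb a b k)
    refine ⟨_, _, w, hw, ?_, ?_⟩ <;>
      simp [h.cos_zero, h.sin_zero, h.cos_deriv_zero, h.sin_deriv_zero]
  · refine Lp.ext (hr.left.trans (Filter.EventuallyEq.trans ?_ (hcomb _ _ _).symm))
    filter_upwards [ae_restrict_mem measurableSet_Icc] with t ht
    rw [H.eq_fst (hr.isSol hl.le x) ht]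
    ring
  · rw [H.eq_fst (hr.isSol hl.le x) hll, hIs, hIc]
  · have := (hr.isSol hl.le x).lagrange H.sin hll
    simp only [h.sin_zero, h.sin_deriv_zero, Complex.ofReal_zero, Complex.ofReal_one, mul_zero,
      sub_zero, mul_one] at this
    rw [hIs]
    linear_combination -this
  -- An injective linear map on a finite-dimensional space is bounded below.
  · let T : ℂ × ℂ →ₗ[ℂ] EdgeL2 l :=
      (LinearMap.toSpanSingleton ℂ _ Ec).coprod (LinearMap.toSpanSingleton ℂ _ Es)
    have hT : ∀ a b : ℂ, T (a, b) = a • Ec + b • Es := fun a b => by simp [T]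
    have hker : LinearMap.ker T = ⊥ := by
      rw [LinearMap.ker_eq_bot']
      rintro ⟨a, b⟩ hab
      rw [hT] at hab
      have hz : ∀ t ∈ Icc (0 : ℝ) l, a * (c t : ℂ) + b * (s t : ℂ) = 0 := by
        refine eq_zero_of_ae hl ((continuousOn_const.mul hcc).add (continuousOn_const.mul hsc)) ?_
        have h1 := hcomb a b 0
        rw [map_zero, add_zero, hab] at h1
        filter_upwards [h1, Lp.coeFn_zero ℂ 2 (edgeMeasure l),
          ae_restrict_mem measurableSet_Icc] with t h2 h3 ht
        rw [h3] at h2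
        have h4 : ∀ ψ : ℝ → ℂ, ∫ x in (0 : ℝ)..t, (0 : EdgeL2 l) x * ψ x = 0 := fun ψ => by
          have := integral_mul_smul 0 (0 : EdgeL2 l) ψ ht
          simpa using this
        rw [h4, h4] at h2
        simpa using h2.symm
      have ha : a = 0 := by simpa [h.cos_zero, h.sin_zero] using hz 0 h00
      obtain ⟨t, ht, hst⟩ := h.exists_sin_ne_zero hl
      have hb : b = 0 := by
        have := hz t ht
        rw [ha, zero_mul, zero_add, mul_eq_zero] at this
        exact this.resolve_right (by exact_mod_cast hst)
      rw [ha, hb]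
      rfl
    obtain ⟨K, -, hK⟩ := T.exists_antilipschitzWith hker
    refine ⟨K, fun a b => ?_⟩
    rw [← hT]
    exact (norm_fst_le (a, b)).trans (hK.le_mul_norm (map_zero T) _)
  · have h1 : Is Es = ((∫ t in (0 : ℝ)..l, s t * s t : ℝ) : ℂ) := by
      rw [hIs, ← intervalIntegral.integral_ofReal]
      refine integral_congr_edge ?_ hll
      filter_upwards [hEs'] with t ht
      rw [ht]
      push_cast
      rfl
    rw [h1]
    exact_mod_cast (h.integral_sin_sq_pos hl).ne'

end EdgeEquation

/-! ### The resolvent set is open -/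

section Resolvent

variable {E : Type*} [NormedAddCommGroup E] [NormedSpace ℂ E] [CompleteSpace E]

/-- Neumann series: the resolvent at z' is R(1 - (z' - z)R)⁻¹. -/
lemma IsResolventPoint.of_near {T : E →ₗ.[ℂ] E} {z z' : ℂ} {R : E →L[ℂ] E}
    (h1 : ∀ g : E, ∃ h : R g ∈ T.domain, T ⟨R g, h⟩ - z • R g = g)
    (h2 : ∀ x : T.domain, R (T x - z • (x : E)) = x) (hz : ‖(z' - z) • R‖ < 1) :
    IsResolventPoint T z' := by
  obtain ⟨A, hA⟩ := isUnit_one_sub_of_norm_lt_one hz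
  have hA1 : ∀ g, (A⁻¹.1 : E →L[ℂ] E) g - (z' - z) • R ((A⁻¹.1 : E →L[ℂ] E) g) = g := fun g => by
    have h : (A.1 * A⁻¹.1) g = g := by rw [A.mul_inv]; rfl
    rw [hA] at h
    exact h
  have hA2 : ∀ g, (A⁻¹.1 : E →L[ℂ] E) (g - (z' - z) • R g) = g := fun g => by
    have h : (A⁻¹.1 * A.1) g = g := by rw [A.inv_mul]; rfl
    rw [hA] at h
    exact h
  refine ⟨R * A⁻¹.1, fun g => ?_, fun x => ?_⟩
  · obtain ⟨hd, he⟩ := h1 ((A⁻¹.1 : E →L[ℂ] E) g)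
    refine ⟨hd, ?_⟩
    change T ⟨R ((A⁻¹.1 : E →L[ℂ] E) g), hd⟩ - z' • R ((A⁻¹.1 : E →L[ℂ] E) g) = g
    have := hA1 g
    rw [sub_eq_iff_eq_add] at he
    rw [he]
    nth_rw 4 [← this]
    module
  · change R ((A⁻¹.1 : E →L[ℂ] E) (T x - z' • (x : E))) = x
    have h3 : T x - z' • (x : E) =
        (T x - z • (x : E)) - (z' - z) • R (T x - z • (x : E)) := by
      rw [h2 x]
      module
    rw [h3, hA2, h2 x]

lemma isClosed_realSpec (T : E →ₗ.[ℂ] E) : IsClosed (realSpec T) := by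
  rw [← isOpen_compl_iff, Metric.isOpen_iff]
  intro x hx
  obtain ⟨R, h1, h2⟩ : IsResolventPoint T (x : ℂ) := not_not.1 hx
  refine ⟨1 / (‖R‖ + 1), by positivity, fun y hy => not_not.2 (IsResolventPoint.of_near h1 h2 ?_)⟩
  rw [Metric.mem_ball, Real.dist_eq, lt_div_iff₀ (by positivity)] at hy
  rw [norm_smul, ← Complex.ofReal_sub, Complex.norm_real, Real.norm_eq_abs]
  nlinarith [abs_nonneg (y - x)]

end Resolvent

/-! ### Square-summable families -/

section Families

variable {ι κ E F : Type*} [NormedAddCommGroup E] [NormedAddCommGroup F]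

lemma memℓp_of_norm_le {f : ι → E} {g : ι → F} (hf : Memℓp f 2) (K : ℝ)
    (h : ∀ i, ‖g i‖ ≤ K * ‖f i‖) : Memℓp g 2 :=
  (hf.norm.const_mul K).mono h

lemma memℓp_comp_injective {f : ι → E} (hf : Memℓp f 2) {τ : κ → ι}
    (hτ : Function.Injective τ) : Memℓp (fun i => f (τ i)) 2 := by
  rw [memℓp_gen_iff (by norm_num)] at hf ⊢
  exact hf.comp_injective hτ

lemma memℓp_edge {f : Edge → E} (hr : Memℓp (fun i : ℤ × ℤ => f (i.1, i.2, Dir.r)) 2)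
    (hu : Memℓp (fun i : ℤ × ℤ => f (i.1, i.2, Dir.u)) 2) : Memℓp f 2 := by
  have key : ∀ d : Dir, Memℓp (fun i : ℤ × ℤ => f (i.1, i.2, d)) 2 →
      Summable (Set.indicator {e : Edge | e.2.2 = d}
        fun e => ‖f e‖ ^ (2 : ENNReal).toReal) := by
    intro d hd
    rw [memℓp_gen_iff (by norm_num)] at hd
    have hinj : Function.Injective (fun i : ℤ × ℤ => ((i.1, i.2, d) : Edge)) := by
      rintro ⟨a, b⟩ ⟨a', b'⟩ h
      simpa using h
    refine (hinj.summable_iff fun e he => ?_).1 ?_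
    · refine Set.indicator_of_notMem (fun h => he ⟨(e.1, e.2.1), ?_⟩) _
      obtain ⟨a, b, c⟩ := e
      simp only [mem_ofPred_eq] at h
      simp [h]
    · refine hd.congr fun i => ?_
      simp
  rw [memℓp_gen_iff (by norm_num)]
  refine ((key Dir.r hr).add (key Dir.u hu)).congr fun e => ?_
  obtain ⟨a, b, c⟩ := e
  cases c <;> simp [Set.indicator]

/-- A family of continuous linear maps which is pointwise square-summable defines a continuous
linear map into the `ℓ²`-sum. -/
lemma exists_clm_of_memℓp [NormedSpace ℂ E] [CompleteSpace E] [NormedSpace ℂ F] [CompleteSpace F]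
    (T : ι → E →L[ℂ] F) (hT : ∀ x, Memℓp (fun i => T i x) 2) :
    ∃ L : E →L[ℂ] lp (fun _ : ι => F) 2, ∀ x i, L x i = T i x := by
  let L : E →ₗ[ℂ] lp (fun _ : ι => F) 2 :=
    { toFun := fun x => ⟨fun i => T i x, hT x⟩
      map_add' := fun x y => by ext i; exact map_add (T i) x y
      map_smul' := fun a x => by ext i; exact map_smul (T i) a x }
  -- Closed graph theorem: limits in the ℓ²-sum are determined coordinatewise, and each coordinate
  -- is continuous.
  refine ⟨⟨L, L.continuous_of_seq_closed_graph fun u x y hu hy => ?_⟩, fun _ _ => rfl⟩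
  ext i
  have h1 : Filter.Tendsto (fun n => T i (u n)) Filter.atTop (nhds (T i x)) :=
    ((T i).continuous.tendsto x).comp hu
  have h2 : Filter.Tendsto (fun n => T i (u n)) Filter.atTop (nhds (y i)) :=
    ((lp.evalCLM ℂ (fun _ : ι => F) 2 i).continuous.tendsto y).comp hy
  exact tendsto_nhds_unique h2 h1

end Families

/-! ### Boundary values on the lattice -/

section Boundary

variable {l α β θ : ℝ} {V : ℝ → ℝ}

/-- Reindexes the conditions from nodes to edges: the far end of an edge is read from the condition
at its far node, and the phase moves to the other side as its inverse. -/
lemma vertexValue_iff (hβ : β ≠ 0) {u : Edge → ℝ → ℂ} {cc : ℤ × ℤ → ℂ} :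
    (∀ m n : ℤ, VertexValue l θ β u m n (cc (m, n))) ↔
      ∀ m n : ℤ, u (m, n, Dir.r) 0 = cc (m, n) ∧ u (m, n, Dir.u) 0 = β * cc (m, n) ∧
        u (m, n, Dir.r) l = phase (n * θ) * cc (m + 1, n) ∧
        u (m, n, Dir.u) l = β * (phase (-(m * θ)) * cc (m, n + 1)) := by
  have hβ' : (β : ℂ) ≠ 0 := by exact_mod_cast hβ
  have hp := fun x => phase_mul_phase_neg x
  constructor
  · intro h m n
    obtain ⟨h1, h2, -, -⟩ := h m n
    obtain ⟨-, -, h3, -⟩ := h (m + 1) n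
    obtain ⟨-, -, -, h4⟩ := h m (n + 1)
    rw [add_sub_cancel_right] at h3 h4
    refine ⟨h1, ?_, ?_, ?_⟩
    · rw [← h2]; field_simp
    · rw [← h3, ← mul_assoc, hp, one_mul]
    · rw [← h4]
      field_simp
      linear_combination (-(u (m, n, Dir.u) l)) * hp (m * θ)
  · intro h m n
    obtain ⟨h1, h2, -, -⟩ := h m n
    obtain ⟨-, -, h3, -⟩ := h (m - 1) n
    obtain ⟨-, -, -, h4⟩ := h m (n - 1)
    rw [sub_add_cancel] at h3 h4
    refine ⟨h1, ?_, ?_, ?_⟩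
    · rw [h2]; field_simp
    · rw [h3, ← mul_assoc, mul_comm (phase _), hp, one_mul]
    · rw [h4]
      field_simp
      rw [hp, one_mul]

lemma exists_node_values {u v : Edge → ℝ → ℂ}
    (h : ∀ m n : ℤ, ∃ c : ℂ, VertexValue l θ β u m n c ∧ vertexDeriv l θ β v m n = α * c) :
    ∃ cc : ℤ × ℤ → ℂ, (∀ m n : ℤ, VertexValue l θ β u m n (cc (m, n))) ∧
      ∀ m n : ℤ, vertexDeriv l θ β v m n = α * cc (m, n) := by
  choose c hc using h
  exact ⟨fun i => c i.1 i.2, fun m n => (hc m n).1, fun m n => (hc m n).2⟩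

/-! ### Dirichlet eigenvalues belong to the spectrum of the lattice operator -/

/-- The value at the opposite corner is reached along two paths, each multiplying by ρ twice; the
accumulated phases differ by e^{2πiθ} ≠ 1. -/
lemma eq_zero_of_plaquette (hθ : ∀ k : ℤ, θ ≠ k) {cc : ℤ × ℤ → ℂ} {ρ : ℂ} (hρ : ρ ≠ 0) {m n : ℤ}
    (h1 : phase (n * θ) * cc (m + 1, n) = ρ * cc (m, n))
    (h2 : phase (-((m + 1 : ℤ) * θ)) * cc (m + 1, n + 1) = ρ * cc (m + 1, n))
    (h3 : phase (-(m * θ)) * cc (m, n + 1) = ρ * cc (m, n))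
    (h4 : phase ((n + 1 : ℤ) * θ) * cc (m + 1, n + 1) = ρ * cc (m, n + 1)) : cc (m, n) = 0 := by
  have e1 : phase (n * θ) * phase (-((m + 1 : ℤ) * θ)) * phase (2 * θ) =
      phase (-(m * θ)) * phase ((n + 1 : ℤ) * θ) := by
    simp only [← phase_add]
    congr 1
    push_cast
    ring
  have e2 : (phase (2 * θ) - 1) * (ρ * ρ * cc (m, n)) = 0 := by
    have e3 : phase (n * θ) * phase (-((m + 1 : ℤ) * θ)) * cc (m + 1, n + 1) =
        ρ * ρ * cc (m, n) := by
      linear_combination phase (n * θ) * h2 + ρ * h1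
    have e4 : phase (-(m * θ)) * phase ((n + 1 : ℤ) * θ) * cc (m + 1, n + 1) =
        ρ * ρ * cc (m, n) := by
      linear_combination phase (-(m * θ)) * h4 + ρ * h3
    linear_combination (-phase (2 * θ)) * e3 + e4 + cc (m + 1, n + 1) * e1
  have e5 := (mul_eq_zero.1 e2).resolve_left (sub_ne_zero.2 (phase_two_mul_ne_one hθ))
  exact (mul_eq_zero.1 e5).resolve_left (mul_ne_zero hρ hρ)

/-- Suppose a resolvent exists and apply it to s(·;μ) placed on one edge. As s(l;μ) = 0, every other
edge transports values by the factor ρ = c(l;μ) whatever its slopes. Plaquettes avoiding the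
exceptional edge make both its end values zero, contradicting ∫s² ≠ 0. Only continuity at the nodes
is used. -/
theorem mem_realSpec_of_dirichlet (hl : 0 < l) (hβ : β ≠ 0) (hθ : ∀ k : ℤ, θ ≠ k) {μ : ℝ}
    {ρ sl' : ℂ} (hρ : ρ ≠ 0) (ES : EdgeSolver l V μ ρ 0 sl') :
    μ ∈ realSpec (latticeOp l V α β θ) := by
  classical
  rintro ⟨R, hR, -⟩
  let e₀ : Edge := (0, 0, Dir.r)
  obtain ⟨hd, he⟩ := hR (lp.single 2 e₀ ES.Es)
  set φ := R (lp.single 2 e₀ ES.Es) with hφ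
  have hg := (latticeOp l V α β θ).mem_graph ⟨φ, hd⟩
  rw [latticeOp_graph hl] at hg
  obtain ⟨u, v, w, hrep, hbd⟩ := hg
  obtain ⟨cc, hcc, -⟩ := exists_node_values hbd
  rw [vertexValue_iff hβ] at hcc
  have hk : ∀ e, (latticeOp l V α β θ ⟨φ, hd⟩ : LatticeL2 l) e - (μ : ℂ) • φ e =
      (lp.single 2 e₀ ES.Es : LatticeL2 l) e := fun e => by
    have := congrArg (fun f : LatticeL2 l => f e) he
    exact this
  have hend : ∀ e, u e l = u e 0 * ρ + ρ * ES.Is ((lp.single 2 e₀ ES.Es : LatticeL2 l) e) :=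
    fun e => by
      have := ES.fst_end (hrep e)
      rw [hk e] at this
      simpa using this
  have hend' : ∀ e, e ≠ e₀ → u e l = ρ * u e 0 := fun e hne => by
    have := hend e
    rw [lp.single_apply_ne _ _ _ hne, map_zero] at this
    rw [this]
    ring
  have hβ' : (β : ℂ) ≠ 0 := by exact_mod_cast hβ
  have hup : ∀ m n : ℤ, phase (-(m * θ)) * cc (m, n + 1) = ρ * cc (m, n) := fun m n => by
    obtain ⟨-, h2, -, h4⟩ := hcc m n
    have := hend' (m, n, Dir.u) (by simp [e₀])
    rw [h2, h4] at this
    exact mul_left_cancel₀ hβ' (by linear_combination this)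
  have hright : ∀ m n : ℤ, (m, n) ≠ (0, 0) → phase (n * θ) * cc (m + 1, n) = ρ * cc (m, n) :=
    fun m n hmn => by
      obtain ⟨h1, -, h3, -⟩ := hcc m n
      have := hend' (m, n, Dir.r) (by simpa [e₀] using hmn)
      rwa [h1, h3] at this
  -- The plaquettes with lower left corners (1,0) and (-1,0) do not contain the exceptional edge
  -- from (0,0) to (1,0). The value at (0,0) is then reached along the edge from (-1,0).
  have c10 : cc (1, 0) = 0 := eq_zero_of_plaquette hθ hρ (hright 1 0 (by simp)) (hup (1 + 1) 0)
    (hup 1 0) (hright 1 (0 + 1) (by simp))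
  have cm10 : cc (-1, 0) = 0 := eq_zero_of_plaquette hθ hρ (hright (-1) 0 (by simp))
    (hup (-1 + 1) 0) (hup (-1) 0) (hright (-1) (0 + 1) (by simp))
  have c00 : cc (0, 0) = 0 := by
    have := hright (-1) 0 (by simp)
    rw [cm10, mul_zero] at this
    exact (mul_eq_zero.1 this).resolve_left (phase_ne_zero _)
  obtain ⟨h1, -, h3, -⟩ := hcc 0 0
  have := hend e₀
  rw [lp.single_apply_self] at this
  simp only [e₀] at this
  rw [h1, h3, zero_add, c00, c10, mul_zero, zero_mul, zero_add] at this
  exact mul_ne_zero hρ ES.Is_ne_zero this.symm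

/-! ### Points outside `Σ` and the Dirichlet spectrum belong to the resolvent set -/

/-- The derivative conditions in terms of the boundary values. -/
lemma vertexDeriv_eq (hβ : β ≠ 0) {u v : Edge → ℝ → ℂ} {d₀ d₁ : Edge → ℂ} {cl sl sl' : ℂ}
    (hsl : sl ≠ 0) (hv₀ : ∀ e, v e 0 = (u e l - u e 0 * cl) / sl + d₀ e)
    (hv₁ : ∀ e, v e l = (u e l * sl' - u e 0) / sl + d₁ e) {cc : ℤ × ℤ → ℂ}
    (hcc : ∀ m n : ℤ, VertexValue l θ β u m n (cc (m, n))) (m n : ℤ) :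
    vertexDeriv l θ β v m n - α * cc (m, n) =
      (1 / sl) * ((phase (n * θ) * cc (m + 1, n) + phase (-(n * θ)) * cc (m - 1, n)
        + (β : ℂ) ^ 2 * (phase (-(m * θ)) * cc (m, n + 1) + phase (m * θ) * cc (m, n - 1)))
        - ((1 + (β : ℂ) ^ 2) * (sl' + cl) + α * sl) * cc (m, n))
      + (d₀ (m, n, Dir.r) + β * d₀ (m, n, Dir.u) - phase (-(n * θ)) * d₁ (m - 1, n, Dir.r)
        - β * phase (m * θ) * d₁ (m, n - 1, Dir.u)) := by
  rw [vertexValue_iff hβ] at hcc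
  obtain ⟨h1, h2, h3, h4⟩ := hcc m n
  obtain ⟨g1, -, g3, -⟩ := hcc (m - 1) n
  obtain ⟨-, g2, -, g4⟩ := hcc m (n - 1)
  rw [sub_add_cancel] at g3 g4
  have p1 := phase_mul_phase_neg (n * θ)
  have p2 := phase_mul_phase_neg (m * θ)
  rw [vertexDeriv, hv₀, hv₀, hv₁, hv₁, h1, h2, h3, h4, g1, g2, g3, g4]
  generalize phase (n * θ) = a, phase (-(n * θ)) = a', phase (m * θ) = b,
    phase (-(m * θ)) = b' at p1 p2 ⊢
  field_simp
  linear_combination (-sl' * cc (m, n)) * p1 - (β : ℂ) ^ 2 * sl' * cc (m, n) * p2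

/-- The value at the point `0` of an edge prescribed by a family of node values. -/
def startValue (β : ℝ) : Edge → NodeL2 →L[ℂ] ℂ
  | (m, n, Dir.r) => lp.evalCLM ℂ (fun _ : ℤ × ℤ => ℂ) 2 (m, n)
  | (m, n, Dir.u) => (β : ℂ) • lp.evalCLM ℂ (fun _ : ℤ × ℤ => ℂ) 2 (m, n)

/-- The value at the point `l` of an edge prescribed by a family of node values. -/
def endValue (β θ : ℝ) : Edge → NodeL2 →L[ℂ] ℂ
  | (m, n, Dir.r) => phase (n * θ) • lp.evalCLM ℂ (fun _ : ℤ × ℤ => ℂ) 2 (m + 1, n)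
  | (m, n, Dir.u) =>
    ((β : ℂ) * phase (-(m * θ))) • lp.evalCLM ℂ (fun _ : ℤ × ℤ => ℂ) 2 (m, n + 1)

lemma memℓp_startValue (g : NodeL2) : Memℓp (fun e => startValue β e g) 2 := by
  refine memℓp_edge (lp.memℓp g) (memℓp_of_norm_le (lp.memℓp g) |β| fun i => ?_)
  change ‖(β : ℂ) * g (i.1, i.2)‖ ≤ _
  rw [norm_mul, Complex.norm_real, Real.norm_eq_abs]

lemma memℓp_endValue (g : NodeL2) : Memℓp (fun e => endValue β θ e g) 2 := by
  refine memℓp_edge (memℓp_of_norm_le (memℓp_comp_injective (lp.memℓp g)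
    (translate 1 0).injective) 1 fun i => ?_) (memℓp_of_norm_le (memℓp_comp_injective (lp.memℓp g)
    (translate 0 1).injective) |β| fun i => ?_)
  · change ‖phase (i.2 * θ) * g (i.1 + 1, i.2)‖ ≤ 1 * ‖g (i.1 + 1, i.2 + 0)‖
    rw [norm_mul, phase_norm, add_zero]
  · change ‖(β : ℂ) * phase (-(i.1 * θ)) * g (i.1, i.2 + 1)‖ ≤ |β| * ‖g (i.1 + 0, i.2 + 1)‖
    rw [norm_mul, norm_mul, phase_norm, Complex.norm_real, Real.norm_eq_abs, add_zero, mul_one]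

/-- Γ gathers what the source on the adjacent edges contributes to the derivative sum at each node:
the inhomogeneity of the difference equation. -/
lemma exists_source_clm (β θ : ℝ) (d₀ d₁ : EdgeL2 l →L[ℂ] ℂ) :
    ∃ Γ : LatticeL2 l →L[ℂ] NodeL2, ∀ k m n, Γ k (m, n) =
      d₀ (k (m, n, Dir.r)) + β * d₀ (k (m, n, Dir.u)) - phase (-(n * θ)) * d₁ (k (m - 1, n, Dir.r))
        - β * phase (m * θ) * d₁ (k (m, n - 1, Dir.u)) := by
  let ev : Edge → LatticeL2 l →L[ℂ] EdgeL2 l := fun e => lp.evalCLM ℂ (fun _ : Edge => EdgeL2 l) 2 e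
  have hmem : ∀ (d : EdgeL2 l →L[ℂ] ℂ) (b : ℤ × ℤ → ℂ) (K : ℝ) (τ : ℤ × ℤ → Edge),
      (∀ i, ‖b i‖ ≤ K) → Function.Injective τ → ∀ k : LatticeL2 l,
      Memℓp (fun i => b i * d (k (τ i))) 2 := by
    intro d b K τ hb hτ k
    refine memℓp_of_norm_le (memℓp_comp_injective (lp.memℓp k) hτ) (K * ‖d‖) fun i => ?_
    rw [norm_mul, mul_assoc]
    exact mul_le_mul (hb i) (d.le_opNorm _) (norm_nonneg _) ((norm_nonneg _).trans (hb i))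
  obtain ⟨Γ, hΓ⟩ := exists_clm_of_memℓp (ι := ℤ × ℤ) (E := LatticeL2 l) (F := ℂ)
    (fun i => d₀ ∘L ev (i.1, i.2, Dir.r) + (β : ℂ) • (d₀ ∘L ev (i.1, i.2, Dir.u))
      - phase (-(i.2 * θ)) • (d₁ ∘L ev (i.1 - 1, i.2, Dir.r))
      - ((β : ℂ) * phase (i.1 * θ)) • (d₁ ∘L ev (i.1, i.2 - 1, Dir.u))) fun k => by
    have h1 := hmem d₀ (fun _ => 1) 1 (fun i => (i.1, i.2, Dir.r)) (by simp)
      (by rintro ⟨a, b⟩ ⟨a', b'⟩ h; simpa using h) k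
    have h2 := hmem d₀ (fun _ => (β : ℂ)) |β| (fun i => (i.1, i.2, Dir.u)) (by simp)
      (by rintro ⟨a, b⟩ ⟨a', b'⟩ h; simpa using h) k
    have h3 := hmem d₁ (fun i => phase (-(i.2 * θ))) 1 (fun i => (i.1 - 1, i.2, Dir.r))
      (by simp [phase_norm]) (by rintro ⟨a, b⟩ ⟨a', b'⟩ h; simpa using h) k
    have h4 := hmem d₁ (fun i => (β : ℂ) * phase (i.1 * θ)) |β| (fun i => (i.1, i.2 - 1, Dir.u))
      (by simp [phase_norm]) (by rintro ⟨a, b⟩ ⟨a', b'⟩ h; simpa using h) k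
    simp only [one_mul] at h1
    exact ((h1.add h2).sub h3).sub h4
  exact ⟨Γ, fun k m n => hΓ k (m, n)⟩

/-- Node values solving (η - M)g = sl·Γk determine the end values and so the slopes on every edge,
which defines R. Conversely, the node values of any element of the domain are in ℓ² and satisfy the
same equation, so R is also a left inverse. -/
theorem isResolventPoint_latticeOp (hl : 0 < l) (hβ : β ≠ 0) {x : ℝ} {cl sl sl' : ℂ}
    (hsl : sl ≠ 0) (ES : EdgeSolver l V x cl sl sl')
    (hη : (1 + (β : ℂ) ^ 2) * (sl' + cl) + α * sl ∉ spectrum ℂ (discreteLaplacian θ β)) :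
    IsResolventPoint (latticeOp l V α β θ) x := by
  set η : ℂ := (1 + (β : ℂ) ^ 2) * (sl' + cl) + α * sl with hη'
  set M := discreteLaplacian θ β with hM
  obtain ⟨A, hA⟩ := spectrum.notMem_iff.1 hη
  have hAapp : ∀ g : NodeL2, (A.1 : NodeL2 →L[ℂ] NodeL2) g = η • g - M g := fun g => by
    rw [hA]
    rfl
  have hA1 : ∀ g : NodeL2, η • (A⁻¹.1 : NodeL2 →L[ℂ] NodeL2) g
      - M ((A⁻¹.1 : NodeL2 →L[ℂ] NodeL2) g) = g := fun g => by
    have h : (A.1 * A⁻¹.1) g = g := by rw [A.mul_inv]; rfl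
    rw [← hAapp]
    exact h
  have hA2 : ∀ g : NodeL2, (A⁻¹.1 : NodeL2 →L[ℂ] NodeL2) (η • g - M g) = g := fun g => by
    have h : (A⁻¹.1 * A.1) g = g := by rw [A.inv_mul]; rfl
    rw [← hAapp]
    exact h
  -- Source terms of v(0) and v(l) after solving `fst_end` and `snd_end` for the slopes, possible
  -- since sl ≠ 0.
  let d₀ : EdgeL2 l →L[ℂ] ℂ := ES.Ic - (cl / sl) • ES.Is
  let d₁ : EdgeL2 l →L[ℂ] ℂ := -((1 / sl) • ES.Is)
  obtain ⟨Γ, hΓ⟩ := exists_source_clm β θ d₀ d₁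
  have hv₀ : ∀ {f g : EdgeL2 l} {u v w : ℝ → ℂ}, Represents l V f g u v w →
      v 0 = (u l - u 0 * cl) / sl + d₀ (g - (x : ℂ) • f) := fun {f g u v w} hr => by
    have h := ES.fst_end hr
    change v 0 = _ + (ES.Ic (g - (x : ℂ) • f) - (cl / sl) * ES.Is (g - (x : ℂ) • f))
    field_simp
    linear_combination -h
  have hv₁ : ∀ {f g : EdgeL2 l} {u v w : ℝ → ℂ}, Represents l V f g u v w →
      v l = (u l * sl' - u 0) / sl + d₁ (g - (x : ℂ) • f) := fun {f g u v w} hr => by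
    have h := ES.snd_end hr
    change v l = _ + -((1 / sl) * ES.Is (g - (x : ℂ) • f))
    field_simp
    linear_combination h
  -- the node values of the solution
  let N : LatticeL2 l →L[ℂ] NodeL2 := sl • (A⁻¹.1 ∘L Γ)
  have hNeq : ∀ k, η • N k - M (N k) = sl • Γ k := fun k => by
    have := hA1 (Γ k)
    change η • (sl • (A⁻¹.1 : NodeL2 →L[ℂ] NodeL2) (Γ k))
      - M (sl • (A⁻¹.1 : NodeL2 →L[ℂ] NodeL2) (Γ k)) = sl • Γ k
    rw [map_smul, smul_comm, ← smul_sub, this]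
  let ev : Edge → LatticeL2 l →L[ℂ] EdgeL2 l := fun e => lp.evalCLM ℂ (fun _ : Edge => EdgeL2 l) 2 e
  let a : Edge → LatticeL2 l →L[ℂ] ℂ := fun e => startValue β e ∘L N
  let b : Edge → LatticeL2 l →L[ℂ] ℂ := fun e =>
    (1 / sl) • (endValue β θ e ∘L N - cl • a e) + d₀ ∘L ev e
  have hb_apply : ∀ e k, b e k = (endValue β θ e (N k) - a e k * cl) / sl + d₀ (k e) := by
    intro e k
    change (1 / sl) * (endValue β θ e (N k) - cl * a e k) + d₀ (k e) = _
    ring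
  obtain ⟨R, hR⟩ := exists_clm_of_memℓp (ι := Edge) (E := LatticeL2 l) (F := EdgeL2 l)
    (fun e => (a e).smulRight ES.Ec + (b e).smulRight ES.Es + ES.P ∘L ev e) fun k => by
    have ha : Memℓp (fun e => a e k) 2 := memℓp_startValue (N k)
    have hd : Memℓp (fun e => d₀ (k e)) 2 :=
      memℓp_of_norm_le (lp.memℓp k) ‖d₀‖ fun e => d₀.le_opNorm _
    have he : Memℓp (fun e => endValue β θ e (N k)) 2 := memℓp_endValue (N k)
    have hb : Memℓp (fun e => b e k) 2 :=
      ((he.sub (ha.const_smul cl)).const_smul (1 / sl)).add hd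
    have h1 : Memℓp (fun e => a e k • ES.Ec) 2 :=
      memℓp_of_norm_le ha ‖ES.Ec‖ fun e => by rw [norm_smul, mul_comm]
    have h2 : Memℓp (fun e => b e k • ES.Es) 2 :=
      memℓp_of_norm_le hb ‖ES.Es‖ fun e => by rw [norm_smul, mul_comm]
    have h3 : Memℓp (fun e => ES.P (k e)) 2 :=
      memℓp_of_norm_le (lp.memℓp k) ‖ES.P‖ fun e => ES.P.le_opNorm _
    exact (h1.add h2).add h3
  have hR' : ∀ k e, R k e = a e k • ES.Ec + b e k • ES.Es + ES.P (k e) := fun k e => hR k e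
  have hgraph : ∀ k, (R k, k + (x : ℂ) • R k) ∈ latticeGraph l V α β θ := by
    intro k
    choose u v w hrep hu0 hv0 using fun e => ES.exists_represents (k e) (a e k) (b e k)
    have hrep' : ∀ e, Represents l V (R k e) ((k + (x : ℂ) • R k : LatticeL2 l) e)
        (u e) (v e) (w e) := fun e => by
      have := hrep e
      rw [← hR'] at this
      exact this
    have hk : ∀ e, (k + (x : ℂ) • R k : LatticeL2 l) e - (x : ℂ) • R k e = k e := fun e => by
      change k e + (x : ℂ) • R k e - (x : ℂ) • R k e = k e
      rw [add_sub_cancel_right]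
    -- The initial slope `b` was chosen so that the solution reaches the prescribed value at l.
    have hul : ∀ e, u e l = endValue β θ e (N k) := fun e => by
      have h1 := hv₀ (hrep' e)
      rw [hk, hv0, hu0, hb_apply] at h1
      have h2 := add_right_cancel h1
      rw [div_left_inj' hsl] at h2
      exact (sub_left_inj.1 h2).symm
    have hvv : ∀ m n : ℤ, VertexValue l θ β u m n (N k (m, n)) := by
      rw [vertexValue_iff (cc := fun i => N k i) hβ]
      intro m n
      refine ⟨hu0 _, hu0 _, hul _, ?_⟩
      rw [hul, ← mul_assoc]
      rfl
    refine ⟨u, v, w, hrep', fun m n => ⟨N k (m, n), hvv m n, ?_⟩⟩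
    have h1 := vertexDeriv_eq (α := α) (cc := fun i => N k i) hβ hsl
      (d₀ := fun e => d₀ (k e)) (d₁ := fun e => d₁ (k e))
      (fun e => by have := hv₀ (hrep' e); rwa [hk] at this)
      (fun e => by have := hv₁ (hrep' e); rwa [hk] at this) hvv m n
    rw [← discreteLaplacian_apply, ← hη', ← hΓ] at h1
    have h2 := congrArg (fun g : NodeL2 => g (m, n)) (hNeq k)
    have h3 : η * N k (m, n) - M (N k) (m, n) = sl * Γ k (m, n) := h2
    rw [← sub_eq_zero, h1]
    field_simp
    linear_combination -h3
  refine ⟨R, fun k => ?_, fun y => ?_⟩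
  · have h := hgraph k
    rw [← latticeOp_graph hl] at h
    have hd : R k ∈ (latticeOp l V α β θ).domain := LinearPMap.mem_domain_of_mem_graph h
    refine ⟨hd, ?_⟩
    have h2 : latticeOp l V α β θ ⟨R k, hd⟩ = k + (x : ℂ) • R k :=
      (LinearPMap.mem_graph_snd_inj _ ((latticeOp l V α β θ).mem_graph ⟨R k, hd⟩) h rfl)
    rw [h2, add_sub_cancel_right]
  · obtain ⟨φ, hφ⟩ := y
    have hg := (latticeOp l V α β θ).mem_graph ⟨φ, hφ⟩
    rw [latticeOp_graph hl] at hg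
    set ψ := latticeOp l V α β θ ⟨φ, hφ⟩ with hψ
    obtain ⟨u, v, w, hrep, hbd⟩ := hg
    obtain ⟨cc, hcc, hder⟩ := exists_node_values hbd
    set k : LatticeL2 l := ψ - (x : ℂ) • φ with hk
    have hke : ∀ e, ψ e - (x : ℂ) • φ e = k e := fun e => rfl
    have heq : ∀ e, φ e = u e 0 • ES.Ec + v e 0 • ES.Es + ES.P (k e) := fun e =>
      ES.eq_of_represents (hrep e)
    obtain ⟨K, hK⟩ := ES.norm_le
    have hu_mem : Memℓp (fun e => u e 0) 2 := by
      have h1 : Memℓp (fun e => ES.P (k e)) 2 :=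
        memℓp_of_norm_le (lp.memℓp k) ‖ES.P‖ fun e => ES.P.le_opNorm _
      refine memℓp_of_norm_le ((lp.memℓp φ).sub h1) K fun e => ?_
      have h2 : φ e - ES.P (k e) = u e 0 • ES.Ec + v e 0 • ES.Es := by
        rw [heq e, add_sub_cancel_right]
      change _ ≤ K * ‖φ e - ES.P (k e)‖
      rw [h2]
      exact hK _ _
    have hcc' := (vertexValue_iff hβ).1 hcc
    have hcc_mem : Memℓp cc 2 := by
      have h1 := memℓp_comp_injective hu_mem (τ := fun i : ℤ × ℤ => ((i.1, i.2, Dir.r) : Edge))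
        (by rintro ⟨a, b⟩ ⟨a', b'⟩ h; simpa using h)
      exact memℓp_of_norm_le h1 1 fun i => by
        rw [(hcc' i.1 i.2).1, one_mul]
    let cN : NodeL2 := ⟨cc, hcc_mem⟩
    -- Uniqueness of the node values, by invertibility of η - M.
    have hcN : cN = N k := by
      have h1 : η • cN - M cN = sl • Γ k := by
        ext ⟨m, n⟩
        have h2 := vertexDeriv_eq (α := α) (cc := fun i => cN i) hβ hsl
          (d₀ := fun e => d₀ (k e)) (d₁ := fun e => d₁ (k e))
          (fun e => hv₀ (hrep e)) (fun e => hv₁ (hrep e)) hcc m n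
        rw [← discreteLaplacian_apply, ← hη', ← hΓ, sub_eq_zero.2 (hder m n)] at h2
        change η * cN (m, n) - M cN (m, n) = sl * Γ k (m, n)
        field_simp at h2
        linear_combination h2
      have h3 := hA2 cN
      rw [h1, map_smul] at h3
      exact h3.symm
    change R k = φ
    ext1
    funext e
    have ha : a e k = u e 0 := by
      change startValue β e (N k) = _
      rw [← hcN]
      obtain ⟨m, n, d⟩ := e
      cases d
      · exact (hcc' m n).1.symm
      · exact (hcc' m n).2.1.symm
    have hend : endValue β θ e (N k) = u e l := by
      rw [← hcN]
      obtain ⟨m, n, d⟩ := e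
      cases d
      · exact (hcc' m n).2.2.1.symm
      · rw [(hcc' m n).2.2.2, ← mul_assoc]
        rfl
    have hb : b e k = v e 0 := by
      rw [hb_apply, hend, ha, hv₀ (hrep e)]
      rfl
    rw [hR', ha, hb, ← heq]

end Boundary

/-! ### The discriminant -/

section Discriminant

variable {l α β θ : ℝ} {V : ℝ → ℝ} {c c' s s' : ℝ → ℝ} {x : ℝ}

lemma IsSolution.isSol (hl : 0 ≤ l) {a b : ℂ} {u v : ℝ → ℂ} (h : IsSolution l V x a b u v) :
    IsSol l (fun t => ((V t - x : ℝ) : ℂ)) (fun _ => 0) u v := by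
  obtain ⟨w, hw, he, -, -⟩ := h
  refine ⟨⟨hl, hw.continuousOn_fst.integrableOn_compact isCompact_Icc, hw.fun_eq⟩,
    IsPrimitive.congr_ae (f' := w) ⟨hl, hw.memLp.integrable (by norm_num), hw.deriv_eq⟩ ?_⟩
  filter_upwards [he] with t ht
  push_cast
  linear_combination -ht

lemma IsSol.isSolution (hV : MemLp V 2 (edgeMeasure l)) {u v : ℝ → ℂ}
    (h : IsSol l (fun t => ((V t - x : ℝ) : ℂ)) (fun _ => 0) u v) :
    IsSolution l V x (u 0) (v 0) u v := by
  have h0 : IsSol l (fun t => ((V t - x : ℝ) : ℂ)) (0 : EdgeL2 l) u v := h.congr_ae (by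
    filter_upwards [Lp.coeFn_zero ℂ 2 (edgeMeasure l)] with t ht
    rw [ht, Pi.zero_apply])
  obtain ⟨w, hw⟩ := h0.represents hV (memLp_of_continuousOn h.fst.continuousOn 2).coeFn_toLp
  refine ⟨w, hw.isH2, ?_, rfl, rfl⟩
  have hr := hw.right
  rw [zero_add] at hr
  filter_upwards [hr, hw.left, Lp.coeFn_smul (x : ℂ)
    (memLp_of_continuousOn h.fst.continuousOn 2).toLp] with t h1 h2 h3
  rw [← h1, h3, Pi.smul_apply, h2, smul_eq_mul]

/-- Uniqueness for the initial value problem makes the relation `IsEta` single-valued, with a real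
value at real x. -/
lemma IsFundamental.isEta_iff (hV : MemLp V 2 (edgeMeasure l))
    (h : IsFundamental l (fun t => V t - x) c c' s s') {y : ℂ} :
    IsEta l V α β x y ↔ y = (((1 + β ^ 2) * (s' l + c l) + α * s l : ℝ) : ℂ) := by
  have H := h.ofReal
  have hl := H.cos.nonneg
  have hll : l ∈ Icc (0 : ℝ) l := ⟨hl, le_rfl⟩
  constructor
  · rintro ⟨u₁, v₁, u₂, v₂, h₁, h₂, rfl⟩
    have e₁ := H.eq_of_homogeneous (h₁.isSol hl) hll
    have e₂ := H.eq_of_homogeneous (h₂.isSol hl) hll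
    obtain ⟨-, -, -, i₁, j₁⟩ := h₁
    obtain ⟨-, -, -, i₂, j₂⟩ := h₂
    rw [e₁.1, e₁.2, e₂.1, i₁, j₁, i₂, j₂]
    push_cast
    ring
  · rintro rfl
    have h₁ := H.sin.isSolution hV
    have h₂ := H.cos.isSolution hV
    rw [H.sin_zero, H.sin_deriv_zero] at h₁
    rw [H.cos_zero, H.cos_deriv_zero] at h₂
    exact ⟨_, _, _, _, h₁, h₂, by push_cast; ring⟩

/-- A Dirichlet eigenfunction is v(0)·s with v(0) ≠ 0, so its vanishing at l is that of s. -/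
lemma sin_eq_zero_of_isEigenvalue (hl : 0 < l) {cl sl sl' : ℂ} (ES : EdgeSolver l V x cl sl sl')
    (h : IsEigenvalue (dirichletOp l V) x) : sl = 0 := by
  obtain ⟨⟨f, hf⟩, hne, he⟩ := h
  have hg := (dirichletOp l V).mem_graph ⟨f, hf⟩
  rw [dirichletOp_graph hl, he] at hg
  obtain ⟨u, v, w, hr, h0, h1⟩ := hg
  have e1 := ES.eq_of_represents hr
  have e2 := ES.fst_end hr
  simp only [sub_self, map_zero, h0, h1, zero_smul, zero_add, add_zero, zero_mul, mul_zero,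
    sub_zero] at e1 e2
  refine (mul_eq_zero.1 e2.symm).resolve_left fun hv => hne ?_
  rw [hv, zero_smul] at e1
  exact e1

lemma two_le_add_of_mul_eq_one {a b : ℝ} (ha : 0 < a) (h : b * a = 1) : 2 ≤ a + b := by
  have hb : 0 < b := pos_of_mul_pos_left (by rw [h]; exact one_pos) ha.le
  nlinarith [sq_nonneg (a - b)]

end Discriminant

end MagneticLattice

end

/-! ### Assembly of the main theorem -/

open MagneticLattice in
theorem mainTheorem3 (l : ℝ) (hl : 0 < l) (V : ℝ → ℝ)
    (hV : MeasureTheory.MemLp V 2 (MeasureTheory.volume.restrict (Set.Icc 0 l)))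
    (α β θ : ℝ) (hβ : β ≠ 0) (hθ : ∀ k : ℤ, θ ≠ k) :
    {p : ℝ × ℝ | MagneticLattice.IsGap
      (MagneticLattice.realSpec (MagneticLattice.latticeOp l V α β θ)) p.1 p.2}.Infinite ∧
    (∀ μ : ℝ, MagneticLattice.IsEigenvalue (MagneticLattice.dirichletOp l V) μ →
      ∃ a b : ℝ, MagneticLattice.IsGap (MagneticLattice.bandSet l V α β θ) a b ∧
        μ ∈ Set.Ioo a b ∧
        Set.Ioo a b ∩ MagneticLattice.realSpec (MagneticLattice.latticeOp l V α β θ) = {μ}) ∧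
    ‖MagneticLattice.discreteLaplacian θ β‖ < 2 * (1 + β ^ 2) ∧
    (∀ μ : ℝ, MagneticLattice.IsEigenvalue (MagneticLattice.dirichletOp l V) μ →
      ∃ y : ℂ, MagneticLattice.IsEta l V α β μ y ∧ 2 * (1 + β ^ 2) ≤ ‖y‖) := by
  have hVi : IntegrableOn V (Icc 0 l) := hV.integrable (by norm_num)
  choose C C' S S' H using fun x : ℝ => exists_isFundamental (q := fun t => V t - x) hl.le
    (hVi.sub (integrableOn_const (by simp)))
  have ES := fun x => (exists_edgeSolver hl hV (H x)).some
  have hll : l ∈ Icc (0 : ℝ) l := ⟨hl.le, le_rfl⟩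
  obtain ⟨hC, hS, hS'⟩ := continuous_fundamental H
  set η : ℝ → ℝ := fun x => (1 + β ^ 2) * (S' x l + C x l) + α * S x l with hη
  have hηc : Continuous η := by fun_prop
  have hIsEta : ∀ (x : ℝ) (y : ℂ), IsEta l V α β x y ↔ y = (η x : ℂ) := fun x y =>
    (H x).isEta_iff hV
  have hband : bandSet l V α β θ = {x : ℝ | (η x : ℂ) ∈ spectrum ℂ (discreteLaplacian θ β)} := by
    ext x
    simp [bandSet, hIsEta]
  have hbandc : IsClosed (bandSet l V α β θ) := by
    rw [hband]
    exact (spectrum.isClosed (discreteLaplacian θ β)).preimage (by fun_prop : Continuous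
      fun x => ((η x : ℝ) : ℂ))
  have hB : (0 : ℝ) < 1 + β ^ 2 := by positivity
  have hwr : ∀ x, S x l = 0 → C x l * S' x l = 1 := fun x hx => by
    have := (H x).wronskian hll
    rwa [hx, mul_zero, sub_zero] at this
  have hpos : ∀ x, S x l = 0 → 0 < S' x l → 2 * (1 + β ^ 2) ≤ η x := fun x hx hx' => by
    have h1 := two_le_add_of_mul_eq_one hx' (hwr x hx)
    simp only [hη, hx]
    nlinarith
  have hneg : ∀ x, S x l = 0 → S' x l < 0 → η x ≤ -(2 * (1 + β ^ 2)) := fun x hx hx' => by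
    have h1 := two_le_add_of_mul_eq_one (a := -S' x l) (b := -C x l) (by linarith)
      (by rw [neg_mul_neg]; exact hwr x hx)
    simp only [hη, hx]
    nlinarith
  have hηabs : ∀ x, S x l = 0 → 2 * (1 + β ^ 2) ≤ |η x| := fun x hx => by
    have hne : S' x l ≠ 0 := fun h0 => by simpa [h0] using hwr x hx
    rcases lt_or_gt_of_ne hne with h | h
    · exact le_abs.2 (Or.inr (by linarith [hneg x hx h]))
    · exact le_abs.2 (Or.inl (hpos x hx h))
  have hsign := fun x (hx : S x l = 0) => sign_near_zero hl H hx
  have hzeros := exists_sin_eq_zero_gt hl hVi H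
  obtain ⟨k₀, hk₀, hasym⟩ := hyp_asymptotics hl hVi H α β
  have hfbot : ∃ X, ∀ x ≤ X, 0 < S x l := ⟨-k₀ ^ 2, fun x hx => by
    have h1 : k₀ ≤ Real.sqrt (-x) := Real.le_sqrt_of_sq_le (by linarith)
    have h2 := (hasym _ h1).1
    rwa [Real.sq_sqrt (by nlinarith), neg_neg] at h2⟩
  have hηbot : ∀ X N : ℝ, ∃ x < X, N < η x := fun X N => by
    -- The parts of k yield in turn the asymptotic range, k² > |X|, and kl/2 ≥ |N| + 1.
    set k := k₀ + |X| + 1 + 2 * (|N| + 1) / l with hk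
    have h0 : 0 < 2 * (|N| + 1) / l := by positivity
    have hX := abs_nonneg X
    refine ⟨-k ^ 2, ?_, ?_⟩
    · nlinarith [neg_abs_le X]
    · refine lt_of_lt_of_le ?_ (hasym k (by linarith)).2
      have h1 : 2 * (|N| + 1) / l ≤ k := by linarith
      rw [div_le_iff₀ hl] at h1
      linarith [le_abs_self N]
  have hnorm := norm_discreteLaplacian_lt hβ hθ
  obtain ⟨σ, hσ⟩ := exists_real_mem_spectrum_discreteLaplacian θ β
  have hspec : ∀ y : ℝ, (y : ℂ) ∈ spectrum ℂ (discreteLaplacian θ β) → |y| < 2 * (1 + β ^ 2) :=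
    fun y hy => by
      have h1 := spectrum.norm_le_norm_mul_of_mem hy
      have h2 : ‖(1 : NodeL2 →L[ℂ] NodeL2)‖ ≤ 1 := ContinuousLinearMap.norm_id_le
      rw [Complex.norm_real, Real.norm_eq_abs] at h1
      nlinarith [norm_nonneg (discreteLaplacian θ β)]
  have hzeroSpec : ∀ μ, S μ l = 0 → μ ∈ realSpec (latticeOp l V α β θ) := fun μ hμ => by
    have e := ES μ
    rw [hμ, Complex.ofReal_zero] at e
    refine mem_realSpec_of_dirichlet hl hβ hθ ?_ e
    exact_mod_cast left_ne_zero_of_mul_eq_one (hwr μ hμ)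
  have hres : ∀ x, S x l ≠ 0 → x ∉ bandSet l V α β θ → x ∉ realSpec (latticeOp l V α β θ) :=
    fun x hx hxb => not_not.2 (isResolventPoint_latticeOp hl hβ (by exact_mod_cast hx) (ES x) (by
      rw [hband] at hxb
      intro h
      rw [mem_ofPred_eq] at hxb
      refine hxb ?_
      simp only [hη]
      push_cast
      exact h))
  have hgap : ∀ μ, S μ l = 0 → ∃ a b : ℝ, IsGap (bandSet l V α β θ) a b ∧ μ ∈ Ioo a b ∧
      Ioo a b ∩ realSpec (latticeOp l V α β θ) = {μ} := fun μ hμ => by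
    obtain ⟨a₀, ha₀, haσ, ha⟩ := exists_level_below hS hηc hpos hneg hsign hfbot hηbot
      (hspec σ hσ) hμ
    obtain ⟨b₀, hb₀, hbσ, hb⟩ := exists_level_above hS hηc hpos hneg hsign hzeros (hspec σ hσ) hμ
    have hlevel : ∀ {x}, η x = σ → x ∈ bandSet l V α β θ := fun {x} hx => by
      rwa [hband, mem_ofPred_eq, hx]
    -- |η(μ)| ≥ 2(1+β²) exceeds every spectral value of M.
    have hμb : μ ∉ bandSet l V α β θ := fun h => by
      rw [hband] at h
      exact absurd (hηabs μ hμ) (not_le.2 (hspec _ h))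
    obtain ⟨a, b, hab, hμab, haa, hbb⟩ := exists_isGap_of_isClosed hbandc ha₀ hb₀ (hlevel haσ)
      (hlevel hbσ) hμb
    refine ⟨a, b, hab, hμab, Subset.antisymm ?_ ?_⟩
    · rintro y ⟨hy, hys⟩
      by_contra hne
      refine hres y ?_ (fun h => (Set.disjoint_left.1 hab.2.2.2) hy h) hys
      rcases lt_or_gt_of_ne hne with h | h
      · exact ha y ⟨haa.trans hy.1.le, h⟩
      · exact hb y ⟨h, hy.2.le.trans hbb⟩
    · rintro y rfl
      exact ⟨hμab, hzeroSpec y hμ⟩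
  have hzero : ∀ μ : ℝ, IsEigenvalue (dirichletOp l V) μ → S μ l = 0 := fun μ hμ => by
    exact_mod_cast sin_eq_zero_of_isEigenvalue hl (ES μ) hμ
  refine ⟨?_, fun μ hμ => hgap μ (hzero μ hμ), hnorm, fun μ hμ =>
    ⟨η μ, (hIsEta μ _).2 rfl, ?_⟩⟩
  · have hinf : {μ : ℝ | S μ l = 0}.Infinite := by
      refine Set.infinite_of_not_bddAbove fun ⟨X, hX⟩ => ?_
      obtain ⟨x, hx, hx0⟩ := hzeros X
      exact absurd (hX hx0) (not_le.2 hx)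
    -- Every zero of s(l;·) occurs as the left endpoint of a spectral gap, and there are infinitely
    -- many zeros.
    refine Set.Infinite.of_image Prod.fst (hinf.mono fun μ hμ => ?_)
    obtain ⟨a, b, -, hμab, hab⟩ := hgap μ hμ
    -- A point just right of μ and outside the spectrum. The spectral gap around it cannot begin
    -- anywhere in (μ, x₁], so it begins at μ; a later zero bounds it above.
    set x₁ := (μ + b) / 2 with hx₁
    have hb := hμab.2
    have hnot : ∀ y ∈ Ioc μ x₁, y ∉ realSpec (latticeOp l V α β θ) := fun y hy hys => by
      have : y ∈ ({μ} : Set ℝ) := hab ▸ ⟨⟨hμab.1.trans hy.1, by linarith [hy.2]⟩, hys⟩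
      exact hy.1.ne' this
    obtain ⟨ν, hν, hν0⟩ := hzeros x₁
    obtain ⟨a', b', hgap', hx₁', haa, -⟩ := exists_isGap_of_isClosed
      (isClosed_realSpec (latticeOp l V α β θ)) (show μ < x₁ by linarith) hν
      (hzeroSpec μ hμ) (hzeroSpec ν hν0) (hnot x₁ ⟨by linarith, le_rfl⟩)
    have ha' : a' = μ := by
      by_contra hne
      exact hnot a' ⟨lt_of_le_of_ne haa (Ne.symm hne), hx₁'.1.le⟩ hgap'.2.1
    exact ⟨(a', b'), hgap', ha'⟩
  · rw [Complex.norm_real, Real.norm_eq_abs]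
    exact hηabs μ (hzero μ hμ)
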